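/- Let $n\ge 2$ and, for $0\le k\le n$, let $x_k(q)=\sum_{i=0}^{k-1}\binom{n-1}{i}q^{n-1-i}(1-q)^i$ be the allocation rule, as a function of an agent's quantile $q\in[0,1]$, of the $k$-unit $n$-agent highest-bids-win auction. Let $x=\sum_{k=0}^n w_k x_k$ be a convex combination of these rules that is not constant in $q$ (that is, $w_j>0$ for some $1\le j\le n-1$). Values are given by a continuous strictly increasing function $v:[0,1]\to[0,1]$ of the quantile. Let the continuous strictly increasing function $b:[0,1]\to[0,\infty)$ be a symmetric Bayes–Nash equilibrium, in quantile space, of the first-price auction with allocation rule $x$: for every $q$, the bid $z=b(q)$ maximizes $(v(q)-z)\,x(G(z))$ over all $z\ge 0$, where $G(z)=\Pr[b(U)\le z]$, $U$ uniform on $[0,1]$, is the distribution function of the bids. For $0\le k\le n$ let $P_k=\int_0^1 x_k'(q)\,v(q)(1-q)\,dq$ be the per-agent revenue of the $k$-unit highest-bids-win auction, and let $Z_k(q)=(1-q)x_k'(q)/x'(q)$ for $0<q<1$. Assume $\lim_{q\to1^-}Z_k(q)=0$. Given $N\ge 1$ independent samples from the bid distribution, with order statistics $\hat b^{(1)}\le\dots\le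 \hat b^{(N)}$, let $\hat b(q)=\hat b^{(i)}$ for $q\in[\frac{i-1}{N},\frac iN)$, and let $\hat P_k=\int_0^1 -x(q)Z_k'(q)\,\hat b(q)\,dq$ be the plug-in estimate of $P_k$. Theorem. For every such $k$, $$\Big(\mathbb E\big[\,|\hat P_k-P_k|^2\,\big]\Big)^{1/2}\;\le\;\sqrt{\frac2N}\;\sup_{0<q<1}\left\{\frac{x'(q)}{x(q)}\right\}\;\sup_{0<q<1}\left\{\frac{(1-q)\,x(q)\,x_k'(q)}{x'(q)}\right\},$$ where the suprema may be $+\infty$ and $0\cdot\infty=0$. -/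

import Mathlib

open MeasureTheory ProbabilityTheory Set Filter Topology
open scoped ENNReal

namespace RankAuction

/-- Allocation rule, in quantile space, of the `k`-unit `n`-agent highest-bids-win auction:
the probability that at most `k - 1` of the `n - 1` other agents (with i.i.d. uniform quantiles)
have a quantile greater than `q`. -/
noncomputable def knAlloc (n k : ℕ) (q : ℝ) : ℝ :=
  ∑ i ∈ Finset.range k, ((n - 1).choose i : ℝ) * q ^ (n - 1 - i) * (1 - q) ^ i

/-- Allocation rule of the rank-based auction that runs the `k`-unit auction
with probability `w k`, for `k = 0, …, n`. -/
noncomputable def mixAlloc (n : ℕ) (w : ℕ → ℝ) (q : ℝ) : ℝ :=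
  ∑ k ∈ Finset.range (n + 1), w k * knAlloc n k q

/-- The bid distribution: law of `b q` for a uniformly distributed quantile `q ∈ [0, 1]`. -/
noncomputable def bidDist (b : ℝ → ℝ) : Measure ℝ :=
  (volume.restrict (Icc (0 : ℝ) 1)).map b

/-- Cumulative distribution function of the bids. For a strictly increasing continuous bid
function it is the inverse of `b` on the range of `b`, `0` below and `1` above that range. -/
noncomputable def bidCDF (b : ℝ → ℝ) (z : ℝ) : ℝ :=
  (bidDist b).real (Iic z)

/-- Interim utility in the first-price format: an agent with quantile `q` who bids `z`, while all
other agents follow the bid function `b`, is served with probability `x (b⁻¹ z)` and pays `z`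
when served. -/
noncomputable def firstPriceUtility (n : ℕ) (w : ℕ → ℝ) (v b : ℝ → ℝ) (q z : ℝ) : ℝ :=
  (v q - z) * mixAlloc n w (bidCDF b z)

/-- `b` (as a function of the quantile) is a symmetric Bayes-Nash equilibrium of the first-price
rank-based auction with weights `w` and value function `v`: bids are nonnegative, and no agent
gains by deviating to another nonnegative bid. -/
structure IsFirstPriceBNE (n : ℕ) (w : ℕ → ℝ) (v b : ℝ → ℝ) : Prop where
  nonneg : ∀ q ∈ Icc (0 : ℝ) 1, 0 ≤ b q
  best_response : ∀ q ∈ Icc (0 : ℝ) 1, ∀ z : ℝ, 0 ≤ z →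
    firstPriceUtility n w v b q z ≤ firstPriceUtility n w v b q (b q)

/-- The revenue curve (its values at the two endpoints play no role). -/
def revenueCurve (v : ℝ → ℝ) (q : ℝ) : ℝ := v q * (1 - q)

/-- `P_k`: the per-agent revenue of the `k`-unit `n`-agent highest-bids-win auction. -/
noncomputable def multiUnitRevenue (n : ℕ) (v : ℝ → ℝ) (k : ℕ) : ℝ :=
  ∫ q in (0 : ℝ)..1, deriv (knAlloc n k) q * revenueCurve v q

/-- `Z_k(q) = (1 - q) x_k'(q) / x'(q)`. -/
noncomputable def zFun (n : ℕ) (w : ℕ → ℝ) (k : ℕ) (q : ℝ) : ℝ :=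
  (1 - q) * deriv (knAlloc n k) q / deriv (mixAlloc n w) q

/-- The estimated bid function of a sample `s`: on `[i/N, (i+1)/N)` it equals the
`(i+1)`-st smallest sample point (`i = 0, …, N - 1`). -/
noncomputable def empBid {N : ℕ} (s : Fin N → ℝ) (q : ℝ) : ℝ :=
  if h : ⌊(N : ℝ) * q⌋₊ < N then s (Tuple.sort s ⟨⌊(N : ℝ) * q⌋₊, h⟩) else 0

/-- The plug-in estimate of `P_k`: the estimated bid function is substituted for `b` in
`P_k = E_q[-x(q) Z_k'(q) b(q)]`. -/
noncomputable def plugInEstimate (n : ℕ) (w : ℕ → ℝ) (k : ℕ) {N : ℕ} (s : Fin N → ℝ) : ℝ :=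
  ∫ q in (0 : ℝ)..1, -(mixAlloc n w q * deriv (zFun n w k) q * empBid s q)

/-- `sup_q x'(q) / x(q)`, possibly infinite. -/
noncomputable def supLogDeriv (n : ℕ) (w : ℕ → ℝ) : ℝ≥0∞ :=
  ⨆ q ∈ Ioo (0 : ℝ) 1, ENNReal.ofReal (deriv (mixAlloc n w) q / mixAlloc n w q)

/-- `sup_q (1 - q) x(q) x_k'(q) / x'(q)`, possibly infinite. -/
noncomputable def supWeighted (n : ℕ) (w : ℕ → ℝ) (k : ℕ) : ℝ≥0∞ :=
  ⨆ q ∈ Ioo (0 : ℝ) 1, ENNReal.ofReal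
    ((1 - q) * mixAlloc n w q * deriv (knAlloc n k) q / deriv (mixAlloc n w) q)

end RankAuction

namespace RankAuction

/-! ### Order statistics -/

/-! Let `A = sup x'/x` and `W = sup x Z` with `Z = Z_k`. If `k` is `0` or `n` the error is zero, and
if a supremum is infinite the bound is infinite, because both suprema are positive when `1 ≤ k < n`.
Otherwise finiteness of `A` forces `x(0) > 0` (Grönwall). The incentive constraints give `x b = ∫ v
x'`, hence `b' = (v - b) x'/x`. Finiteness of `W` and `Z → 0` at `1` force the indices with positive
weight to reach both sides of `k`, so `Z` extends to a `C¹` function on `[0,1]` with `Z(1) = 0`. It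
is quasi-concave, since `1/Z` is convex in `log((1-q)/q)` (`min_le_zFun`). Integration by parts
turns `P_k` into `-∫ x Z' b`.

The quantiles of the sampled bids are independent uniforms with empirical distribution function `F`,
and the estimated bid function is `b` composed with the empirical quantile function. Fubini
(`estimate_sub_eq`) writes the error as `∫ b'(r) ∫_r^{F(r)} x Z' dq dr`. Integrating the inner
integral by parts leaves an increment of `Z` weighted by `x(r)`, plus at most `A W |F(r) - r|`,
because `0 ≤ x' Z ≤ A W`.

The second piece contributes at most `A W b(1) / (2√N)` in `L²`, by Cauchy–Schwarz against the
density `b'` and the Bernoulli variance of `F(r)`.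

For the first piece, `b' ≤ A (v - b)`, and `x (v - b)` is a layered integral: `x(r)(v(r) - b(r)) =
∫_0^{v(r)} x(t(y)) dy`, with `t` the generalized inverse of `v`. On the layer of `t = t(y) ≤ r`, the
weight `Z` may be capped at `W / x(t)`; the factor `x(t)/W` normalizes it to `[0,1]`. A second
layering, by the superlevel sets of the capped weight, bounds the piece by `A W` times an average of
measures of quantiles that `F` moves into, or out of, a level set (`exists_pathwise_bound`). By
quasi-concavity each level set is an interval, so these measures are governed by the deviations `u`,
`v` of two uniform order statistics. Their squares are at most `4/3 (u² + v² - u v)`, and Harris'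
inequality bounds the mean of `u v` below by the product of the means (`exists_level_bound`).
Minkowski's inequality carries this to the average. Both layerings are Riemann sums with `M` levels,
and `M` tends to infinity at the end.

It remains to compare constants (`exists_numeric_bound`): the sum of the two pieces fits under `√2`
for `N ≥ 5`. For smaller `N` the cruder estimate `|∫_r^p x Z'| ≤ W + A W |p - r|` and the bound
`b(1) ≤ 1 - e^{-A}` are needed as well. -/

/-- The `i`-th order statistic (counted from `0`) of a finite sample. -/
noncomputable def ordStat {N : ℕ} (i : Fin N) (s : Fin N → ℝ) : ℝ := s (Tuple.sort s i)

/-- The number of sample points that are at most `t`. -/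
noncomputable def countLE {N : ℕ} (s : Fin N → ℝ) (t : ℝ) : ℕ :=
  (Finset.univ.filter fun j => s j ≤ t).card

/-- The duality between order statistics and counting. Measurability, monotonicity and the law of
order statistics are all read off from `countLE` through it. -/
lemma lt_ordStat_iff {N : ℕ} (i : Fin N) (s : Fin N → ℝ) (t : ℝ) :
    t < ordStat i s ↔ countLE s t ≤ i := by
  have h := Tuple.lt_card_le_iff_apply_le_of_monotone (j := i) (a := t) (Tuple.monotone_sort s)
  have hc : (Finset.univ.filter fun j => (s ∘ Tuple.sort s) j ≤ t).card = countLE s t := by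
    unfold countLE
    refine Finset.card_bij (fun j _ => Tuple.sort s j) ?_ ?_ ?_
    · intro a ha; simpa using ha
    · intro a _ b _ hab; exact (Tuple.sort s).injective hab
    · intro b hb; exact ⟨(Tuple.sort s).symm b, by simpa using hb, by simp⟩
  rw [hc] at h
  rw [← not_le, ← not_lt (a := (i : ℕ))]
  exact not_congr h.symm

lemma countLE_mono_right {N : ℕ} (s : Fin N → ℝ) : Monotone (countLE s) := by
  intro a b hab
  refine Finset.card_le_card fun j hj => ?_
  simp only [Finset.mem_filter, Finset.mem_univ, true_and] at hj ⊢
  exact hj.trans hab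

lemma countLE_anti_left {N : ℕ} {s s' : Fin N → ℝ} (h : s ≤ s') (t : ℝ) :
    countLE s' t ≤ countLE s t := by
  refine Finset.card_le_card fun j hj => ?_
  simp only [Finset.mem_filter, Finset.mem_univ, true_and] at hj ⊢
  exact (h j).trans hj

lemma countLE_le {N : ℕ} (s : Fin N → ℝ) (t : ℝ) : countLE s t ≤ N :=
  (Finset.card_le_univ _).trans_eq (Fintype.card_fin N)

lemma countLE_eq_sum {N : ℕ} (s : Fin N → ℝ) (t : ℝ) :
    (countLE s t : ℝ) = ∑ j, if s j ≤ t then (1 : ℝ) else 0 := by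
  simp [countLE]

lemma monotone_ordStat {N : ℕ} (i : Fin N) : Monotone (ordStat i) := by
  intro s s' h
  refine le_of_forall_lt fun t ht => ?_
  rw [lt_ordStat_iff] at ht ⊢
  exact (countLE_anti_left h t).trans ht

lemma measurable_countLE {N : ℕ} (t : ℝ) : Measurable fun s : Fin N → ℝ => countLE s t := by
  have : (fun s : Fin N → ℝ => countLE s t) = fun s => ∑ j, if s j ≤ t then 1 else 0 := by
    ext s; simp [countLE]
  rw [this]
  refine Finset.measurable_sum _ fun j _ => ?_
  exact Measurable.ite (measurableSet_le (measurable_pi_apply j) measurable_const)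
    measurable_const measurable_const

lemma measurable_ordStat {N : ℕ} (i : Fin N) : Measurable (ordStat i) := by
  refine measurable_of_Ioi fun t => ?_
  have : ordStat i ⁻¹' Ioi t = {s | countLE s t ≤ i} := by
    ext s; exact lt_ordStat_iff i s t
  rw [this]
  exact (measurable_countLE t) (measurableSet_Iic)

lemma ordStat_mem {N : ℕ} (i : Fin N) {s : Fin N → ℝ} {S : Set ℝ} (h : ∀ j, s j ∈ S) :
    ordStat i s ∈ S := h _

/-- A permutation sorting `s` also sorts `b ∘ s`, and all sorting permutations yield the same sorted
sample, so ties do no harm. -/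
lemma ordStat_comp {N : ℕ} (i : Fin N) {s : Fin N → ℝ} {b : ℝ → ℝ} {S : Set ℝ}
    (hs : ∀ j, s j ∈ S) (hb : MonotoneOn b S) :
    ordStat i (fun j => b (s j)) = b (ordStat i s) := by
  have hm : Monotone ((b ∘ s) ∘ Tuple.sort s) := fun a c hac =>
    hb (hs _) (hs _) (Tuple.monotone_sort s hac)
  have := (Tuple.comp_sort_eq_comp_iff_monotone (f := b ∘ s) (σ := Tuple.sort s)).2 hm
  exact (congrFun this i).symm

/-! ### Positive correlation of monotone functions of independent variables -/

/-- Chebyshev's symmetrization: for two independent copies, `(f p₁ - f p₂)(g p₁ - g p₂)` is never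
negative, and its mean is twice the covariance. -/
lemma integral_mul_le_of_monotone (ν : Measure ℝ) [IsProbabilityMeasure ν] {f g : ℝ → ℝ}
    (hf : Monotone f) (hg : Monotone g) (C : ℝ) (hfC : ∀ s, |f s| ≤ C) (hgC : ∀ s, |g s| ≤ C) :
    (∫ s, f s ∂ν) * ∫ s, g s ∂ν ≤ ∫ s, f s * g s ∂ν := by
  have fi : Integrable f ν := Integrable.of_bound hf.measurable.aestronglyMeasurable C
    (ae_of_all _ hfC)
  have gi : Integrable g ν := Integrable.of_bound hg.measurable.aestronglyMeasurable C
    (ae_of_all _ hgC)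
  have fgi : Integrable (fun s => f s * g s) ν :=
    fi.mul_bdd hg.measurable.aestronglyMeasurable (ae_of_all _ hgC)
  have h0 : 0 ≤ ∫ p : ℝ × ℝ, (f p.1 - f p.2) * (g p.1 - g p.2) ∂(ν.prod ν) := by
    refine integral_nonneg fun p => ?_
    rcases le_total p.1 p.2 with h | h
    · exact mul_nonneg_of_nonpos_of_nonpos (sub_nonpos.2 (hf h)) (sub_nonpos.2 (hg h))
    · exact mul_nonneg (sub_nonneg.2 (hf h)) (sub_nonneg.2 (hg h))
  have e1 : ∫ p : ℝ × ℝ, (f p.1 - f p.2) * (g p.1 - g p.2) ∂(ν.prod ν)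
      = 2 * (∫ s, f s * g s ∂ν) - 2 * ((∫ s, f s ∂ν) * ∫ s, g s ∂ν) := by
    have a1 : Integrable (fun p : ℝ × ℝ => f p.1 * g p.1) (ν.prod ν) := fgi.comp_fst ν
    have a2 : Integrable (fun p : ℝ × ℝ => f p.2 * g p.2) (ν.prod ν) := fgi.comp_snd ν
    have a3 : Integrable (fun p : ℝ × ℝ => f p.1 * g p.2) (ν.prod ν) := fi.mul_prod gi
    have a4 : Integrable (fun p : ℝ × ℝ => g p.1 * f p.2) (ν.prod ν) := gi.mul_prod fi
    have : (fun p : ℝ × ℝ => (f p.1 - f p.2) * (g p.1 - g p.2)) = fun p =>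
        (f p.1 * g p.1 + f p.2 * g p.2) - (f p.1 * g p.2 + g p.1 * f p.2) := by
      ext p; ring
    have a5 : Integrable (fun p : ℝ × ℝ => f p.1 * g p.1 + f p.2 * g p.2) (ν.prod ν) := a1.add a2
    have a6 : Integrable (fun p : ℝ × ℝ => f p.1 * g p.2 + g p.1 * f p.2) (ν.prod ν) := a3.add a4
    rw [this, integral_sub a5 a6, integral_add a1 a2, integral_add a3 a4,
      integral_prod_mul f g, integral_prod_mul g f, integral_fun_fst (fun s => f s * g s),
      integral_fun_snd (fun s => f s * g s)]
    simp; ring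
  linarith

/-- **Harris' inequality**: monotone bounded functions of independent real variables are
positively correlated. -/
theorem integral_mul_le_of_monotone_pi (ν : Measure ℝ) [IsProbabilityMeasure ν] :
    ∀ (N : ℕ) {f g : (Fin N → ℝ) → ℝ}, Monotone f → Monotone g → Measurable f → Measurable g →
    ∀ C : ℝ, (∀ s, |f s| ≤ C) → (∀ s, |g s| ≤ C) →
    (∫ s, f s ∂(Measure.pi fun _ => ν)) * ∫ s, g s ∂(Measure.pi fun _ => ν)
      ≤ ∫ s, f s * g s ∂(Measure.pi fun _ => ν)
  | 0, f, g, _, _, _, _, C, _, _ => by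
    have hc : ∀ s : Fin 0 → ℝ, s = Fin.elim0 := fun s => Subsingleton.elim _ _
    have h1 : ∀ h : (Fin 0 → ℝ) → ℝ, ∫ s, h s ∂(Measure.pi fun _ => ν) = h Fin.elim0 := by
      intro h
      rw [show h = fun _ => h Fin.elim0 from funext fun s => by rw [hc s]]
      simp
    rw [h1, h1, h1 (fun s => f s * g s)]
  | N + 1, f, g, hf, hg, fm, gm, C, hfC, hgC => by
    -- Split off the first coordinate. The partial integrals over the others are monotone in it, so
    -- the one-variable inequality applies to them; the induction hypothesis handles each fixed
    -- first coordinate.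
    have mp := (measurePreserving_piFinSuccAbove (fun _ : Fin (N + 1) => ν) 0).symm
    have hcons : ∀ p : ℝ × (Fin N → ℝ),
        (MeasurableEquiv.piFinSuccAbove (fun _ : Fin (N + 1) => ℝ) 0).symm p
          = Fin.cons p.1 p.2 := by
      intro p
      simp [MeasurableEquiv.piFinSuccAbove_symm_apply, Fin.insertNthEquiv]
    have key : ∀ h : (Fin (N + 1) → ℝ) → ℝ, Measurable h → (∃ C, ∀ s, |h s| ≤ C) →
        ∫ s, h s ∂(Measure.pi fun _ => ν)
          = ∫ a, ∫ s, h (Fin.cons a s) ∂(Measure.pi fun _ : Fin N => ν) ∂ν := by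
      rintro h hm ⟨D, hD⟩
      rw [← mp.integral_comp', integral_prod]
      · simp_rw [hcons]
      · exact Integrable.of_bound (hm.comp (MeasurableEquiv.measurable _)).aestronglyMeasurable D
          (ae_of_all _ fun p => hD _)
    have cm : ∀ a : ℝ, Measurable fun s : Fin N → ℝ => (Fin.cons a s : Fin (N + 1) → ℝ) := by
      intro a
      refine measurable_pi_lambda _ fun i => ?_
      refine Fin.cases ?_ (fun j => ?_) i
      · simp
      · simpa using measurable_pi_apply j
    have cmono : ∀ a : ℝ, Monotone fun s : Fin N → ℝ => (Fin.cons a s : Fin (N + 1) → ℝ) := by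
      intro a s s' h i
      refine Fin.cases ?_ (fun j => ?_) i
      · simp
      · simpa using h j
    have cmono' : ∀ s : Fin N → ℝ, Monotone fun a : ℝ => (Fin.cons a s : Fin (N + 1) → ℝ) := by
      intro s a a' h i
      refine Fin.cases ?_ (fun j => ?_) i
      · simpa using h
      · simp
    have ib : ∀ h : (Fin (N + 1) → ℝ) → ℝ, Measurable h → (∀ s, |h s| ≤ C) → ∀ a,
        Integrable (fun s => h (Fin.cons a s)) (Measure.pi fun _ : Fin N => ν) :=
      fun h hm hC a => Integrable.of_bound (hm.comp (cm a)).aestronglyMeasurable C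
        (ae_of_all _ fun s => hC _)
    have Fm : ∀ h : (Fin (N + 1) → ℝ) → ℝ, Measurable h → Monotone h → (∀ s, |h s| ≤ C) →
        Monotone fun a => ∫ s, h (Fin.cons a s) ∂(Measure.pi fun _ : Fin N => ν) :=
      fun h hm hmo hC a a' haa => integral_mono (ib h hm hC a) (ib h hm hC a')
        fun s => hmo (cmono' s haa)
    have Fb : ∀ h : (Fin (N + 1) → ℝ) → ℝ, (∀ s, |h s| ≤ C) →
        ∀ a, |∫ s, h (Fin.cons a s) ∂(Measure.pi fun _ : Fin N => ν)| ≤ C := by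
      intro h hC a
      have := norm_integral_le_of_norm_le_const (μ := Measure.pi fun _ : Fin N => ν)
        (f := fun s => h (Fin.cons a s)) (C := C) (ae_of_all _ fun s => hC _)
      simpa using this
    have hC2 : ∀ s, |f s * g s| ≤ C * C := fun s => by
      rw [abs_mul]
      exact mul_le_mul (hfC s) (hgC s) (abs_nonneg _) ((abs_nonneg _).trans (hfC s))
    rw [key f fm ⟨C, hfC⟩, key g gm ⟨C, hgC⟩, key (fun s => f s * g s) (fm.mul gm) ⟨C * C, hC2⟩]
    refine (integral_mul_le_of_monotone ν (Fm f fm hf hfC) (Fm g gm hg hgC) C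
      (Fb f hfC) (Fb g hgC)).trans ?_
    have ihA : ∀ a, (∫ s, f (Fin.cons a s) ∂(Measure.pi fun _ : Fin N => ν))
        * (∫ s, g (Fin.cons a s) ∂(Measure.pi fun _ : Fin N => ν))
        ≤ ∫ s, f (Fin.cons a s) * g (Fin.cons a s) ∂(Measure.pi fun _ : Fin N => ν) := fun a =>
      integral_mul_le_of_monotone_pi ν N (hf.comp (cmono a)) (hg.comp (cmono a))
        (fm.comp (cm a)) (gm.comp (cm a)) C (fun s => hfC _) (fun s => hgC _)
    refine integral_mono ?_ ?_ ihA
    · refine Integrable.of_bound (((Fm f fm hf hfC).measurable.mul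
        (Fm g gm hg hgC).measurable).aestronglyMeasurable) (C * C) (ae_of_all _ fun a => ?_)
      rw [Real.norm_eq_abs, abs_mul]
      exact mul_le_mul (Fb f hfC a) (Fb g hgC a) (abs_nonneg _) ((abs_nonneg _).trans (Fb f hfC a))
    · have : Integrable (fun s => f s * g s) (Measure.pi fun _ : Fin (N + 1) => ν) :=
        Integrable.of_bound (fm.mul gm).aestronglyMeasurable (C * C) (ae_of_all _ hC2)
      have := (mp.integrable_comp_emb (MeasurableEquiv.measurableEmbedding _)).2 this
      refine this.integral_prod_left.congr (ae_of_all _ fun a => ?_)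
      simp only [Function.comp_apply, hcons]

/-! ### Moments of uniform order statistics -/

/-- Integration by parts passes from `m` to `m + 1`: the primitive `t^(m+1) (1-t)^(N-m)` vanishes at
both ends, so all Bernstein polynomials of degree `N` have the same integral. -/
lemma integral_bernstein (N : ℕ) : ∀ m ≤ N,
    ∫ t in (0 : ℝ)..1, (N.choose m : ℝ) * t ^ m * (1 - t) ^ (N - m) = 1 / (N + 1)
  | 0, _ => by
    have := intervalIntegral.integral_comp_sub_left (a := (0 : ℝ)) (b := 1) (fun t : ℝ => t ^ N) 1
    simp only [Nat.choose_zero_right, Nat.cast_one, pow_zero, one_mul, Nat.sub_zero]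
    rw [this]
    simp [integral_pow]
  | m + 1, hm => by
    have ih := integral_bernstein N m (by omega)
    have hd : ∀ t ∈ uIcc (0 : ℝ) 1, HasDerivAt (fun t : ℝ => t ^ (m + 1) * (1 - t) ^ (N - m))
        ((m + 1) * t ^ m * (1 - t) ^ (N - m)
          - (N - m : ℕ) * t ^ (m + 1) * (1 - t) ^ (N - (m + 1))) t := by
      intro t _
      have h1 := (hasDerivAt_pow (m + 1) t)
      have h2 := ((hasDerivAt_id t).const_sub 1).fun_pow (N - m)
      have := h1.fun_mul h2
      refine this.congr_deriv ?_
      simp only [Nat.sub_sub, id, Nat.add_sub_cancel]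
      push_cast
      ring
    have hi := intervalIntegral.integral_eq_sub_of_hasDerivAt hd
      (Continuous.intervalIntegrable (by fun_prop) _ _)
    have hNm : N - m ≠ 0 := by omega
    simp only [sub_self, zero_pow hNm, mul_zero, zero_pow (Nat.succ_ne_zero m), zero_mul] at hi
    rw [intervalIntegral.integral_sub (Continuous.intervalIntegrable (by fun_prop) _ _)
      (Continuous.intervalIntegrable (by fun_prop) _ _)] at hi
    simp only [mul_assoc, intervalIntegral.integral_const_mul] at hi ih ⊢
    have hc : (N.choose (m + 1) : ℝ) * (m + 1) = N.choose m * (N - m : ℕ) := by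
      exact_mod_cast Nat.choose_succ_right_eq N m
    have hm0 : (m + 1 : ℝ) ≠ 0 := by positivity
    have hb : ∫ t in (0 : ℝ)..1, t ^ m * (1 - t) ^ (N - m)
        = (N - m : ℕ) * (∫ t in (0 : ℝ)..1, t ^ (m + 1) * (1 - t) ^ (N - (m + 1))) / (m + 1) := by
      field_simp
      linarith
    rw [hb] at ih
    rw [← ih]
    field_simp
    linear_combination (∫ t in (0 : ℝ)..1, t ^ (m + 1) * (1 - t) ^ (N - (m + 1))) * hc

/-- Multiplication by `t` turns a Bernstein polynomial of degree `N` into a multiple of one of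
degree `N + 1`. -/
lemma integral_bernstein_mul (N m : ℕ) (hm : m ≤ N) :
    ∫ t in (0 : ℝ)..1, 2 * t * ((N.choose m : ℝ) * t ^ m * (1 - t) ^ (N - m))
      = 2 * (m + 1) / ((N + 1) * (N + 2)) := by
  have h := integral_bernstein (N + 1) (m + 1) (by omega)
  have hc : ((N + 1 : ℕ) : ℝ) * N.choose m = (N + 1).choose (m + 1) * (m + 1 : ℕ) := by
    exact_mod_cast Nat.add_one_mul_choose_eq N m
  push_cast at hc h
  have : ∀ t : ℝ, 2 * t * ((N.choose m : ℝ) * t ^ m * (1 - t) ^ (N - m))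
      = 2 * (m + 1) / (N + 1) *
        (((N + 1).choose (m + 1) : ℝ) * t ^ (m + 1) * (1 - t) ^ (N + 1 - (m + 1))) := by
    intro t
    rw [Nat.add_sub_add_right]
    have : (N + 1 : ℝ) ≠ 0 := by positivity
    field_simp
    linear_combination t * t ^ m * (1 - t) ^ (N - m) * hc
  simp_rw [this]
  simp only [Nat.add_sub_add_right] at h ⊢
  rw [intervalIntegral.integral_const_mul, h]
  have : (N + 1 : ℝ) ≠ 0 := by positivity
  have : (N + 2 : ℝ) ≠ 0 := by positivity
  have : (N + 1 + 1 : ℝ) ≠ 0 := by positivity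
  field_simp
  ring

/-- A sample of `N` independent uniform random variables. -/
structure IsUniformSample {Ω : Type*} [MeasurableSpace Ω] (μ : Measure Ω) {N : ℕ}
    (U : Fin N → Ω → ℝ) : Prop where
  meas : ∀ i, Measurable (U i)
  indep : iIndepFun U μ
  law : ∀ i, μ.map (U i) = volume.restrict (Icc (0 : ℝ) 1)
  mem : ∀ i ω, U i ω ∈ Icc (0 : ℝ) 1

namespace IsUniformSample

variable {Ω : Type*} [MeasurableSpace Ω] {μ : Measure Ω} {N : ℕ} {U : Fin N → Ω → ℝ}

lemma measurable_sample (hU : IsUniformSample μ U) : Measurable fun ω j => U j ω :=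
  measurable_pi_lambda _ hU.meas

lemma prob_le (hU : IsUniformSample μ U) (i : Fin N) {t : ℝ} (ht : t ∈ Icc (0 : ℝ) 1) :
    μ (U i ⁻¹' Iic t) = ENNReal.ofReal t := by
  rw [← Measure.map_apply (hU.meas i) measurableSet_Iic, hU.law,
    Measure.restrict_apply measurableSet_Iic]
  have : Iic t ∩ Icc (0 : ℝ) 1 = Icc 0 t := by
    ext s; simp only [mem_inter_iff, mem_Iic, mem_Icc]
    constructor
    · rintro ⟨a, b, c⟩; exact ⟨b, a⟩
    · rintro ⟨a, b⟩; exact ⟨b, a, b.trans ht.2⟩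
  rw [this]; simp

variable [IsProbabilityMeasure μ]

lemma prob_gt (hU : IsUniformSample μ U) (i : Fin N) {t : ℝ} (ht : t ∈ Icc (0 : ℝ) 1) :
    μ (U i ⁻¹' Ioi t) = ENNReal.ofReal (1 - t) := by
  have h : U i ⁻¹' Ioi t = (U i ⁻¹' Iic t)ᶜ := by rw [← preimage_compl, compl_Iic]
  rw [h, prob_compl_eq_one_sub (hU.meas i measurableSet_Iic), hU.prob_le i ht,
    ENNReal.ofReal_sub _ ht.1, ENNReal.ofReal_one]

/-- The event splits according to which `m`-element set of sample points lies in `Iic t`;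
independence gives each part the same product probability. -/
lemma prob_countLE_eq (hU : IsUniformSample μ U) {t : ℝ} (ht : t ∈ Icc (0 : ℝ) 1) (m : ℕ) :
    μ.real {ω | countLE (fun j => U j ω) t = m} = (N.choose m : ℝ) * t ^ m * (1 - t) ^ (N - m) := by
  classical
  have hset : {ω | countLE (fun j => U j ω) t = m} =
      ⋃ S ∈ Finset.powersetCard m (Finset.univ : Finset (Fin N)),
        ⋂ j ∈ (Finset.univ : Finset (Fin N)), U j ⁻¹' (if j ∈ S then Iic t else Ioi t) := by
    ext ω
    simp only [mem_ofPred_eq, mem_iUnion, Finset.mem_powersetCard, Finset.subset_univ, true_and,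
      mem_iInter, Finset.mem_univ, forall_true_left, exists_prop, mem_preimage, countLE]
    constructor
    · intro h
      refine ⟨_, h, fun j => ?_⟩
      by_cases hj : U j ω ≤ t
      · simp [hj]
      · simp [hj, not_le.1 hj]
    · rintro ⟨S, hS, h⟩
      rw [← hS]
      congr 1
      ext j
      have := h j
      by_cases hj : j ∈ S
      · simpa [hj] using this
      · simpa [hj] using this
  have hmeas : ∀ S : Finset (Fin N), MeasurableSet
      (⋂ j ∈ (Finset.univ : Finset (Fin N)), U j ⁻¹' (if j ∈ S then Iic t else Ioi t)) := by
    intro S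
    refine Finset.measurableSet_biInter _ fun j _ => hU.meas j ?_
    split_ifs
    exacts [measurableSet_Iic, measurableSet_Ioi]
  have hprob : ∀ S ∈ Finset.powersetCard m (Finset.univ : Finset (Fin N)), μ.real
      (⋂ j ∈ (Finset.univ : Finset (Fin N)), U j ⁻¹' (if j ∈ S then Iic t else Ioi t))
        = t ^ m * (1 - t) ^ (N - m) := by
    intro S hS
    have hS' := (Finset.mem_powersetCard.1 hS).2
    rw [measureReal_def, hU.indep.measure_inter_preimage_eq_mul]
    · rw [ENNReal.toReal_prod]
      have : ∀ j, (μ (U j ⁻¹' (if j ∈ S then Iic t else Ioi t))).toReal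
          = if j ∈ S then t else 1 - t := by
        intro j
        split_ifs
        · rw [hU.prob_le j ht, ENNReal.toReal_ofReal ht.1]
        · rw [hU.prob_gt j ht, ENNReal.toReal_ofReal (by linarith [ht.2])]
      simp_rw [this]
      rw [Finset.prod_ite, Finset.prod_const, Finset.prod_const]
      have h1 : (Finset.univ.filter fun j => j ∈ S) = S := by ext; simp
      have h2 : (Finset.univ.filter fun j => j ∉ S).card = N - m := by
        have : (Finset.univ.filter fun j => j ∉ S) = Sᶜ := by ext; simp
        rw [this, Finset.card_compl, Fintype.card_fin, hS']
      rw [h1, h2, hS']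
    · intro j _
      split_ifs
      exacts [measurableSet_Iic, measurableSet_Ioi]
  rw [hset, measureReal_biUnion_finset _ fun S _ => hmeas S, Finset.sum_congr rfl hprob,
    Finset.sum_const, Finset.card_powersetCard, Finset.card_univ, Fintype.card_fin, nsmul_eq_mul,
    mul_assoc]
  intro S _ T _ hST
  rw [Function.onFun, Set.disjoint_left]
  intro ω h1 h2
  apply hST
  simp only [mem_iInter, Finset.mem_univ, forall_true_left, mem_preimage] at h1 h2
  ext j
  have a := h1 j
  have b := h2 j
  by_cases hs : j ∈ S <;> by_cases ht : j ∈ T <;> simp_all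
  · linarith
  · linarith

lemma prob_lt_ordStat (hU : IsUniformSample μ U) {t : ℝ} (ht : t ∈ Icc (0 : ℝ) 1) (i : Fin N) :
    μ.real {ω | t < ordStat i fun j => U j ω}
      = ∑ m ∈ Finset.range (i + 1), (N.choose m : ℝ) * t ^ m * (1 - t) ^ (N - m) := by
  have hset : {ω | t < ordStat i fun j => U j ω} =
      ⋃ m ∈ Finset.range ((i : ℕ) + 1), {ω | countLE (fun j => U j ω) t = m} := by
    ext ω
    simp [lt_ordStat_iff]
  rw [hset, measureReal_biUnion_finset]
  · exact Finset.sum_congr rfl fun m _ => hU.prob_countLE_eq ht m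
  · intro a _ b _ hab
    rw [Function.onFun, Set.disjoint_left]
    intro ω h1 h2
    exact hab (h1.symm.trans h2)
  · intro m _
    exact ((measurable_countLE t).comp hU.measurable_sample) (measurableSet_singleton m)

end IsUniformSample

/-- Layer-cake formula for a random variable with values in the unit interval. -/
lemma integral_primitive_eq {Ω : Type*} [MeasurableSpace Ω] {μ : Measure Ω}
    [IsProbabilityMeasure μ] {X : Ω → ℝ} (hX : Measurable X) (hX01 : ∀ ω, X ω ∈ Icc (0 : ℝ) 1)
    {g : ℝ → ℝ} (hg : Continuous g) :
    ∫ ω, (∫ t in (0 : ℝ)..X ω, g t) ∂μ = ∫ t in (0 : ℝ)..1, g t * μ.real {ω | t < X ω} := by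
  have h1 : ∀ ω, (∫ t in (0 : ℝ)..X ω, g t)
      = ∫ t in Ioc (0 : ℝ) 1, (if t < X ω then g t else 0) := by
    intro ω
    rw [intervalIntegral.integral_of_le (hX01 ω).1, integral_Ioc_eq_integral_Ioo]
    have : ∀ t, (if t < X ω then g t else 0) = (Iio (X ω)).indicator g t := by
      intro t; simp [indicator]
    simp_rw [this]
    rw [setIntegral_indicator measurableSet_Iio]
    congr 2
    ext t
    simp only [mem_Ioo, mem_inter_iff, mem_Ioc, mem_Iio]
    constructor
    · rintro ⟨a, b⟩; exact ⟨⟨a, (b.le.trans (hX01 ω).2)⟩, b⟩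
    · rintro ⟨⟨a, _⟩, b⟩; exact ⟨a, b⟩
  have hms : MeasurableSet {p : Ω × ℝ | p.2 < X p.1} :=
    measurableSet_lt measurable_snd (hX.comp measurable_fst)
  have hi : Integrable (Function.uncurry fun ω t => if t < X ω then g t else 0)
      (μ.prod (volume.restrict (Ioc (0 : ℝ) 1))) := by
    have : Integrable (fun p : Ω × ℝ => g p.2) (μ.prod (volume.restrict (Ioc (0 : ℝ) 1))) := by
      have : Integrable g (volume.restrict (Ioc (0 : ℝ) 1)) :=
        (hg.integrableOn_Icc).mono_set Ioc_subset_Icc_self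
      exact this.comp_snd μ
    refine (this.indicator hms).congr (ae_of_all _ fun p => ?_)
    simp [Function.uncurry, indicator]
  simp_rw [h1]
  rw [integral_integral_swap hi, intervalIntegral.integral_of_le zero_le_one]
  refine integral_congr_ae (ae_of_all _ fun t => ?_)
  have : ∀ ω, (if t < X ω then g t else 0) = {ω | t < X ω}.indicator (fun _ => g t) ω := by
    intro ω; simp [indicator]
  simp_rw [this]
  rw [integral_indicator_const _ (measurableSet_lt measurable_const hX)]
  simp [mul_comm]

namespace IsUniformSample

variable {Ω : Type*} [MeasurableSpace Ω] {μ : Measure Ω} {N : ℕ} {U : Fin N → Ω → ℝ}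

lemma measurable_ordStat (hU : IsUniformSample μ U) (i : Fin N) :
    Measurable fun ω => ordStat i fun j => U j ω :=
  (RankAuction.measurable_ordStat i).comp hU.measurable_sample

variable [IsProbabilityMeasure μ]

/-- By the layer-cake formula this integrates a binomial tail, which consists of `i + 1` Bernstein
polynomials of equal integral. -/
lemma integral_ordStat (hU : IsUniformSample μ U) (i : Fin N) :
    ∫ ω, ordStat i (fun j => U j ω) ∂μ = (i + 1) / (N + 1) := by
  have h := integral_primitive_eq (μ := μ) (hU.measurable_ordStat i)
    (fun ω => ordStat_mem i fun j => hU.mem j ω) (g := fun _ => 1) continuous_const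
  simp only [intervalIntegral.integral_const, sub_zero, smul_eq_mul, mul_one, one_mul] at h
  rw [h, intervalIntegral.integral_congr (g := fun t => ∑ m ∈ Finset.range ((i : ℕ) + 1),
    (N.choose m : ℝ) * t ^ m * (1 - t) ^ (N - m))]
  · rw [intervalIntegral.integral_finsetSum
      fun m _ => Continuous.intervalIntegrable (by fun_prop) _ _]
    rw [Finset.sum_congr rfl fun m hm => integral_bernstein N m
      (by have := Finset.mem_range.1 hm; have := i.2; omega)]
    simp; ring
  · intro t ht
    rw [uIcc_of_le zero_le_one] at ht
    exact hU.prob_lt_ordStat ht i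

lemma integral_ordStat_sq (hU : IsUniformSample μ U) (i : Fin N) :
    ∫ ω, ordStat i (fun j => U j ω) ^ 2 ∂μ = (i + 1) * (i + 2) / ((N + 1) * (N + 2)) := by
  have h := integral_primitive_eq (μ := μ) (hU.measurable_ordStat i)
    (fun ω => ordStat_mem i fun j => hU.mem j ω) (g := fun t => 2 * t) (by fun_prop)
  have h2 : ∀ a : ℝ, ∫ t in (0 : ℝ)..a, 2 * t = a ^ 2 := by
    intro a
    rw [intervalIntegral.integral_const_mul, integral_id]; ring
  simp only [h2] at h
  rw [h, intervalIntegral.integral_congr (g := fun t => ∑ m ∈ Finset.range ((i : ℕ) + 1),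
    2 * t * ((N.choose m : ℝ) * t ^ m * (1 - t) ^ (N - m)))]
  · rw [intervalIntegral.integral_finsetSum
      fun m _ => Continuous.intervalIntegrable (by fun_prop) _ _]
    rw [Finset.sum_congr rfl fun m hm => integral_bernstein_mul N m
      (by have := Finset.mem_range.1 hm; have := i.2; omega)]
    have : ∀ k : ℕ, ∑ m ∈ Finset.range k, (2 * ((m : ℝ) + 1) / ((N + 1) * (N + 2)))
        = k * (k + 1) / ((N + 1) * (N + 2)) := by
      intro k
      induction k with
      | zero => simp
      | succ k ih => rw [Finset.sum_range_succ, ih]; push_cast; ring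
    rw [this]; push_cast; ring
  · intro t ht
    rw [uIcc_of_le zero_le_one] at ht
    simp only
    rw [hU.prob_lt_ordStat ht i, Finset.mul_sum]

/-- Order statistics are monotone in each sample point, so Harris' inequality makes them positively
correlated; their joint law is never computed. -/
lemma integral_ordStat_mul_le (hU : IsUniformSample μ U) (i j : Fin N) :
    (∫ ω, ordStat i (fun j => U j ω) ∂μ) * ∫ ω, ordStat j (fun j => U j ω) ∂μ
      ≤ ∫ ω, ordStat i (fun j => U j ω) * ordStat j (fun j => U j ω) ∂μ := by
  let ν : Measure ℝ := volume.restrict (Icc (0 : ℝ) 1)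
  have hν : IsProbabilityMeasure ν := ⟨by simp [ν]⟩
  have hlaw : μ.map (fun ω j => U j ω) = Measure.pi fun _ : Fin N => ν := by
    rw [(iIndepFun_iff_map_fun_eq_pi_map fun i => (hU.meas i).aemeasurable).1 hU.indep]
    congr 1
    funext i
    exact hU.law i
  -- Truncation to `[0,1]` is monotone and leaves the sample unchanged; it only supplies the global
  -- bound that Harris' inequality requires.
  let c : (Fin N → ℝ) → (Fin N → ℝ) := fun s j => max 0 (min 1 (s j))
  have hcm : Monotone c := fun s s' h j => max_le_max le_rfl (min_le_min le_rfl (h j))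
  have hcmeas : Measurable c := measurable_pi_lambda _ fun j =>
    measurable_const.max (measurable_const.min (measurable_pi_apply j))
  have hc1 : ∀ (i : Fin N) s, |ordStat i (c s)| ≤ 1 := by
    intro i s
    have : ordStat i (c s) ∈ Icc (0 : ℝ) 1 :=
      ordStat_mem i fun j => ⟨le_max_left _ _, max_le zero_le_one (min_le_left _ _)⟩
    rw [abs_le]; constructor <;> linarith [this.1, this.2]
  have hcU : ∀ ω, c (fun j => U j ω) = fun j => U j ω := by
    intro ω; funext j
    have := hU.mem j ω
    simp only [c]
    rw [min_eq_right this.2, max_eq_right this.1]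
  have key := integral_mul_le_of_monotone_pi ν N ((monotone_ordStat i).comp hcm)
    ((monotone_ordStat j).comp hcm) ((RankAuction.measurable_ordStat i).comp hcmeas)
    ((RankAuction.measurable_ordStat j).comp hcmeas) 1 (hc1 i) (hc1 j)
  have m1 := (RankAuction.measurable_ordStat i).comp hcmeas
  have m2 := (RankAuction.measurable_ordStat j).comp hcmeas
  have m12 : Measurable fun s => (ordStat i ∘ c) s * (ordStat j ∘ c) s := m1.mul m2
  rw [← hlaw, integral_map hU.measurable_sample.aemeasurable m1.aestronglyMeasurable,
    integral_map hU.measurable_sample.aemeasurable m2.aestronglyMeasurable,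
    integral_map hU.measurable_sample.aemeasurable m12.aestronglyMeasurable] at key
  simpa only [Function.comp_apply, hcU] using key

/-- Mean squared deviation of the empirical distribution function. -/
lemma integral_countLE_sub_sq (hU : IsUniformSample μ U) {t : ℝ} (ht : t ∈ Icc (0 : ℝ) 1) :
    ∫ ω, ((countLE (fun j => U j ω) t : ℝ) - N * t) ^ 2 ∂μ = N * (t * (1 - t)) := by
  let Y : Fin N → Ω → ℝ := fun j ω => if U j ω ≤ t then 1 else 0
  have hY : ∀ j, Y j = (U j ⁻¹' Iic t).indicator 1 := by
    intro j; ext ω; simp [Y, indicator]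
  have hYm : ∀ j, Measurable (Y j) := fun j => by
    rw [hY]; exact measurable_one.indicator (hU.meas j measurableSet_Iic)
  have hYb : ∀ j ω, |Y j ω| ≤ 1 := fun j ω => by
    simp only [Y]; split_ifs <;> simp
  have hYL : ∀ j, MemLp (Y j) 2 μ := fun j =>
    MemLp.of_bound (hYm j).aestronglyMeasurable 1 (ae_of_all _ (hYb j))
  have hYi : ∀ j, ∫ ω, Y j ω ∂μ = t := fun j => by
    rw [hY, integral_indicator_one (hU.meas j measurableSet_Iic), measureReal_def,
      hU.prob_le j ht, ENNReal.toReal_ofReal ht.1]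
  have hYv : ∀ j, variance (Y j) μ = t * (1 - t) := fun j => by
    rw [variance_eq_sub (hYL j), hYi]
    have : (Y j ^ 2) = Y j := by
      ext ω; simp only [Y, Pi.pow_apply]; split_ifs <;> simp
    rw [this, hYi]; ring
  have hind : iIndepFun Y μ := by
    have := hU.indep.comp (fun _ (s : ℝ) => if s ≤ t then (1 : ℝ) else 0) fun _ =>
      Measurable.ite measurableSet_Iic measurable_const measurable_const
    exact this
  have hvar := IndepFun.variance_sum (μ := μ) (X := Y) (s := Finset.univ) (fun j _ => hYL j)
    (fun i _ j _ hij => hind.indepFun hij)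
  simp only [hYv, Finset.sum_const, Finset.card_univ, Fintype.card_fin, nsmul_eq_mul] at hvar
  rw [← hvar, variance_eq_integral]
  · have hs : ∫ ω, (∑ j, Y j) ω ∂μ = N * t := by
      simp only [Finset.sum_apply]
      rw [integral_finsetSum _ fun j _ => (hYL j).integrable one_le_two]
      simp [hYi]
    rw [hs]
    simp only [Finset.sum_apply, Y, countLE_eq_sum]
  · rw [Finset.sum_fn]
    exact (Finset.measurable_sum _ fun j _ => hYm j).aemeasurable

end IsUniformSample

/-! ### Level sets under the empirical distribution function -/

/-- The empirical distribution function of a sample. -/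
noncomputable def ecdf {N : ℕ} (s : Fin N → ℝ) (r : ℝ) : ℝ := countLE s r / N

lemma ecdf_mem {N : ℕ} (s : Fin N → ℝ) (r : ℝ) : ecdf s r ∈ Icc (0 : ℝ) 1 :=
  ⟨by unfold ecdf; positivity,
    div_le_one_of_le₀ (by exact_mod_cast countLE_le s r) (Nat.cast_nonneg _)⟩

/-- The set of quantiles that the empirical distribution function moves into `I`. -/
def movedInto {N : ℕ} (s : Fin N → ℝ) (I : Set ℝ) : Set ℝ :=
  {r | r ∈ Icc (0 : ℝ) 1 ∧ ecdf s r ∈ I ∧ r ∉ I}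

/-- The set of quantiles that the empirical distribution function moves out of `I`. -/
def movedOut {N : ℕ} (s : Fin N → ℝ) (I : Set ℝ) : Set ℝ :=
  {r | r ∈ Icc (0 : ℝ) 1 ∧ r ∈ I ∧ ecdf s r ∉ I}

/-- The empirical distribution function is a step function with values in multiples of `1/N`, so the
preimage of a ray is a ray ending at one order statistic. The index depends on `β` alone, not on the
sample. -/
lemma ecdf_lt_iff {N : ℕ} (s : Fin N → ℝ) {β : ℝ} {j : Fin N} (h1 : (j : ℝ) < N * β)
    (h2 : N * β ≤ j + 1) (r : ℝ) : ecdf s r < β ↔ r < ordStat j s := by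
  have hN : (0 : ℝ) < N := by exact_mod_cast j.pos
  rw [ecdf, div_lt_iff₀ hN, lt_ordStat_iff, mul_comm]
  constructor
  · intro h
    have : (countLE s r : ℝ) < (j : ℕ) + 1 := h.trans_le h2
    exact Nat.lt_succ_iff.1 (by exact_mod_cast this)
  · intro h
    exact lt_of_le_of_lt (by exact_mod_cast h) h1

lemma lt_ecdf_iff {N : ℕ} (s : Fin N → ℝ) {α : ℝ} {i : Fin N} (h1 : (i : ℝ) ≤ N * α)
    (h2 : N * α < i + 1) (r : ℝ) : α < ecdf s r ↔ ordStat i s ≤ r := by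
  have hN : (0 : ℝ) < N := by exact_mod_cast i.pos
  rw [← not_lt (b := ordStat i s), lt_ordStat_iff, ecdf, lt_div_iff₀ hN, mul_comm, ← not_le,
    not_iff_not]
  constructor
  · intro h
    have : (countLE s r : ℝ) < (i : ℕ) + 1 := lt_of_le_of_lt h h2
    exact Nat.lt_succ_iff.1 (by exact_mod_cast this)
  · intro h
    exact le_trans (by exact_mod_cast h) h1

lemma exists_upper_index {N : ℕ} {β : ℝ} (h0 : 0 < N * β) (h1 : β ≤ 1) :
    ∃ j : Fin N, (j : ℝ) < N * β ∧ N * β ≤ j + 1 := by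
  have hc : 0 < ⌈N * β⌉₊ := Nat.ceil_pos.2 h0
  have hle : ⌈N * β⌉₊ ≤ N := Nat.ceil_le.2 (mul_le_of_le_one_right (Nat.cast_nonneg _) h1)
  -- The shift by one is due to counting order statistics from `0`.
  refine ⟨⟨⌈N * β⌉₊ - 1, by omega⟩, Nat.lt_ceil.1 (by simp; omega), ?_⟩
  have := Nat.le_ceil (N * β)
  have h : ((⌈N * β⌉₊ - 1 : ℕ) : ℝ) + 1 = ⌈N * β⌉₊ := by
    exact_mod_cast Nat.sub_add_cancel hc
  simp only [h, this]

lemma exists_lower_index {N : ℕ} {α : ℝ} (h0 : 0 ≤ α) (h1 : N * α < N) :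
    ∃ i : Fin N, (i : ℝ) ≤ N * α ∧ N * α < i + 1 := by
  have h : ⌊N * α⌋₊ < N := (Nat.floor_lt (by positivity)).2 h1
  exact ⟨⟨_, h⟩, Nat.floor_le (by positivity), Nat.lt_floor_add_one _⟩

lemma volume_real_le_of_subset {S : Set ℝ} {a b c d : ℝ} (h : S ⊆ Icc a b ∪ Icc c d) :
    volume.real S ≤ max 0 (b - a) + max 0 (d - c) := by
  refine (measureReal_mono h (by
    exact (measure_union_lt_top measure_Icc_lt_top measure_Icc_lt_top).ne)).trans ?_
  refine (measureReal_union_le _ _).trans_eq ?_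
  rw [Real.volume_real_Icc, Real.volume_real_Icc, max_comm, max_comm (d - c)]

/-- The preimage of the interval under the step function is again an interval, with order statistics
as endpoints; what it gains over `Ioo α β` lies between each endpoint and its estimate. -/
lemma movedInto_Ioo_le {N : ℕ} (s : Fin N → ℝ) {α β : ℝ} {i j : Fin N}
    (hi1 : (i : ℝ) ≤ N * α) (hi2 : N * α < i + 1) (hj1 : (j : ℝ) < N * β) (hj2 : N * β ≤ j + 1) :
    volume.real (movedInto s (Ioo α β)) ≤ max 0 (α - ordStat i s) + max 0 (ordStat j s - β) := by
  refine volume_real_le_of_subset fun r hr => ?_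
  obtain ⟨_, ⟨h1, h2⟩, h3⟩ := hr
  rw [lt_ecdf_iff s hi1 hi2] at h1
  rw [ecdf_lt_iff s hj1 hj2] at h2
  by_cases hα : r ≤ α
  · exact Or.inl ⟨h1, hα⟩
  · exact Or.inr ⟨not_lt.1 fun h => h3 ⟨not_le.1 hα, h⟩, h2.le⟩

lemma movedOut_Ioo_le {N : ℕ} (s : Fin N → ℝ) {α β : ℝ} {i j : Fin N}
    (hi1 : (i : ℝ) ≤ N * α) (hi2 : N * α < i + 1) (hj1 : (j : ℝ) < N * β) (hj2 : N * β ≤ j + 1) :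
    volume.real (movedOut s (Ioo α β)) ≤ max 0 (ordStat i s - α) + max 0 (β - ordStat j s) := by
  refine volume_real_le_of_subset fun r hr => ?_
  obtain ⟨_, ⟨h1, h2⟩, h3⟩ := hr
  by_cases hα : r < ordStat i s
  · exact Or.inl ⟨h1.le, hα.le⟩
  · refine Or.inr ⟨not_lt.1 fun h => h3 ⟨?_, ?_⟩, h2.le⟩
    · rw [lt_ecdf_iff s hi1 hi2]; exact not_lt.1 hα
    · rwa [ecdf_lt_iff s hj1 hj2]

/-- The left endpoint `0` cannot be crossed, so only one order statistic matters. -/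
lemma movedInto_Ico_le {N : ℕ} (s : Fin N → ℝ) {β : ℝ} {j : Fin N}
    (hj1 : (j : ℝ) < N * β) (hj2 : N * β ≤ j + 1) :
    volume.real (movedInto s (Ico 0 β)) ≤ max 0 (ordStat j s - β) := by
  have : volume.real (movedInto s (Ico 0 β)) ≤ max 0 (ordStat j s - β) + max 0 (0 - 0) := by
    refine volume_real_le_of_subset fun r hr => Or.inl ?_
    obtain ⟨h0, ⟨_, h2⟩, h3⟩ := hr
    rw [ecdf_lt_iff s hj1 hj2] at h2
    exact ⟨not_lt.1 fun h => h3 ⟨h0.1, h⟩, h2.le⟩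
  simpa using this

lemma movedOut_Ico_le {N : ℕ} (s : Fin N → ℝ) {β : ℝ} {j : Fin N}
    (hj1 : (j : ℝ) < N * β) (hj2 : N * β ≤ j + 1) :
    volume.real (movedOut s (Ico 0 β)) ≤ max 0 (β - ordStat j s) := by
  have : volume.real (movedOut s (Ico 0 β)) ≤ max 0 (β - ordStat j s) + max 0 (0 - 0) := by
    refine volume_real_le_of_subset fun r hr => Or.inl ?_
    obtain ⟨h0, ⟨_, h2⟩, h3⟩ := hr
    refine ⟨not_lt.1 fun h => h3 ⟨(ecdf_mem s r).1, ?_⟩, h2.le⟩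
    rwa [ecdf_lt_iff s hj1 hj2]
  simpa using this

/-- For `u`, `v` of equal sign the left side is the larger square, and the slack is a third of `(2u
- v)²` or `(2v - u)²`; for opposite signs it is `(u - v)²`, and the slack is `(u + v)²/3`. The
factor `4/3` is sharp in both cases. -/
lemma max_posPart_add_sq_le (u v : ℝ) :
    (max (max 0 (-u) + max 0 v) (max 0 u + max 0 (-v))) ^ 2
      ≤ 4 / 3 * (u ^ 2 + v ^ 2 - u * v) := by
  rcases le_total 0 u with hu | hu <;> rcases le_total 0 v with hv | hv
  · rw [max_eq_left (by linarith : -u ≤ 0), max_eq_right hv, max_eq_right hu,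
      max_eq_left (by linarith : -v ≤ 0)]
    rcases le_total u v with h | h
    · rw [max_eq_left (by linarith)]; nlinarith [sq_nonneg (2 * u - v)]
    · rw [max_eq_right (by linarith)]; nlinarith [sq_nonneg (2 * v - u)]
  · rw [max_eq_left (by linarith : -u ≤ 0), max_eq_left hv, max_eq_right hu,
      max_eq_right (by linarith : 0 ≤ -v), max_eq_right (by linarith)]
    nlinarith [sq_nonneg (u + v)]
  · rw [max_eq_right (by linarith : 0 ≤ -u), max_eq_right hv, max_eq_left hu,
      max_eq_left (by linarith : -v ≤ 0), max_eq_left (by linarith)]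
    nlinarith [sq_nonneg (u + v)]
  · rw [max_eq_right (by linarith : 0 ≤ -u), max_eq_left hv, max_eq_left hu,
      max_eq_right (by linarith : 0 ≤ -v)]
    rcases le_total u v with h | h
    · rw [max_eq_left (by linarith)]; nlinarith [sq_nonneg (2 * v - u)]
    · rw [max_eq_right (by linarith)]; nlinarith [sq_nonneg (2 * u - v)]

/-! ### Variance plus squared bias of order statistics -/

/-- A bound, for samples of size `N`, on `N` times the variance of a uniform order statistic plus
`3 / 2` times its squared distance in mean from the quantiles that it estimates. -/
def DeviationBound (N : ℕ) (c : ℝ) : Prop :=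
  ∀ (i : Fin N) (α : ℝ), (i : ℝ) ≤ N * α → N * α ≤ i + 1 →
    N * ((i + 1) * (N - i) / ((N + 1) ^ 2 * (N + 2)) + 3 / 2 * ((i + 1) / (N + 1) - α) ^ 2) ≤ c

/-- With `p = (i+1)/(N+1)` the mean, the variance is `p(1-p)/(N+2)`, and `α` in `[i/N, (i+1)/N]` is
within `max(p, 1-p)/N` of `p`. Take `P = max(p, 1-p)`. -/
lemma deviation_le {N : ℕ} {i : Fin N} {α : ℝ} (h1 : (i : ℝ) ≤ N * α) (h2 : N * α ≤ i + 1) :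
    ∃ P : ℝ, 1 / 2 ≤ P ∧ P ≤ N / (N + 1) ∧
    N * (((i : ℝ) + 1) * (N - i) / ((N + 1) ^ 2 * (N + 2)) + 3 / 2 * ((i + 1) / (N + 1) - α) ^ 2)
      ≤ N / (N + 2) * (P * (1 - P)) + 3 / 2 * P ^ 2 / N := by
  have hN : (0 : ℝ) < N := by exact_mod_cast i.pos
  have hiN : (i : ℝ) + 1 ≤ N := by exact_mod_cast i.2
  have hi0 : (0 : ℝ) ≤ i := Nat.cast_nonneg _
  set p : ℝ := (i + 1) / (N + 1) with hp
  have hp1 : 1 - p = (N - i) / (N + 1) := by rw [hp]; field_simp; ring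
  have b1 : p - α ≤ (1 - p) / N := by
    have : (i : ℝ) / N ≤ α := by rw [div_le_iff₀ hN]; linarith
    have : p - i / N = (1 - p) / N := by rw [hp1, hp]; field_simp; ring
    linarith
  have b2 : -(p / N) ≤ p - α := by
    have : α ≤ (i + 1) / N := by rw [le_div_iff₀ hN]; linarith
    have : (i + 1) / N - p = p / N := by rw [hp]; field_simp; ring
    linarith
  have e : ((i : ℝ) + 1) * (N - i) / ((N + 1) ^ 2 * (N + 2)) = p * (1 - p) / (N + 2) := by
    rw [hp1, hp]; field_simp
  have hpN : p ≤ N / (N + 1) := by rw [hp]; gcongr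
  have hpN' : 1 - p ≤ N / (N + 1) := by rw [hp1]; gcongr; linarith
  rw [e]
  have main : ∀ P : ℝ, p * (1 - p) = P * (1 - P) → p ≤ P → 1 - p ≤ P →
      N * (p * (1 - p) / (N + 2) + 3 / 2 * (p - α) ^ 2)
        ≤ N / (N + 2) * (P * (1 - P)) + 3 / 2 * P ^ 2 / N := by
    intro P hP h1 h2
    have hb : (p - α) ^ 2 ≤ (P / N) ^ 2 := by
      refine sq_le_sq' ?_ ?_
      · refine le_trans (neg_le_neg ?_) b2; gcongr
      · refine b1.trans ?_; gcongr
    calc N * (p * (1 - p) / (N + 2) + 3 / 2 * (p - α) ^ 2)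
        ≤ N * (P * (1 - P) / (N + 2) + 3 / 2 * (P / N) ^ 2) := by rw [hP]; gcongr
      _ = _ := by field_simp
  rcases le_total p (1 - p) with h | h
  · exact ⟨1 - p, by linarith, hpN', main _ (by ring) h le_rfl⟩
  · exact ⟨p, by linarith, hpN, main _ rfl le_rfl h⟩

/-- The quadratic in `P` still increases up to the constraint `P ≤ N/(N+1)`, and the constant is its
value there, rounded up; likewise for `N = 4`. -/
lemma deviationBound_three : DeviationBound 3 (394 / 1000) := by
  intro i α h1 h2
  obtain ⟨P, hP1, hP2, h⟩ := deviation_le h1 h2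
  refine h.trans ?_
  push_cast at hP2 ⊢
  norm_num at hP2 ⊢
  nlinarith

lemma deviationBound_four : DeviationBound 4 (347 / 1000) := by
  intro i α h1 h2
  obtain ⟨P, hP1, hP2, h⟩ := deviation_le h1 h2
  refine h.trans ?_
  push_cast at hP2 ⊢
  norm_num at hP2 ⊢
  nlinarith

/-- Here the unconstrained maximum `a²/(4(a-d))` of `a P - (a-d) P²` suffices; `124/100` below is `4
· 31/100`. -/
lemma deviationBound_of_five_le {N : ℕ} (hN : 5 ≤ N) : DeviationBound N (31 / 100) := by
  intro i α h1 h2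
  obtain ⟨P, -, -, h⟩ := deviation_le h1 h2
  refine h.trans ?_
  have hN' : (5 : ℝ) ≤ N := by exact_mod_cast hN
  set a : ℝ := N / (N + 2) with ha
  set d : ℝ := 3 / 2 / N with hd
  have e : a * (P * (1 - P)) + 3 / 2 * P ^ 2 / N = a * P - (a - d) * P ^ 2 := by
    rw [hd]; ring
  rw [e]
  have hkey : a ^ 2 ≤ 124 / 100 * (a - d) := by
    have : 124 / 100 * (a - d) - a ^ 2
        = (24 / 100 * (N : ℝ) ^ 3 + 62 / 100 * N ^ 2 - 744 / 100 * N - 744 / 100)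
          / (N * (N + 2) ^ 2) := by
      rw [ha, hd]; field_simp; ring
    have hnum : (0 : ℝ) ≤ 24 / 100 * (N : ℝ) ^ 3 + 62 / 100 * N ^ 2 - 744 / 100 * N - 744 / 100 := by
      nlinarith [mul_nonneg (sub_nonneg.2 hN') (sub_nonneg.2 hN'),
        mul_nonneg (mul_nonneg (sub_nonneg.2 hN') (sub_nonneg.2 hN')) (sub_nonneg.2 hN')]
    have : 0 ≤ 124 / 100 * (a - d) - a ^ 2 := by rw [this]; positivity
    linarith
  have had : 0 < a - d := by
    have : 0 < a := by rw [ha]; positivity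
    nlinarith [pow_pos this 2]
  by_contra hcon
  push Not at hcon
  nlinarith [sq_nonneg (a - 2 * (a - d) * P), mul_pos had (sub_pos.2 hcon)]

namespace IsUniformSample

variable {Ω : Type*} [MeasurableSpace Ω] {μ : Measure Ω} [IsProbabilityMeasure μ] {N : ℕ}
  {U : Fin N → Ω → ℝ}

lemma integrable_ordStat_mul (hU : IsUniformSample μ U) (i j : Fin N) (a b : ℝ) :
    Integrable (fun ω => (ordStat i (fun j => U j ω) - a) * (ordStat j (fun j => U j ω) - b)) μ := by
  refine Integrable.of_bound (((hU.measurable_ordStat i).sub_const a).mul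
    ((hU.measurable_ordStat j).sub_const b)).aestronglyMeasurable ((1 + |a|) * (1 + |b|))
    (ae_of_all _ fun ω => ?_)
  have h : ∀ (i : Fin N) (a : ℝ), |ordStat i (fun j => U j ω) - a| ≤ 1 + |a| := fun i a => by
    have : ordStat i (fun j => U j ω) ∈ Icc (0 : ℝ) 1 := ordStat_mem i fun j => hU.mem j ω
    refine (abs_sub _ _).trans (add_le_add_left ?_ _)
    rw [abs_of_nonneg this.1]; exact this.2
  rw [Real.norm_eq_abs, abs_mul]
  exact mul_le_mul (h i a) (h j b) (abs_nonneg _) (by positivity)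

lemma integrable_ordStat (hU : IsUniformSample μ U) (i : Fin N) :
    Integrable (fun ω => ordStat i (fun j => U j ω)) μ :=
  Integrable.of_bound (hU.measurable_ordStat i).aestronglyMeasurable 1 (ae_of_all _ fun ω => by
    have : ordStat i (fun j => U j ω) ∈ Icc (0 : ℝ) 1 := ordStat_mem i fun j => hU.mem j ω
    rw [Real.norm_eq_abs, abs_of_nonneg this.1]; exact this.2)

lemma integral_ordStat_sub_sq (hU : IsUniformSample μ U) (i : Fin N) (α : ℝ) :
    ∫ ω, (ordStat i (fun j => U j ω) - α) ^ 2 ∂μ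
      = (i + 1) * (N - i) / ((N + 1) ^ 2 * (N + 2)) + ((i + 1) / (N + 1) - α) ^ 2 := by
  have e : ∀ ω, (ordStat i (fun j => U j ω) - α) ^ 2
      = ordStat i (fun j => U j ω) ^ 2 - 2 * α * ordStat i (fun j => U j ω) + α ^ 2 :=
    fun ω => by ring
  have i1 := hU.integrable_ordStat i
  have i2 : Integrable (fun ω => ordStat i (fun j => U j ω) ^ 2) μ := by
    simpa [sq] using hU.integrable_ordStat_mul i i 0 0
  simp_rw [e]
  have i3 : Integrable (fun ω => ordStat i (fun j => U j ω) ^ 2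
      - 2 * α * ordStat i (fun j => U j ω)) μ := i2.sub (i1.const_mul _)
  rw [integral_add i3 (integrable_const _), integral_sub i2 (i1.const_mul _), integral_const_mul, hU.integral_ordStat,
    hU.integral_ordStat_sq]
  have : (N + 1 : ℝ) ≠ 0 := by positivity
  have : (N + 2 : ℝ) ≠ 0 := by positivity
  simp
  field_simp
  ring

/-- Nonnegative covariance, centred at arbitrary targets: only the product of the two biases
remains. -/
lemma le_integral_ordStat_sub_mul (hU : IsUniformSample μ U) (i j : Fin N) (α β : ℝ) :
    ((i + 1) / (N + 1) - α) * ((j + 1) / (N + 1) - β)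
      ≤ ∫ ω, (ordStat i (fun j => U j ω) - α) * (ordStat j (fun j => U j ω) - β) ∂μ := by
  have h := hU.integral_ordStat_mul_le i j
  rw [hU.integral_ordStat, hU.integral_ordStat] at h
  have e : ∀ ω, (ordStat i (fun j => U j ω) - α) * (ordStat j (fun j => U j ω) - β)
      = ordStat i (fun j => U j ω) * ordStat j (fun j => U j ω) - β * ordStat i (fun j => U j ω)
        - α * ordStat j (fun j => U j ω) + α * β := fun ω => by ring
  have i1 := hU.integrable_ordStat i
  have i2 := hU.integrable_ordStat j
  have i3 : Integrable (fun ω => ordStat i (fun j => U j ω) * ordStat j (fun j => U j ω)) μ := by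
    simpa using hU.integrable_ordStat_mul i j 0 0
  simp_rw [e]
  have i4 : Integrable (fun ω => ordStat i (fun j => U j ω) * ordStat j (fun j => U j ω)
      - β * ordStat i (fun j => U j ω)) μ := i3.sub (i1.const_mul _)
  have i5 : Integrable (fun ω => ordStat i (fun j => U j ω) * ordStat j (fun j => U j ω)
      - β * ordStat i (fun j => U j ω) - α * ordStat j (fun j => U j ω)) μ :=
    i4.sub (i2.const_mul _)
  rw [integral_add i5 (integrable_const _), integral_sub i4 (i2.const_mul _), integral_sub i3 (i1.const_mul _),
    integral_const_mul, integral_const_mul, hU.integral_ordStat, hU.integral_ordStat]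
  simp
  linarith

/-- For a relatively open subinterval `I` of `[0, 1)`, the amount of quantiles moved into, or out
of, `I` by the empirical distribution function is of order `1 / √N` in mean square. -/
lemma exists_level_bound (hU : IsUniformSample μ U) {c : ℝ} (hc : DeviationBound N c)
    (hN : 0 < N) {I : Set ℝ}
    (hI : I = ∅ ∨ (∃ β, 0 < β ∧ β ≤ 1 ∧ I = Ico 0 β) ∨
      ∃ α β, 0 ≤ α ∧ α < β ∧ β ≤ 1 ∧ I = Ioo α β) :
    ∃ g : Ω → ℝ, Measurable g ∧ (∀ ω, volume.real (movedInto (fun j => U j ω) I) ≤ g ω) ∧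
      (∀ ω, volume.real (movedOut (fun j => U j ω) I) ≤ g ω) ∧ Integrable (fun ω => g ω ^ 2) μ ∧
      ∫ ω, g ω ^ 2 ∂μ ≤ 8 / 3 * c / N := by
  have hN' : (0 : ℝ) < N := by exact_mod_cast hN
  have hc0 : 0 ≤ c := by
    refine le_trans ?_ (hc ⟨0, hN⟩ 0 (by simp) (by simp))
    simp only [Nat.cast_zero]
    positivity
  rcases hI with rfl | ⟨β, hβ0, hβ1, rfl⟩ | ⟨α, β, hα0, hαβ, hβ1, rfl⟩
  · refine ⟨fun _ => 0, measurable_const, fun ω => ?_, fun ω => ?_, by simp, ?_⟩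
    · simp [movedInto]
    · simp [movedOut]
    · simp; positivity
  · obtain ⟨j, hj1, hj2⟩ := exists_upper_index (N := N) (by positivity) hβ1
    refine ⟨fun ω => |ordStat j (fun j => U j ω) - β|,
      ((hU.measurable_ordStat j).sub_const _).abs, fun ω => ?_, fun ω => ?_, ?_, ?_⟩
    · exact (movedInto_Ico_le _ hj1 hj2).trans (max_le (abs_nonneg _) (le_abs_self _))
    · refine (movedOut_Ico_le _ hj1 hj2).trans (max_le (abs_nonneg _) ?_)
      simp only [abs_sub_comm _ β]; exact le_abs_self _
    · simp only [sq_abs]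
      simpa [sq] using hU.integrable_ordStat_mul j j β β
    · simp only [sq_abs]
      rw [hU.integral_ordStat_sub_sq, le_div_iff₀ hN']
      have := hc j β hj1.le hj2
      nlinarith [mul_nonneg hN'.le (sq_nonneg (((j : ℝ) + 1) / (N + 1) - β))]
  · obtain ⟨j, hj1, hj2⟩ := exists_upper_index (N := N)
      (mul_pos hN' (lt_of_le_of_lt hα0 hαβ)) hβ1
    obtain ⟨i, hi1, hi2⟩ := exists_lower_index (N := N) hα0
      (mul_lt_of_lt_one_right hN' (hαβ.trans_le hβ1))
    let u : Ω → ℝ := fun ω => ordStat i (fun j => U j ω) - α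
    let v : Ω → ℝ := fun ω => ordStat j (fun j => U j ω) - β
    have um : Measurable u := (hU.measurable_ordStat i).sub_const _
    have vm : Measurable v := (hU.measurable_ordStat j).sub_const _
    -- The explicit majorant of both displaced measures spares any discussion of their measurability
    -- in `ω`.
    let g : Ω → ℝ := fun ω =>
      max (max 0 (-u ω) + max 0 (v ω)) (max 0 (u ω) + max 0 (-v ω))
    have gm : Measurable g := ((measurable_const.max um.neg).add (measurable_const.max vm)).max
      ((measurable_const.max um).add (measurable_const.max vm.neg))
    have hle : ∀ ω, g ω ^ 2 ≤ 4 / 3 * (u ω ^ 2 + v ω ^ 2 - u ω * v ω) := fun ω =>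
      max_posPart_add_sq_le _ _
    have iu : Integrable (fun ω => u ω ^ 2) μ := by
      simpa [sq] using hU.integrable_ordStat_mul i i α α
    have iv : Integrable (fun ω => v ω ^ 2) μ := by
      simpa [sq] using hU.integrable_ordStat_mul j j β β
    have iuv : Integrable (fun ω => u ω * v ω) μ := hU.integrable_ordStat_mul i j α β
    have iR : Integrable (fun ω => 4 / 3 * (u ω ^ 2 + v ω ^ 2 - u ω * v ω)) μ :=
      ((iu.add iv).sub iuv).const_mul _
    have ig : Integrable (fun ω => g ω ^ 2) μ := by
      refine iR.mono' (gm.pow_const 2).aestronglyMeasurable (ae_of_all _ fun ω => ?_)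
      rw [Real.norm_eq_abs, abs_of_nonneg (sq_nonneg _)]
      exact hle ω
    refine ⟨g, gm, fun ω => ?_, fun ω => ?_, ig, ?_⟩
    · refine (movedInto_Ioo_le _ hi1 hi2 hj1 hj2).trans (le_trans (le_of_eq ?_) (le_max_left _ _))
      simp [u, v]
    · refine (movedOut_Ioo_le _ hi1 hi2 hj1 hj2).trans (le_trans (le_of_eq ?_) (le_max_right _ _))
      simp [u, v]
    · refine (integral_mono ig iR hle).trans ?_
      have iuv' : Integrable (fun ω => u ω ^ 2 + v ω ^ 2) μ := iu.add iv
      rw [integral_const_mul, integral_sub iuv' iuv, integral_add iu iv,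
        hU.integral_ordStat_sub_sq, hU.integral_ordStat_sub_sq, le_div_iff₀ hN']
      have h1 := hc i α hi1 hi2.le
      have h2 := hc j β hj1.le hj2
      have h3 := hU.le_integral_ordStat_sub_mul i j α β
      change _ ≤ ∫ ω, u ω * v ω ∂μ at h3
      have h4 := mul_le_mul_of_nonneg_left h3 hN'.le
      -- The product of biases enters with a minus sign and is absorbed by `-δ δ' ≤ (δ² + δ'²)/2`;
      -- this is where the weight `3/2` in `DeviationBound` comes from.
      nlinarith [mul_nonneg hN'.le
        (sq_nonneg ((((i : ℝ) + 1) / (N + 1) - α) + (((j : ℝ) + 1) / (N + 1) - β)))]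

end IsUniformSample

/-! ### Deterministic estimates -/

/-- An allocation rule `x`, a weight `Z`, a value function `v` and the associated equilibrium bid
function `b`, with bounds `A` for `x' / x` and `W` for `x Z`. -/
structure BidSetup (x x' Z Z' v b : ℝ → ℝ) (A W : ℝ) : Prop where
  deriv_x : ∀ q, HasDerivAt x (x' q) q
  cont_x' : Continuous x'
  deriv_Z : ∀ q ∈ Icc (0 : ℝ) 1, HasDerivAt Z (Z' q) q
  cont_Z' : ContinuousOn Z' (Icc (0 : ℝ) 1)
  x_pos : ∀ q ∈ Icc (0 : ℝ) 1, 0 < x q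
  x'_nonneg : ∀ q ∈ Icc (0 : ℝ) 1, 0 ≤ x' q
  x'_le : ∀ q ∈ Icc (0 : ℝ) 1, x' q ≤ A * x q
  Z_nonneg : ∀ q ∈ Icc (0 : ℝ) 1, 0 ≤ Z q
  xZ_le : ∀ q ∈ Icc (0 : ℝ) 1, x q * Z q ≤ W
  Z_quasi : ∀ p ∈ Icc (0 : ℝ) 1, ∀ s, p ≤ s → ∀ r ∈ Icc (0 : ℝ) 1, s ≤ r → min (Z p) (Z r) ≤ Z s
  Z_one : Z 1 = 0
  A_pos : 0 < A
  W_pos : 0 < W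
  v_mono : MonotoneOn v (Icc (0 : ℝ) 1)
  v_cont : ContinuousOn v (Icc (0 : ℝ) 1)
  v_mem : ∀ q ∈ Icc (0 : ℝ) 1, v q ∈ Icc (0 : ℝ) 1
  payment : ∀ q ∈ Icc (0 : ℝ) 1, x q * b q = ∫ s in (0 : ℝ)..q, v s * x' s
  b_le : ∀ q ∈ Icc (0 : ℝ) 1, b q ≤ v q

namespace BidSetup

variable {x x' Z Z' v b : ℝ → ℝ} {A W : ℝ}

lemma cont_x (S : BidSetup x x' Z Z' v b A W) : Continuous x :=
  continuous_iff_continuousAt.2 fun q => (S.deriv_x q).continuousAt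

lemma cont_Z (S : BidSetup x x' Z Z' v b A W) : ContinuousOn Z (Icc 0 1) :=
  fun q hq => (S.deriv_Z q hq).continuousAt.continuousWithinAt

lemma x_mono (S : BidSetup x x' Z Z' v b A W) : MonotoneOn x (Icc 0 1) := by
  refine monotoneOn_of_deriv_nonneg (convex_Icc 0 1) S.cont_x.continuousOn
    (fun q _ => (S.deriv_x q).differentiableAt.differentiableWithinAt) fun q hq => ?_
  rw [(S.deriv_x q).deriv]
  exact S.x'_nonneg q (interior_subset hq)

/-- This pointwise bound makes every remainder of the integrations by parts below a multiple of `A W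
|p - r|`. -/
lemma kappa_le (S : BidSetup x x' Z Z' v b A W) {q : ℝ} (hq : q ∈ Icc (0 : ℝ) 1) :
    x' q * Z q ≤ A * W :=
  calc x' q * Z q ≤ A * x q * Z q := mul_le_mul_of_nonneg_right (S.x'_le q hq) (S.Z_nonneg q hq)
    _ = A * (x q * Z q) := by ring
    _ ≤ A * W := mul_le_mul_of_nonneg_left (S.xZ_le q hq) S.A_pos.le

lemma kappa_nonneg (S : BidSetup x x' Z Z' v b A W) {q : ℝ} (hq : q ∈ Icc (0 : ℝ) 1) :
    0 ≤ x' q * Z q := mul_nonneg (S.x'_nonneg q hq) (S.Z_nonneg q hq)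

lemma uIcc_sub {r p : ℝ} (hr : r ∈ Icc (0 : ℝ) 1) (hp : p ∈ Icc (0 : ℝ) 1) :
    uIcc r p ⊆ Icc (0 : ℝ) 1 := (convex_Icc (0 : ℝ) 1).ordConnected.uIcc_subset hr hp

lemma kappa_integrable (S : BidSetup x x' Z Z' v b A W) {r p : ℝ} (hr : r ∈ Icc (0 : ℝ) 1)
    (hp : p ∈ Icc (0 : ℝ) 1) : IntervalIntegrable (fun q => x' q * Z q) volume r p :=
  (S.cont_x'.continuousOn.mul (S.cont_Z.mono (uIcc_sub hr hp))).intervalIntegrable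

lemma xZ'_integrable (S : BidSetup x x' Z Z' v b A W) {r p : ℝ} (hr : r ∈ Icc (0 : ℝ) 1)
    (hp : p ∈ Icc (0 : ℝ) 1) : IntervalIntegrable (fun q => x q * Z' q) volume r p :=
  (S.cont_x.continuousOn.mul (S.cont_Z'.mono (uIcc_sub hr hp))).intervalIntegrable

lemma integral_xZ' (S : BidSetup x x' Z Z' v b A W) {r p : ℝ} (hr : r ∈ Icc (0 : ℝ) 1)
    (hp : p ∈ Icc (0 : ℝ) 1) :
    ∫ q in r..p, x q * Z' q = x p * Z p - x r * Z r - ∫ q in r..p, x' q * Z q :=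
  intervalIntegral.integral_mul_deriv_eq_deriv_mul (fun q _ => S.deriv_x q)
    (fun q hq => S.deriv_Z q (uIcc_sub hr hp hq)) (S.cont_x'.intervalIntegrable _ _)
    ((S.cont_Z'.mono (uIcc_sub hr hp)).intervalIntegrable)

lemma integral_x' (S : BidSetup x x' Z Z' v b A W) (r p : ℝ) :
    ∫ q in r..p, x' q = x p - x r :=
  intervalIntegral.integral_eq_sub_of_hasDerivAt (fun q _ => S.deriv_x q)
    (S.cont_x'.intervalIntegrable _ _)

lemma integral_kappa_nonneg (S : BidSetup x x' Z Z' v b A W) {r p : ℝ} (hr : r ∈ Icc (0 : ℝ) 1)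
    (hp : p ∈ Icc (0 : ℝ) 1) (h : r ≤ p) : 0 ≤ ∫ q in r..p, x' q * Z q :=
  intervalIntegral.integral_nonneg h fun _ hq => S.kappa_nonneg ⟨hr.1.trans hq.1, hq.2.trans hp.2⟩

lemma integral_kappa_le (S : BidSetup x x' Z Z' v b A W) {r p : ℝ} (hr : r ∈ Icc (0 : ℝ) 1)
    (hp : p ∈ Icc (0 : ℝ) 1) (h : r ≤ p) : ∫ q in r..p, x' q * Z q ≤ A * W * (p - r) := by
  have := intervalIntegral.integral_mono_on h (S.kappa_integrable hr hp)
    (_root_.intervalIntegrable_const (μ := volume) (c := A * W)) fun q hq =>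
      S.kappa_le ⟨hr.1.trans hq.1, hq.2.trans hp.2⟩
  rw [intervalIntegral.integral_const, smul_eq_mul] at this
  linarith

lemma le_integral_kappa (S : BidSetup x x' Z Z' v b A W) {r p m : ℝ} (hr : r ∈ Icc (0 : ℝ) 1)
    (hp : p ∈ Icc (0 : ℝ) 1) (h : r ≤ p) (hm : ∀ q ∈ Icc r p, m ≤ Z q) :
    m * (x p - x r) ≤ ∫ q in r..p, x' q * Z q := by
  have := intervalIntegral.integral_mono_on h
    ((S.cont_x'.intervalIntegrable r p).const_mul m) (S.kappa_integrable hr hp) fun q hq => by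
      rw [mul_comm]
      exact mul_le_mul_of_nonneg_left (hm q hq)
        (S.x'_nonneg q ⟨hr.1.trans hq.1, hq.2.trans hp.2⟩)
  rwa [intervalIntegral.integral_const_mul, S.integral_x'] at this

lemma x_sub_le (S : BidSetup x x' Z Z' v b A W) {r p : ℝ} (hr : r ∈ Icc (0 : ℝ) 1)
    (hp : p ∈ Icc (0 : ℝ) 1) (h : r ≤ p) : x p - x r ≤ A * (p - r) * x p := by
  have := intervalIntegral.integral_mono_on h (S.cont_x'.intervalIntegrable r p)
    (_root_.intervalIntegrable_const (μ := volume) (c := A * x p)) fun q hq =>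
      (S.x'_le q ⟨hr.1.trans hq.1, hq.2.trans hp.2⟩).trans (mul_le_mul_of_nonneg_left
        (S.x_mono ⟨hr.1.trans hq.1, hq.2.trans hp.2⟩ hp hq.2) S.A_pos.le)
  rw [S.integral_x', intervalIntegral.integral_const, smul_eq_mul] at this
  linarith

/-- Both boundary terms lie in `[0, W]`, so their difference is at most `W` in absolute value. No
quasi-concavity is involved, which makes this the crude bound for small samples. -/
lemma abs_integral_xZ'_le (S : BidSetup x x' Z Z' v b A W) {r p : ℝ} (hr : r ∈ Icc (0 : ℝ) 1)
    (hp : p ∈ Icc (0 : ℝ) 1) : |∫ q in r..p, x q * Z' q| ≤ W + A * W * |p - r| := by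
  rw [S.integral_xZ' hr hp]
  have h1 := S.xZ_le r hr
  have h2 := S.xZ_le p hp
  have h3 := mul_nonneg (S.x_pos r hr).le (S.Z_nonneg r hr)
  have h4 := mul_nonneg (S.x_pos p hp).le (S.Z_nonneg p hp)
  rw [abs_le]
  rcases le_total r p with h | h
  · rw [abs_of_nonneg (sub_nonneg.2 h)]
    have h5 := S.integral_kappa_nonneg hr hp h
    have h6 := S.integral_kappa_le hr hp h
    have h7 := h5.trans h6
    constructor <;> linarith
  · rw [abs_of_nonpos (sub_nonpos.2 h), intervalIntegral.integral_symm]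
    have h5 := S.integral_kappa_nonneg hp hr h
    have h6 := S.integral_kappa_le hp hr h
    have h7 := h5.trans h6
    constructor <;> linarith

/-- Replacing `x p` by `x r` in the boundary term at `p` costs at most `A W |p - r|`. The cap is
harmless, since `x p * Z p ≤ W ≤ x r * (W / x t)` for `t ≤ r`. -/
lemma integral_xZ'_le (S : BidSetup x x' Z Z' v b A W) {r p t : ℝ} (hr : r ∈ Icc (0 : ℝ) 1)
    (hp : p ∈ Icc (0 : ℝ) 1) (ht : t ∈ Icc (0 : ℝ) 1) (htr : t ≤ r) :
    ∫ q in r..p, x q * Z' q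
      ≤ x r * max 0 (min (Z p) (W / x t) - Z r) + A * W * |p - r| := by
  have hxr := S.x_pos r hr
  have hxt := S.x_pos t ht
  have hZp := S.Z_nonneg p hp
  have hcap : W ≤ x r * (W / x t) := by
    rw [mul_div_assoc', le_div_iff₀ hxt, mul_comm]
    exact mul_le_mul_of_nonneg_right (S.x_mono ht hr htr) S.W_pos.le
  have hW := S.xZ_le p hp
  have main : ∫ q in r..p, x q * Z' q
      ≤ x r * (min (Z p) (W / x t) - Z r) + A * W * |p - r| := by
    rw [S.integral_xZ' hr hp]
    rcases le_total r p with h | h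
    · rw [abs_of_nonneg (sub_nonneg.2 h)]
      have h5 := S.integral_kappa_nonneg hr hp h
      have h6 := mul_le_mul_of_nonneg_right (S.x_sub_le hr hp h) hZp
      have h7 := mul_le_mul_of_nonneg_left hW (mul_nonneg S.A_pos.le (sub_nonneg.2 h))
      have h8 : 0 ≤ A * W * (p - r) :=
        mul_nonneg (mul_nonneg S.A_pos.le S.W_pos.le) (sub_nonneg.2 h)
      rcases min_cases (Z p) (W / x t) with ⟨e, _⟩ | ⟨e, _⟩ <;> rw [e] <;> nlinarith
    · rw [abs_of_nonpos (sub_nonpos.2 h), intervalIntegral.integral_symm]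
      have h5 := S.integral_kappa_le hp hr h
      have h6 := mul_le_mul_of_nonneg_right (S.x_mono hp hr h) hZp
      rcases min_cases (Z p) (W / x t) with ⟨e, _⟩ | ⟨e, _⟩ <;> rw [e] <;> nlinarith
  refine main.trans (add_le_add_left (mul_le_mul_of_nonneg_left (le_max_right _ _) hxr.le) _)

/-- For `p ≤ r` quasi-concavity gives `Z ≥ min (Z p) (Z r)` on `[p, r]`, so `∫ x' Z` pays for the
change of `x` in the boundary terms. The cap can only enlarge the right side. -/
lemma le_integral_xZ' (S : BidSetup x x' Z Z' v b A W) {r p t : ℝ} (hr : r ∈ Icc (0 : ℝ) 1)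
    (hp : p ∈ Icc (0 : ℝ) 1) :
    -(∫ q in r..p, x q * Z' q)
      ≤ x r * max 0 (Z r - min (Z p) (W / x t)) + A * W * |p - r| := by
  have hxr := S.x_pos r hr
  have hZp := S.Z_nonneg p hp
  have main : -(∫ q in r..p, x q * Z' q) ≤ x r * max 0 (Z r - Z p) + A * W * |p - r| := by
    rw [S.integral_xZ' hr hp]
    rcases le_total r p with h | h
    · rw [abs_of_nonneg (sub_nonneg.2 h)]
      have h5 := S.integral_kappa_le hr hp h
      have h6 := mul_le_mul_of_nonneg_right (S.x_mono hr hp h) hZp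
      have h7 := mul_le_mul_of_nonneg_left (le_max_right 0 (Z r - Z p)) hxr.le
      nlinarith
    · rw [abs_of_nonpos (sub_nonpos.2 h), intervalIntegral.integral_symm]
      have h8 : 0 ≤ A * W * -(p - r) :=
        mul_nonneg (mul_nonneg S.A_pos.le S.W_pos.le) (by linarith)
      have hq := fun q (hq : q ∈ Icc p r) => S.Z_quasi p hp q hq.1 r hr hq.2
      have h5 := S.le_integral_kappa hp hr h hq
      rcases le_total (Z p) (Z r) with h9 | h9
      · rw [min_eq_left h9] at h5
        rw [max_eq_right (sub_nonneg.2 h9)]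
        nlinarith
      · rw [min_eq_right h9] at h5
        rw [max_eq_left (sub_nonpos.2 h9)]
        have := mul_le_mul_of_nonneg_left h9 (S.x_pos p hp).le
        nlinarith
  refine main.trans (add_le_add_left (mul_le_mul_of_nonneg_left ?_ hxr.le) _)
  exact max_le_max le_rfl (sub_le_sub_left (min_le_left _ _) _)

/-! #### The bid function -/

lemma vx'_integrable (S : BidSetup x x' Z Z' v b A W) {r p : ℝ} (hr : r ∈ Icc (0 : ℝ) 1)
    (hp : p ∈ Icc (0 : ℝ) 1) : IntervalIntegrable (fun q => v q * x' q) volume r p :=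
  ((S.v_cont.mono (uIcc_sub hr hp)).mul S.cont_x'.continuousOn).intervalIntegrable

lemma b_eq (S : BidSetup x x' Z Z' v b A W) {q : ℝ} (hq : q ∈ Icc (0 : ℝ) 1) :
    b q = (∫ s in (0 : ℝ)..q, v s * x' s) / x q := by
  rw [← S.payment q hq, mul_div_cancel_left₀ _ (S.x_pos q hq).ne']

/-- Differentiating the payment identity gives the first-order condition `x b' = (v - b) x'`; this
expression serves as the bid density throughout. -/
lemma hasDerivAt_b (S : BidSetup x x' Z Z' v b A W) {q : ℝ} (hq : q ∈ Ioo (0 : ℝ) 1) :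
    HasDerivAt b ((v q - b q) * x' q / x q) q := by
  have hq' := Ioo_subset_Icc_self hq
  have hcont : ContinuousAt (fun s => v s * x' s) q :=
    (S.v_cont.continuousAt (Icc_mem_nhds hq.1 hq.2)).mul S.cont_x'.continuousAt
  have hmeas : StronglyMeasurableAtFilter (fun s => v s * x' s) (𝓝 q) :=
    ContinuousOn.stronglyMeasurableAtFilter isOpen_Ioo
      ((S.v_cont.mono Ioo_subset_Icc_self).mul S.cont_x'.continuousOn) q hq
  have h1 := intervalIntegral.integral_hasDerivAt_right
    (S.vx'_integrable (left_mem_Icc.2 zero_le_one) hq') hmeas hcont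
  have h2 := h1.fun_div (S.deriv_x q) (S.x_pos q hq').ne'
  rw [← S.payment q hq'] at h2
  have h3 : b =ᶠ[𝓝 q] fun q => (∫ s in (0 : ℝ)..q, v s * x' s) / x q := by
    filter_upwards [Ioo_mem_nhds hq.1 hq.2] with s hs
    exact S.b_eq (Ioo_subset_Icc_self hs)
  refine (h2.congr_of_eventuallyEq h3).congr_deriv ?_
  have := (S.x_pos q hq').ne'
  field_simp

lemma cont_b (S : BidSetup x x' Z Z' v b A W) : ContinuousOn b (Icc 0 1) := by
  have h : ContinuousOn (fun q => (∫ s in (0 : ℝ)..q, v s * x' s) / x q) (Icc 0 1) := by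
    refine ContinuousOn.div ?_ S.cont_x.continuousOn fun q hq => (S.x_pos q hq).ne'
    have := intervalIntegral.continuousOn_primitive_interval (μ := volume)
      (f := fun s => v s * x' s) (a := 0) (b := 1)
      (by rw [uIcc_of_le zero_le_one]
          exact (S.v_cont.mul S.cont_x'.continuousOn).integrableOn_Icc)
    rwa [uIcc_of_le zero_le_one] at this
  exact h.congr fun q hq => S.b_eq hq

lemma b_zero (S : BidSetup x x' Z Z' v b A W) : b 0 = 0 := by
  rw [S.b_eq (left_mem_Icc.2 zero_le_one)]; simp

lemma cont_db (S : BidSetup x x' Z Z' v b A W) :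
    ContinuousOn (fun q => (v q - b q) * x' q / x q) (Icc 0 1) :=
  ((S.v_cont.sub S.cont_b).mul S.cont_x'.continuousOn).div S.cont_x.continuousOn
    fun q hq => (S.x_pos q hq).ne'

lemma db_nonneg (S : BidSetup x x' Z Z' v b A W) {q : ℝ} (hq : q ∈ Icc (0 : ℝ) 1) :
    0 ≤ (v q - b q) * x' q / x q :=
  div_nonneg (mul_nonneg (sub_nonneg.2 (S.b_le q hq)) (S.x'_nonneg q hq)) (S.x_pos q hq).le

lemma db_integrable (S : BidSetup x x' Z Z' v b A W) {r p : ℝ} (hr : r ∈ Icc (0 : ℝ) 1)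
    (hp : p ∈ Icc (0 : ℝ) 1) :
    IntervalIntegrable (fun q => (v q - b q) * x' q / x q) volume r p :=
  (S.cont_db.mono (uIcc_sub hr hp)).intervalIntegrable

lemma integral_db (S : BidSetup x x' Z Z' v b A W) {u : ℝ} (hu : u ∈ Icc (0 : ℝ) 1) :
    ∫ q in (0 : ℝ)..u, (v q - b q) * x' q / x q = b u := by
  have := intervalIntegral.integral_eq_sub_of_hasDerivAt_of_le hu.1
    (S.cont_b.mono (Icc_subset_Icc_right hu.2))
    (fun q hq => S.hasDerivAt_b ⟨hq.1, hq.2.trans_le hu.2⟩)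
    (S.db_integrable (left_mem_Icc.2 zero_le_one) hu)
  rw [this, S.b_zero, sub_zero]

lemma b_nonneg (S : BidSetup x x' Z Z' v b A W) {u : ℝ} (hu : u ∈ Icc (0 : ℝ) 1) : 0 ≤ b u := by
  rw [← S.integral_db hu]
  exact intervalIntegral.integral_nonneg hu.1 fun q hq => S.db_nonneg ⟨hq.1, hq.2.trans hu.2⟩

/-- The highest bid is bounded in terms of the logarithmic derivative of the allocation rule. -/
lemma b_one_le (S : BidSetup x x' Z Z' v b A W) : b 1 ≤ 1 - Real.exp (-A) := by
  have h0 : (0 : ℝ) ∈ Icc (0 : ℝ) 1 := left_mem_Icc.2 zero_le_one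
  have h1 : (1 : ℝ) ∈ Icc (0 : ℝ) 1 := right_mem_Icc.2 zero_le_one
  have hx1 := S.x_pos 1 h1
  -- Values are at most `1`, so `x(1) b(1) ≤ x(1) - x(0)`; and `x e^{-Aq}` decreases, so `x(0) ≥
  -- e^{-A} x(1)`.
  have hpay : x 1 * b 1 ≤ x 1 - x 0 := by
    rw [S.payment 1 h1, ← S.integral_x' 0 1]
    refine intervalIntegral.integral_mono_on zero_le_one (S.vx'_integrable h0 h1)
      (S.cont_x'.intervalIntegrable _ _) fun q hq => ?_
    exact mul_le_of_le_one_left (S.x'_nonneg q hq) (S.v_mem q hq).2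
  have hanti : AntitoneOn (fun q => x q * Real.exp (-(A * q))) (Icc 0 1) := by
    have hd : ∀ q, HasDerivAt (fun q => x q * Real.exp (-(A * q)))
        (x' q * Real.exp (-(A * q)) + x q * (Real.exp (-(A * q)) * -(A * 1))) q := fun q =>
      (S.deriv_x q).fun_mul (((hasDerivAt_id q).const_mul A).fun_neg.exp)
    refine antitoneOn_of_deriv_nonpos (convex_Icc 0 1)
      (fun q _ => (hd q).continuousAt.continuousWithinAt)
      (fun q _ => (hd q).differentiableAt.differentiableWithinAt) fun q hq => ?_
    rw [(hd q).deriv]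
    have := S.x'_le q (interior_subset hq)
    nlinarith [Real.exp_pos (-(A * q))]
  have := hanti h0 h1 zero_le_one
  simp only [mul_one, mul_zero, neg_zero, Real.exp_zero] at this
  have h2 : x 1 * b 1 ≤ x 1 * (1 - Real.exp (-A)) := by linarith
  exact le_of_mul_le_mul_left h2 hx1

end BidSetup

/-! ### Layer decompositions and the pathwise bound -/

lemma sum_layers {M : ℕ} {a : ℝ} (h1 : a ≤ 1) :
    ∑ j ∈ Finset.range M, (if (j : ℝ) < M * a then (1 : ℝ) else 0) = ⌈M * a⌉₊ := by
  rw [Finset.sum_boole]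
  congr 1
  have h : (Finset.range M).filter (fun j : ℕ => (j : ℝ) < M * a) = Finset.range ⌈M * a⌉₊ := by
    ext j
    simp only [Finset.mem_filter, Finset.mem_range, Nat.lt_ceil]
    refine ⟨fun h => h.2, fun h => ⟨?_, h⟩⟩
    have : (j : ℝ) < M := h.trans_le (mul_le_of_le_one_right (Nat.cast_nonneg _) h1)
    exact_mod_cast this
  rw [h, Finset.card_range]

/-- The layers counted are those between two ceilings; rounding loses less than one layer, whence
the `1 / M`. -/
lemma max_sub_le_sum_layers {M : ℕ} (hM : 0 < M) {a b : ℝ} (ha : a ≤ 1) (hb0 : 0 ≤ b)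
    (hb : b ≤ 1) :
    max 0 (a - b) ≤ (∑ j ∈ Finset.range M,
      (if (j : ℝ) < M * a ∧ ¬ (j : ℝ) < M * b then (1 : ℝ) else 0)) / M + 1 / M := by
  have hM' : (0 : ℝ) < M := by exact_mod_cast hM
  have h0 : 0 ≤ ∑ j ∈ Finset.range M,
      (if (j : ℝ) < M * a ∧ ¬ (j : ℝ) < M * b then (1 : ℝ) else 0) :=
    Finset.sum_nonneg fun j _ => by split_ifs <;> simp
  refine max_le (by positivity) ?_
  rw [← add_div, le_div_iff₀ hM']
  have h1 : (⌈M * a⌉₊ : ℝ) - ⌈M * b⌉₊ ≤ ∑ j ∈ Finset.range M,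
      (if (j : ℝ) < M * a ∧ ¬ (j : ℝ) < M * b then (1 : ℝ) else 0) := by
    rw [← sum_layers ha, ← sum_layers hb, ← Finset.sum_sub_distrib]
    refine Finset.sum_le_sum fun j _ => ?_
    split_ifs <;> simp_all
  have h2 := Nat.le_ceil ((M : ℝ) * a)
  have h3 := Nat.ceil_lt_add_one (mul_nonneg hM'.le hb0)
  linarith

/-- The strict superlevel sets of a quasi-concave continuous function on `[0, 1]`. -/
lemma superlevel_shape {f : ℝ → ℝ} {c : ℝ} (hf : ContinuousOn f (Icc 0 1))
    (hq : ∀ p ∈ Icc (0 : ℝ) 1, ∀ s, p ≤ s → ∀ r ∈ Icc (0 : ℝ) 1, s ≤ r → min (f p) (f r) ≤ f s)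
    (h1 : f 1 ≤ c) :
    {p | p ∈ Icc (0 : ℝ) 1 ∧ c < f p} = ∅ ∨
      (∃ β, 0 < β ∧ β ≤ 1 ∧ {p | p ∈ Icc (0 : ℝ) 1 ∧ c < f p} = Ico 0 β) ∨
      ∃ α β, 0 ≤ α ∧ α < β ∧ β ≤ 1 ∧ {p | p ∈ Icc (0 : ℝ) 1 ∧ c < f p} = Ioo α β := by
  set S := {p | p ∈ Icc (0 : ℝ) 1 ∧ c < f p} with hS
  rcases S.eq_empty_or_nonempty with h | hne
  · exact Or.inl h
  right
  have hbb : BddBelow S := ⟨0, fun p hp => hp.1.1⟩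
  have hba : BddAbove S := ⟨1, fun p hp => hp.1.2⟩
  have hconn : ∀ p ∈ S, ∀ r ∈ S, ∀ s, p ≤ s → s ≤ r → s ∈ S := fun p hp r hr s h h' =>
    ⟨⟨hp.1.1.trans h, h'.trans hr.1.2⟩, (lt_min hp.2 hr.2).trans_le (hq p hp.1 s h r hr.1 h')⟩
  have hnhds : ∀ p ∈ S, ∀ᶠ s in 𝓝[Icc 0 1] p, s ∈ S := fun p hp => by
    filter_upwards [(hf p hp.1).eventually (lt_mem_nhds hp.2), self_mem_nhdsWithin] with s h h'
    exact ⟨h', h⟩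
  have hsup_mem : sSup S ∈ Icc (0 : ℝ) 1 := by
    obtain ⟨p, hp⟩ := hne
    exact ⟨hp.1.1.trans (le_csSup hba hp), csSup_le ⟨p, hp⟩ fun q hq => hq.1.2⟩
  have hinf_mem : sInf S ∈ Icc (0 : ℝ) 1 := by
    obtain ⟨p, hp⟩ := hne
    exact ⟨le_csInf ⟨p, hp⟩ fun q hq => hq.1.1, (csInf_le hbb hp).trans hp.1.2⟩
  -- The set is relatively open in `[0,1]` and misses `1`, so a supremum inside it could be
  -- exceeded.
  have hsup : sSup S ∉ S := fun h => by
    have hlt : sSup S < 1 := lt_of_le_of_ne hsup_mem.2 fun e => by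
      rw [e] at h; exact absurd h.2 (not_lt.2 h1)
    have h2 : ∀ᶠ s in 𝓝[>] sSup S, s ∈ S := by
      have := (hnhds _ h).filter_mono
        (nhdsWithin_mono (sSup S) (Ioo_subset_Icc_self.trans (Icc_subset_Icc_left hsup_mem.1)))
      rwa [nhdsWithin_Ioo_eq_nhdsGT hlt] at this
    obtain ⟨s, hs, hs'⟩ := (h2.and self_mem_nhdsWithin).exists
    exact absurd (le_csSup hba hs) (not_le.2 hs')
  have hlt_sup : ∀ p ∈ S, p < sSup S := fun p hp =>
    lt_of_le_of_ne (le_csSup hba hp) fun e => hsup (e ▸ hp)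
  by_cases h0 : (0 : ℝ) ∈ S
  · refine Or.inl ⟨sSup S, hlt_sup 0 h0, hsup_mem.2, ?_⟩
    refine Subset.antisymm (fun p hp => ⟨hp.1.1, hlt_sup p hp⟩) fun p hp => ?_
    obtain ⟨u, hu, hpu⟩ := exists_lt_of_lt_csSup hne hp.2
    exact hconn 0 h0 u hu p hp.1 hpu.le
  · refine Or.inr ⟨sInf S, sSup S, hinf_mem.1, ?_, hsup_mem.2, ?_⟩
    · obtain ⟨p, hp⟩ := hne
      exact (csInf_le hbb hp).trans_lt (hlt_sup p hp)
    have hinf : sInf S ∉ S := fun h => by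
      have hlt : 0 < sInf S := lt_of_le_of_ne hinf_mem.1 fun e => by
        rw [← e] at h; exact h0 h
      have h2 : ∀ᶠ s in 𝓝[<] sInf S, s ∈ S := by
        have := (hnhds _ h).filter_mono
          (nhdsWithin_mono (sInf S) (Ioo_subset_Icc_self.trans (Icc_subset_Icc_right hinf_mem.2)))
        rwa [nhdsWithin_Ioo_eq_nhdsLT hlt] at this
      obtain ⟨s, hs, hs'⟩ := (h2.and self_mem_nhdsWithin).exists
      exact absurd (csInf_le hbb hs) (not_le.2 hs')
    refine Subset.antisymm (fun p hp => ⟨lt_of_le_of_ne (csInf_le hbb hp) fun e =>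
      hinf (e ▸ hp), hlt_sup p hp⟩) fun p hp => ?_
    obtain ⟨u, hu, hpu⟩ := exists_lt_of_lt_csSup hne hp.2
    obtain ⟨u', hu', hpu'⟩ := exists_lt_of_csInf_lt hne hp.1
    exact hconn u' hu' u hu p hpu'.le hpu.le

namespace BidSetup

variable {x x' Z Z' v b : ℝ → ℝ} {A W : ℝ}

lemma zero_mem_Icc : (0 : ℝ) ∈ Icc (0 : ℝ) 1 := left_mem_Icc.2 zero_le_one

lemma one_mem_Icc : (1 : ℝ) ∈ Icc (0 : ℝ) 1 := right_mem_Icc.2 zero_le_one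

lemma integral_indicator_x' (S : BidSetup x x' Z Z' v b A W) {r t : ℝ} (ht : 0 ≤ t)
    (htr : t ≤ r) : ∫ s in (0 : ℝ)..r, (Ioi t).indicator x' s = x r - x t := by
  rw [← S.integral_x', intervalIntegral.integral_of_le (ht.trans htr),
    intervalIntegral.integral_of_le htr, setIntegral_indicator measurableSet_Ioi]
  congr 2
  ext s
  simp only [mem_inter_iff, mem_Ioc, mem_Ioi]
  exact ⟨fun h => ⟨h.2, h.1.2⟩, fun h => ⟨⟨ht.trans_lt h.1, h.2⟩, h.1⟩⟩

/-- Layer decomposition of the allocation-weighted bid shading. -/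
lemma exists_layers (S : BidSetup x x' Z Z' v b A W) {M : ℕ} (hM : 0 < M) :
    ∃ t : ℕ → ℝ, (∀ i, t i ∈ Icc (0 : ℝ) 1) ∧
      (∀ i : ℕ, ∀ r ∈ Icc (0 : ℝ) 1, (i : ℝ) < M * v r → t i ≤ r) ∧
      ∀ r ∈ Icc (0 : ℝ) 1, x r * (v r - b r)
        ≤ (∑ i ∈ Finset.range M, if (i : ℝ) < M * v r then x (t i) else 0) / M + x 1 / M := by
  have hM' : (0 : ℝ) < M := by exact_mod_cast hM
  -- The threshold `t i` is the generalized inverse of `v` at `i / M`; adjoining `1` keeps the set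
  -- nonempty when no value exceeds that level.
  have hbdd : ∀ i : ℕ, BddBelow (insert 1 {r | r ∈ Icc (0 : ℝ) 1 ∧ (i : ℝ) < M * v r}) :=
    fun i => ⟨0, by rintro y (rfl | hy); exacts [zero_le_one, hy.1.1]⟩
  have hmem : ∀ i : ℕ, sInf (insert 1 {r | r ∈ Icc (0 : ℝ) 1 ∧ (i : ℝ) < M * v r})
      ∈ Icc (0 : ℝ) 1 := fun i =>
    ⟨le_csInf (insert_nonempty _ _) (by rintro y (rfl | hy); exacts [zero_le_one, hy.1.1]),
      csInf_le (hbdd i) (mem_insert _ _)⟩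
  have hle : ∀ i : ℕ, ∀ r ∈ Icc (0 : ℝ) 1, (i : ℝ) < M * v r →
      sInf (insert 1 {r | r ∈ Icc (0 : ℝ) 1 ∧ (i : ℝ) < M * v r}) ≤ r := fun i r hr h =>
    csInf_le (hbdd i) (mem_insert_of_mem _ ⟨hr, h⟩)
  have hlt : ∀ i : ℕ, ∀ r ∈ Icc (0 : ℝ) 1,
      sInf (insert 1 {r | r ∈ Icc (0 : ℝ) 1 ∧ (i : ℝ) < M * v r}) < r → (i : ℝ) < M * v r := by
    intro i r hr h
    obtain ⟨u, hu, hur⟩ := exists_lt_of_csInf_lt (insert_nonempty _ _) h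
    rcases hu with rfl | hu
    · exact absurd hr.2 (not_le.2 hur)
    · exact hu.2.trans_le (mul_le_mul_of_nonneg_left (S.v_mono hu.1 hr hur.le) hM'.le)
  refine ⟨fun i => sInf (insert 1 {r | r ∈ Icc (0 : ℝ) 1 ∧ (i : ℝ) < M * v r}), hmem, hle,
    fun r hr => ?_⟩
  set t := fun i : ℕ => sInf (insert 1 {r | r ∈ Icc (0 : ℝ) 1 ∧ (i : ℝ) < M * v r}) with ht
  have hint : ∀ i, IntervalIntegrable ((Ioi (t i)).indicator x') volume 0 r := fun i => by
    have := (S.cont_x'.intervalIntegrable (μ := volume) 0 r)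
    rw [intervalIntegrable_iff] at this ⊢
    exact this.indicator measurableSet_Ioi
  -- At most `⌈M v(s)⌉` thresholds lie strictly below `s`, which is less than `M v(s) + 1`.
  -- Subtracting `x'` once covers the rounding and accounts for the error `x 1 / M`.
  have h1 : ∫ s in (0 : ℝ)..r, ((∑ i ∈ Finset.range M, (Ioi (t i)).indicator x' s) - x' s)
      ≤ ∫ s in (0 : ℝ)..r, M * (v s * x' s) := by
    refine intervalIntegral.integral_mono_on hr.1 ?_
      ((S.vx'_integrable zero_mem_Icc hr).const_mul _) fun s hs => ?_
    · refine IntervalIntegrable.sub ?_ (S.cont_x'.intervalIntegrable _ _)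
      simpa only [Finset.sum_fn] using IntervalIntegrable.sum (Finset.range M) fun i _ => hint i
    have hs' : s ∈ Icc (0 : ℝ) 1 := ⟨hs.1, hs.2.trans hr.2⟩
    have hx' := S.x'_nonneg s hs'
    have h2 : ∑ i ∈ Finset.range M, (Ioi (t i)).indicator x' s
        ≤ (∑ i ∈ Finset.range M, if (i : ℝ) < M * v s then (1 : ℝ) else 0) * x' s := by
      rw [Finset.sum_mul]
      refine Finset.sum_le_sum fun i _ => ?_
      by_cases h : t i < s
      · rw [indicator_of_mem (mem_Ioi.2 h), if_pos (hlt i s hs' h), one_mul]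
      · rw [indicator_of_notMem (by simpa using h)]
        split_ifs <;> simp [hx']
    rw [sum_layers (S.v_mem s hs').2] at h2
    have h3 := Nat.ceil_lt_add_one (mul_nonneg hM'.le (S.v_mem s hs').1)
    nlinarith
  rw [intervalIntegral.integral_sub, intervalIntegral.integral_finsetSum fun i _ => hint i,
    S.integral_x', intervalIntegral.integral_const_mul, ← S.payment r hr] at h1
  rotate_left
  · simpa only [Finset.sum_fn] using IntervalIntegrable.sum (Finset.range M) fun i _ => hint i
  · exact S.cont_x'.intervalIntegrable _ _
  have h4 : (∑ i ∈ Finset.range M, if (i : ℝ) < M * v r then (1 : ℝ) else 0) * x r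
      - ∑ i ∈ Finset.range M, ∫ s in (0 : ℝ)..r, (Ioi (t i)).indicator x' s
      ≤ ∑ i ∈ Finset.range M, if (i : ℝ) < M * v r then x (t i) else 0 := by
    rw [Finset.sum_mul, ← Finset.sum_sub_distrib]
    refine Finset.sum_le_sum fun i _ => ?_
    split_ifs with h
    · rw [S.integral_indicator_x' (hmem i).1 (hle i r hr h)]
      linarith
    · have : 0 ≤ ∫ s in (0 : ℝ)..r, (Ioi (t i)).indicator x' s :=
        intervalIntegral.integral_nonneg hr.1 fun s hs =>
          indicator_apply_nonneg fun _ => S.x'_nonneg s ⟨hs.1, hs.2.trans hr.2⟩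
      linarith
  rw [sum_layers (S.v_mem r hr).2] at h4
  have h5 := mul_le_mul_of_nonneg_right (Nat.le_ceil ((M : ℝ) * v r)) (S.x_pos r hr).le
  have h6 := S.x_mono hr one_mem_Icc hr.2
  have h7 := S.x_pos 0 zero_mem_Icc
  rw [← add_div, le_div_iff₀ hM']
  nlinarith

end BidSetup

/-- The weight function, capped at the level `W / x t` and normalized to `[0, 1]`. -/
noncomputable def cappedWeight (x Z : ℝ → ℝ) (W t p : ℝ) : ℝ := x t / W * min (Z p) (W / x t)

/-- The superlevel set of `cappedWeight` at level `j / M`. -/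
def weightLevel (x Z : ℝ → ℝ) (W : ℝ) (M : ℕ) (t : ℝ) (j : ℕ) : Set ℝ :=
  {p | p ∈ Icc (0 : ℝ) 1 ∧ (j : ℝ) < M * cappedWeight x Z W t p}

lemma measurable_comp_ecdf {N : ℕ} (s : Fin N → ℝ) (φ : ℝ → ℝ) :
    Measurable fun r => φ (ecdf s r) :=
  (measurable_from_nat (f := fun k : ℕ => φ (k / N))).comp (countLE_mono_right s).measurable

lemma measurableSet_ecdf_preimage {N : ℕ} (s : Fin N → ℝ) (I : Set ℝ) :
    MeasurableSet {r | ecdf s r ∈ I} :=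
  (countLE_mono_right s).measurable (MeasurableSet.of_discrete (s := {k : ℕ | (k : ℝ) / N ∈ I}))

lemma measurableSet_movedInto {N : ℕ} (s : Fin N → ℝ) {I : Set ℝ} (hI : MeasurableSet I) :
    MeasurableSet (movedInto s I) :=
  measurableSet_Icc.inter ((measurableSet_ecdf_preimage s I).inter hI.compl)

lemma measurableSet_movedOut {N : ℕ} (s : Fin N → ℝ) {I : Set ℝ} (hI : MeasurableSet I) :
    MeasurableSet (movedOut s I) :=
  measurableSet_Icc.inter (hI.inter (measurableSet_ecdf_preimage s I).compl)

namespace BidSetup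

variable {x x' Z Z' v b : ℝ → ℝ} {A W : ℝ}

lemma cappedWeight_mem (S : BidSetup x x' Z Z' v b A W) {t p : ℝ} (ht : t ∈ Icc (0 : ℝ) 1)
    (hp : p ∈ Icc (0 : ℝ) 1) : cappedWeight x Z W t p ∈ Icc (0 : ℝ) 1 := by
  have h := S.x_pos t ht
  have hW := S.W_pos
  refine ⟨mul_nonneg (div_pos h hW).le (le_min (S.Z_nonneg p hp) (div_pos hW h).le), ?_⟩
  refine (mul_le_mul_of_nonneg_left (min_le_right _ _) (div_pos h hW).le).trans_eq ?_
  field_simp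

lemma cappedWeight_sub (S : BidSetup x x' Z Z' v b A W) (t p r : ℝ) :
    W * (cappedWeight x Z W t p - cappedWeight x Z W t r)
      = x t * (min (Z p) (W / x t) - min (Z r) (W / x t)) := by
  have hW := S.W_pos
  simp only [cappedWeight]
  field_simp

/-- Quantiles above `t` never feel the cap, because `x t * Z r ≤ x r * Z r ≤ W`. -/
lemma min_Z_cap (S : BidSetup x x' Z Z' v b A W) {t r : ℝ} (ht : t ∈ Icc (0 : ℝ) 1)
    (hr : r ∈ Icc (0 : ℝ) 1) (h : t ≤ r) : min (Z r) (W / x t) = Z r := by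
  refine min_eq_left ?_
  rw [le_div_iff₀ (S.x_pos t ht), mul_comm]
  exact (mul_le_mul_of_nonneg_right (S.x_mono ht hr h) (S.Z_nonneg r hr)).trans (S.xZ_le r hr)

lemma weightLevel_shape (S : BidSetup x x' Z Z' v b A W) (M : ℕ) {t : ℝ}
    (ht : t ∈ Icc (0 : ℝ) 1) (j : ℕ) :
    weightLevel x Z W M t j = ∅ ∨
      (∃ β, 0 < β ∧ β ≤ 1 ∧ weightLevel x Z W M t j = Ico 0 β) ∨
      ∃ α β, 0 ≤ α ∧ α < β ∧ β ≤ 1 ∧ weightLevel x Z W M t j = Ioo α β := by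
  have hmono : Monotone fun z => (M : ℝ) * (x t / W * min z (W / x t)) := fun z z' h =>
    mul_le_mul_of_nonneg_left (mul_le_mul_of_nonneg_left (min_le_min_right _ h)
      (div_pos (S.x_pos t ht) S.W_pos).le) (Nat.cast_nonneg M)
  refine superlevel_shape (f := fun p => M * cappedWeight x Z W t p) (c := j) ?_ ?_ ?_
  · exact continuousOn_const.mul (continuousOn_const.mul (S.cont_Z.inf continuousOn_const))
  · intro p hp s hps r hr hsr
    have h := hmono (S.Z_quasi p hp s hps r hr hsr)
    exact (hmono.map_min (a := Z p) (b := Z r)).symm.trans_le h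
  · have : min 0 (W / x t) = 0 := min_eq_left (div_pos S.W_pos (S.x_pos t ht)).le
    simp [cappedWeight, S.Z_one, this]

lemma measurableSet_weightLevel (S : BidSetup x x' Z Z' v b A W) (M : ℕ) {t : ℝ}
    (ht : t ∈ Icc (0 : ℝ) 1) (j : ℕ) : MeasurableSet (weightLevel x Z W M t j) := by
  rcases S.weightLevel_shape M ht j with h | ⟨β, -, -, h⟩ | ⟨α, β, -, -, -, h⟩ <;> rw [h]
  exacts [MeasurableSet.empty, measurableSet_Ico, measurableSet_Ioo]

lemma posPart_cappedWeight_le (S : BidSetup x x' Z Z' v b A W) {M : ℕ} (hM : 0 < M) {t p r : ℝ}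
    (ht : t ∈ Icc (0 : ℝ) 1) (hp : p ∈ Icc (0 : ℝ) 1) (hr : r ∈ Icc (0 : ℝ) 1) :
    max 0 (cappedWeight x Z W t p - cappedWeight x Z W t r)
      ≤ (∑ j ∈ Finset.range M, open Classical in
        if p ∈ weightLevel x Z W M t j ∧ r ∉ weightLevel x Z W M t j then (1 : ℝ) else 0) / M
        + 1 / M := by
  refine (max_sub_le_sum_layers hM (S.cappedWeight_mem ht hp).2 (S.cappedWeight_mem ht hr).1
    (S.cappedWeight_mem ht hr).2).trans_eq ?_
  simp only [weightLevel, mem_ofPred_eq, hp, hr, true_and]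

/-- The layers of `x (v - b)` distribute `T` over the thresholds, each share carries the factor `x
r`, which cancels, and `x'/x ≤ A` finishes. The rounding term is compared through `x 0 ≤ x r`, hence
the ratio `x 1 / x 0`. -/
lemma db_mul_le (S : BidSetup x x' Z Z' v b A W) {M : ℕ} (hM : 0 < M) {t e : ℕ → ℝ} {r T : ℝ}
    (hr : r ∈ Icc (0 : ℝ) 1)
    (ht : x r * (v r - b r)
        ≤ (∑ i ∈ Finset.range M, if (i : ℝ) < M * v r then x (t i) else 0) / M + x 1 / M)
    (hT : 0 ≤ T) (hTW : T ≤ W) (he : ∀ i, 0 ≤ e i)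
    (hTe : ∀ i : ℕ, (i : ℝ) < M * v r → x (t i) * T ≤ W * x r * e i) :
    (v r - b r) * x' r / x r * T
      ≤ A * W * ((∑ i ∈ Finset.range M, e i) / M + x 1 / x 0 / M) := by
  have hM' : (0 : ℝ) < M := by exact_mod_cast hM
  have hx := S.x_pos r hr
  have hx0 := S.x_pos 0 zero_mem_Icc
  have hx1 := S.x_pos 1 one_mem_Icc
  have h01 := S.x_mono zero_mem_Icc hr hr.1
  have h1 : x r * (v r - b r) * T ≤ W * x r * (∑ i ∈ Finset.range M, e i) / M + x 1 / M * W := by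
    refine (mul_le_mul_of_nonneg_right ht hT).trans ?_
    rw [add_mul, div_mul_eq_mul_div, Finset.sum_mul, Finset.mul_sum]
    refine add_le_add (div_le_div_of_nonneg_right (Finset.sum_le_sum fun i _ => ?_) hM'.le)
      (mul_le_mul_of_nonneg_left hTW (by positivity))
    split_ifs with h
    · exact hTe i h
    · rw [zero_mul]
      exact mul_nonneg (mul_nonneg S.W_pos.le hx.le) (he i)
  have h2 : (v r - b r) * T ≤ W * ((∑ i ∈ Finset.range M, e i) / M + x 1 / x 0 / M) := by
    have h3 : x 1 / M * W ≤ x r * (W * (x 1 / x 0 / M)) := by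
      have : x 1 / M * W = x 0 * (W * (x 1 / x 0 / M)) := by field_simp
      rw [this]
      exact mul_le_mul_of_nonneg_right h01
        (mul_nonneg S.W_pos.le (div_nonneg (div_pos hx1 hx0).le hM'.le))
    have h4 : x r * ((v r - b r) * T)
        ≤ x r * (W * ((∑ i ∈ Finset.range M, e i) / M + x 1 / x 0 / M)) := by
      calc x r * ((v r - b r) * T) = x r * (v r - b r) * T := by ring
        _ ≤ W * x r * (∑ i ∈ Finset.range M, e i) / M + x r * (W * (x 1 / x 0 / M)) := by linarith
        _ = _ := by ring
    exact le_of_mul_le_mul_left h4 hx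
  have hvb := sub_nonneg.2 (S.b_le r hr)
  calc (v r - b r) * x' r / x r * T = x' r / x r * ((v r - b r) * T) := by ring
    _ ≤ A * ((v r - b r) * T) := mul_le_mul_of_nonneg_right
        ((div_le_iff₀ hx).2 (S.x'_le r hr)) (mul_nonneg hvb hT)
    _ ≤ A * (W * ((∑ i ∈ Finset.range M, e i) / M + x 1 / x 0 / M)) :=
        mul_le_mul_of_nonneg_left h2 S.A_pos.le
    _ = _ := by ring

/-- Pointwise form of the pathwise bound, for a primitive that increases. -/
lemma db_mul_integral_le (S : BidSetup x x' Z Z' v b A W) {M : ℕ} (hM : 0 < M) {t : ℕ → ℝ}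
    (ht : ∀ i, t i ∈ Icc (0 : ℝ) 1) {r p : ℝ} (hr : r ∈ Icc (0 : ℝ) 1) (hp : p ∈ Icc (0 : ℝ) 1)
    (htr : ∀ i : ℕ, (i : ℝ) < M * v r → t i ≤ r)
    (hC : x r * (v r - b r)
        ≤ (∑ i ∈ Finset.range M, if (i : ℝ) < M * v r then x (t i) else 0) / M + x 1 / M) :
    (v r - b r) * x' r / x r * (∫ q in r..p, x q * Z' q)
      ≤ A * W * ((∑ i ∈ Finset.range M, ((∑ j ∈ Finset.range M, open Classical in
        if p ∈ weightLevel x Z W M (t i) j ∧ r ∉ weightLevel x Z W M (t i) j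
          then (1 : ℝ) else 0) / M + 1 / M)) / M + x 1 / x 0 / M)
        + A * W * ((v r - b r) * x' r / x r * |p - r|) := by
  have hdb := S.db_nonneg hr
  have h0 : 0 ≤ A * W * |p - r| := mul_nonneg (mul_nonneg S.A_pos.le S.W_pos.le) (abs_nonneg _)
  have hG := (le_abs_self _).trans (S.abs_integral_xZ'_le hr hp)
  have key := S.db_mul_le hM (T := max 0 ((∫ q in r..p, x q * Z' q) - A * W * |p - r|)) hr hC
    (le_max_left _ _) (max_le S.W_pos.le (by linarith))
    (e := fun i => (∑ j ∈ Finset.range M, open Classical in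
        if p ∈ weightLevel x Z W M (t i) j ∧ r ∉ weightLevel x Z W M (t i) j
          then (1 : ℝ) else 0) / M + 1 / M)
    (fun i => (le_max_left _ _).trans (S.posPart_cappedWeight_le hM (ht i) hp hr)) fun i hi => ?_
  · have h2 := mul_le_mul_of_nonneg_left
      (le_max_right 0 ((∫ q in r..p, x q * Z' q) - A * W * |p - r|)) hdb
    linarith
  · have h3 := S.integral_xZ'_le hr hp (ht i) (htr i hi)
    have h4 := S.posPart_cappedWeight_le hM (ht i) hp hr
    have h5 := S.cappedWeight_sub (t i) p r
    rw [S.min_Z_cap (ht i) hr (htr i hi)] at h5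
    have h6 : max 0 ((∫ q in r..p, x q * Z' q) - A * W * |p - r|)
        ≤ x r * max 0 (min (Z p) (W / x (t i)) - Z r) :=
      max_le (mul_nonneg (S.x_pos r hr).le (le_max_left _ _)) (by linarith)
    have h7 : x (t i) * max 0 (min (Z p) (W / x (t i)) - Z r)
        = W * max 0 (cappedWeight x Z W (t i) p - cappedWeight x Z W (t i) r) := by
      rw [mul_max_of_nonneg _ _ (S.x_pos _ (ht i)).le, mul_max_of_nonneg _ _ S.W_pos.le, h5]
      simp
    calc x (t i) * max 0 ((∫ q in r..p, x q * Z' q) - A * W * |p - r|)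
        ≤ x (t i) * (x r * max 0 (min (Z p) (W / x (t i)) - Z r)) :=
          mul_le_mul_of_nonneg_left h6 (S.x_pos _ (ht i)).le
      _ = W * x r * max 0 (cappedWeight x Z W (t i) p - cappedWeight x Z W (t i) r) := by
          rw [mul_left_comm, h7]; ring
      _ ≤ _ := mul_le_mul_of_nonneg_left h4 (mul_pos S.W_pos (S.x_pos r hr)).le

/-- Pointwise form of the pathwise bound, for a primitive that decreases. -/
lemma neg_db_mul_integral_le (S : BidSetup x x' Z Z' v b A W) {M : ℕ} (hM : 0 < M) {t : ℕ → ℝ}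
    (ht : ∀ i, t i ∈ Icc (0 : ℝ) 1) {r p : ℝ} (hr : r ∈ Icc (0 : ℝ) 1) (hp : p ∈ Icc (0 : ℝ) 1)
    (htr : ∀ i : ℕ, (i : ℝ) < M * v r → t i ≤ r)
    (hC : x r * (v r - b r)
        ≤ (∑ i ∈ Finset.range M, if (i : ℝ) < M * v r then x (t i) else 0) / M + x 1 / M) :
    -((v r - b r) * x' r / x r * (∫ q in r..p, x q * Z' q))
      ≤ A * W * ((∑ i ∈ Finset.range M, ((∑ j ∈ Finset.range M, open Classical in
        if r ∈ weightLevel x Z W M (t i) j ∧ p ∉ weightLevel x Z W M (t i) j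
          then (1 : ℝ) else 0) / M + 1 / M)) / M + x 1 / x 0 / M)
        + A * W * ((v r - b r) * x' r / x r * |p - r|) := by
  have hdb := S.db_nonneg hr
  have h0 : 0 ≤ A * W * |p - r| := mul_nonneg (mul_nonneg S.A_pos.le S.W_pos.le) (abs_nonneg _)
  have hG := (neg_le_abs _).trans (S.abs_integral_xZ'_le hr hp)
  have key := S.db_mul_le hM (T := max 0 (-(∫ q in r..p, x q * Z' q) - A * W * |p - r|)) hr hC
    (le_max_left _ _) (max_le S.W_pos.le (by linarith))
    (e := fun i => (∑ j ∈ Finset.range M, open Classical in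
        if r ∈ weightLevel x Z W M (t i) j ∧ p ∉ weightLevel x Z W M (t i) j
          then (1 : ℝ) else 0) / M + 1 / M)
    (fun i => (le_max_left _ _).trans (S.posPart_cappedWeight_le hM (ht i) hr hp)) fun i hi => ?_
  · have h2 := mul_le_mul_of_nonneg_left
      (le_max_right 0 (-(∫ q in r..p, x q * Z' q) - A * W * |p - r|)) hdb
    linarith
  · have h3 := S.le_integral_xZ' (t := t i) hr hp
    have h4 := S.posPart_cappedWeight_le hM (ht i) hr hp
    have h5 := S.cappedWeight_sub (t i) r p
    rw [S.min_Z_cap (ht i) hr (htr i hi)] at h5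
    have h6 : max 0 (-(∫ q in r..p, x q * Z' q) - A * W * |p - r|)
        ≤ x r * max 0 (Z r - min (Z p) (W / x (t i))) :=
      max_le (mul_nonneg (S.x_pos r hr).le (le_max_left _ _)) (by linarith)
    have h7 : x (t i) * max 0 (Z r - min (Z p) (W / x (t i)))
        = W * max 0 (cappedWeight x Z W (t i) r - cappedWeight x Z W (t i) p) := by
      rw [mul_max_of_nonneg _ _ (S.x_pos _ (ht i)).le, mul_max_of_nonneg _ _ S.W_pos.le, h5]
      simp
    calc x (t i) * max 0 (-(∫ q in r..p, x q * Z' q) - A * W * |p - r|)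
        ≤ x (t i) * (x r * max 0 (Z r - min (Z p) (W / x (t i)))) :=
          mul_le_mul_of_nonneg_left h6 (S.x_pos _ (ht i)).le
      _ = W * x r * max 0 (cappedWeight x Z W (t i) r - cappedWeight x Z W (t i) p) := by
          rw [mul_left_comm, h7]; ring
      _ ≤ _ := mul_le_mul_of_nonneg_left h4 (mul_pos S.W_pos (S.x_pos r hr)).le

lemma integrable_db_mul (S : BidSetup x x' Z Z' v b A W) {g : ℝ → ℝ} {c : ℝ}
    (hg : AEStronglyMeasurable g (volume.restrict (Ioc 0 1)))
    (hc : ∀ r ∈ Icc (0 : ℝ) 1, |g r| ≤ c) :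
    IntervalIntegrable (fun r => (v r - b r) * x' r / x r * g r) volume 0 1 := by
  rw [intervalIntegrable_iff_integrableOn_Ioc_of_le zero_le_one]
  refine Integrable.mul_bdd (c := c) ((intervalIntegrable_iff_integrableOn_Ioc_of_le
    zero_le_one).1 (S.db_integrable zero_mem_Icc one_mem_Icc)) hg ?_
  exact (ae_restrict_iff' measurableSet_Ioc).2 (ae_of_all _ fun r hr => hc r (Ioc_subset_Icc_self hr))

lemma abs_ecdf_sub_le {N : ℕ} (s : Fin N → ℝ) {r : ℝ} (hr : r ∈ Icc (0 : ℝ) 1) :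
    |ecdf s r - r| ≤ 1 := by
  have := ecdf_mem s r
  rw [abs_le]
  constructor <;> linarith [this.1, this.2, hr.1, hr.2]

lemma integrable_db_mul_abs (S : BidSetup x x' Z Z' v b A W) {N : ℕ} (s : Fin N → ℝ) :
    IntervalIntegrable (fun r => (v r - b r) * x' r / x r * |ecdf s r - r|) volume 0 1 :=
  S.integrable_db_mul (c := 1)
    ((measurable_comp_ecdf s id).sub measurable_id).norm.aestronglyMeasurable
    fun r hr => by rw [abs_abs]; exact abs_ecdf_sub_le s hr

lemma integrable_db_mul_integral (S : BidSetup x x' Z Z' v b A W) {N : ℕ} (s : Fin N → ℝ) :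
    IntervalIntegrable (fun r => (v r - b r) * x' r / x r * ∫ q in r..ecdf s r, x q * Z' q)
      volume 0 1 := by
  refine S.integrable_db_mul (c := W + A * W * 1) ?_ fun r hr =>
    (S.abs_integral_xZ'_le hr (ecdf_mem s r)).trans (add_le_add_right
      (mul_le_mul_of_nonneg_left (abs_ecdf_sub_le s hr) (mul_pos S.A_pos S.W_pos).le) _)
  have hH : ContinuousOn (fun p => ∫ q in (0 : ℝ)..p, x q * Z' q) (Icc 0 1) := by
    have := intervalIntegral.continuousOn_primitive_interval (μ := volume)
      (f := fun q => x q * Z' q) (a := 0) (b := 1)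
      (by rw [uIcc_of_le zero_le_one]
          exact (S.cont_x.continuousOn.mul S.cont_Z').integrableOn_Icc)
    rwa [uIcc_of_le zero_le_one] at this
  have h1 := (measurable_comp_ecdf s fun p => ∫ q in (0 : ℝ)..p, x q * Z' q).aestronglyMeasurable
    (μ := volume.restrict (Ioc (0 : ℝ) 1))
  have h2 := (hH.mono Ioc_subset_Icc_self).aestronglyMeasurable (μ := volume) measurableSet_Ioc
  refine (h1.sub h2).congr ((ae_restrict_iff' measurableSet_Ioc).2 (ae_of_all _ fun r hr => ?_))
  have hr' := Ioc_subset_Icc_self hr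
  exact intervalIntegral.integral_interval_sub_left
    (S.xZ'_integrable zero_mem_Icc (ecdf_mem s r)) (S.xZ'_integrable zero_mem_Icc hr')

lemma integral_le_of_layers (S : BidSetup x x' Z Z' v b A W) {M : ℕ} (hM : 0 < M) {N : ℕ}
    (s : Fin N → ℝ) {J : ℕ → ℕ → Set ℝ} (hJ : ∀ i j, MeasurableSet (J i j))
    (hJs : ∀ i j, J i j ⊆ Icc (0 : ℝ) 1) {F : ℝ → ℝ} (hF : IntervalIntegrable F volume 0 1)
    {K : ℝ} (h : ∀ r ∈ Icc (0 : ℝ) 1, F r ≤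
      A * W * ((∑ i ∈ Finset.range M, ((∑ j ∈ Finset.range M, (J i j).indicator (1 : ℝ → ℝ) r) / M
        + 1 / M)) / M + K / M) + A * W * ((v r - b r) * x' r / x r * |ecdf s r - r|)) :
    ∫ r in (0 : ℝ)..1, F r
      ≤ A * W * ((∑ i ∈ Finset.range M, ∑ j ∈ Finset.range M, volume.real (J i j)) / M / M
        + (1 + K) / M)
        + A * W * ∫ r in (0 : ℝ)..1, (v r - b r) * x' r / x r * |ecdf s r - r| := by
  have hM' : (0 : ℝ) < M := by exact_mod_cast hM
  have hone : ∀ i j, IntervalIntegrable ((J i j).indicator (1 : ℝ → ℝ)) volume 0 1 := fun i j => by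
    rw [intervalIntegrable_iff_integrableOn_Ioc_of_le zero_le_one]
    exact (integrable_const (1 : ℝ)).indicator (hJ i j)
  have hval : ∀ i j, ∫ r in (0 : ℝ)..1, (J i j).indicator (1 : ℝ → ℝ) r = volume.real (J i j) := by
    intro i j
    rw [intervalIntegral.integral_of_le zero_le_one, integral_indicator_one (hJ i j),
      ← Measure.restrict_congr_set Ioc_ae_eq_Icc.symm, measureReal_restrict_apply (hJ i j),
      inter_eq_left.2 (hJs i j)]
  have hinner : ∀ i, IntervalIntegrable (fun r => (∑ j ∈ Finset.range M,
      (J i j).indicator (1 : ℝ → ℝ) r) / M + 1 / M) volume 0 1 := fun i =>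
    (IntervalIntegrable.div_const (by
      simpa only [Finset.sum_fn] using IntervalIntegrable.sum (Finset.range M) fun j _ => hone i j)
      _).add (_root_.intervalIntegrable_const (μ := volume))
  have houter : IntervalIntegrable (fun r => ∑ i ∈ Finset.range M, ((∑ j ∈ Finset.range M,
      (J i j).indicator (1 : ℝ → ℝ) r) / M + 1 / M)) volume 0 1 := by
    simpa only [Finset.sum_fn] using IntervalIntegrable.sum (Finset.range M) fun i _ => hinner i
  have hfull : IntervalIntegrable (fun r => A * W * ((∑ i ∈ Finset.range M,
      ((∑ j ∈ Finset.range M, (J i j).indicator (1 : ℝ → ℝ) r) / M + 1 / M)) / M + K / M))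
      volume 0 1 :=
    ((houter.div_const _).add (_root_.intervalIntegrable_const (μ := volume))).const_mul _
  have hX := (S.integrable_db_mul_abs s).const_mul (A * W)
  refine (intervalIntegral.integral_mono_on zero_le_one hF (hfull.add hX) h).trans_eq ?_
  rw [intervalIntegral.integral_add hfull hX, intervalIntegral.integral_const_mul,
    intervalIntegral.integral_const_mul, intervalIntegral.integral_add (houter.div_const _)
      (_root_.intervalIntegrable_const (μ := volume)), intervalIntegral.integral_div,
    intervalIntegral.integral_finsetSum fun i _ => hinner i]
  have : ∀ i, ∫ r in (0 : ℝ)..1, ((∑ j ∈ Finset.range M, (J i j).indicator (1 : ℝ → ℝ) r) / M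
      + 1 / M) = (∑ j ∈ Finset.range M, volume.real (J i j)) / M + 1 / M := fun i => by
    rw [intervalIntegral.integral_add (IntervalIntegrable.div_const (by
      simpa only [Finset.sum_fn] using IntervalIntegrable.sum (Finset.range M) fun j _ => hone i j)
      _) (_root_.intervalIntegrable_const (μ := volume)), intervalIntegral.integral_div,
      intervalIntegral.integral_finsetSum fun j _ => hone i j]
    simp [hval]
  simp only [this, Finset.sum_add_distrib, ← Finset.sum_div, Finset.sum_const, Finset.card_range,
    intervalIntegral.integral_const]
  simp only [nsmul_eq_mul, smul_eq_mul]
  field_simp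
  ring

/-- The pathwise bound: the effect of replacing the identity by an empirical distribution function
is controlled by the displacement of superlevel sets of the weight. -/
lemma exists_pathwise_bound (S : BidSetup x x' Z Z' v b A W) {M : ℕ} (hM : 0 < M) :
    ∃ t : ℕ → ℝ, (∀ i, t i ∈ Icc (0 : ℝ) 1) ∧ ∀ {N : ℕ} (s : Fin N → ℝ),
      |∫ r in (0 : ℝ)..1, (v r - b r) * x' r / x r * ∫ q in r..ecdf s r, x q * Z' q|
        ≤ A * W * ((∑ i ∈ Finset.range M, ∑ j ∈ Finset.range M,
            max (volume.real (movedInto s (weightLevel x Z W M (t i) j)))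
              (volume.real (movedOut s (weightLevel x Z W M (t i) j)))) / M / M
            + (1 + x 1 / x 0) / M)
          + A * W * ∫ r in (0 : ℝ)..1, (v r - b r) * x' r / x r * |ecdf s r - r| := by
  obtain ⟨t, ht, htr, hC⟩ := S.exists_layers hM
  refine ⟨t, ht, fun {N} s => ?_⟩
  have hAW := (mul_pos S.A_pos S.W_pos).le
  have hmono : ∀ f g : ℕ → ℕ → ℝ, (∀ i j, f i j ≤ g i j) →
      (∑ i ∈ Finset.range M, ∑ j ∈ Finset.range M, f i j) / M / M
        ≤ (∑ i ∈ Finset.range M, ∑ j ∈ Finset.range M, g i j) / M / M := fun f g h => by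
    gcongr
    exact h _ _
  -- The upper bound for the integral involves only sets moved into a level and the lower bound only
  -- sets moved out. Hence the maximum of the two measures, and not their sum, appears.
  rw [abs_le', ← intervalIntegral.integral_neg]
  constructor
  · refine (S.integral_le_of_layers hM s (J := fun i j => movedInto s (weightLevel x Z W M (t i) j))
      (fun i j => measurableSet_movedInto s (S.measurableSet_weightLevel M (ht i) j))
      (fun i j r hr => hr.1) (S.integrable_db_mul_integral s) (K := x 1 / x 0)
      fun r hr => ?_).trans (add_le_add_left (mul_le_mul_of_nonneg_left (add_le_add_left
        (hmono _ _ fun i j => le_max_left _ _) _) hAW) _)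
    refine (S.db_mul_integral_le hM ht hr (ecdf_mem s r) (fun i => htr i r hr) (hC r hr)).trans_eq ?_
    have e : ∀ i j, (movedInto s (weightLevel x Z W M (t i) j)).indicator (1 : ℝ → ℝ) r = open Classical in
        if ecdf s r ∈ weightLevel x Z W M (t i) j ∧ r ∉ weightLevel x Z W M (t i) j
          then (1 : ℝ) else 0 := fun i j => by
      classical
      rw [indicator_apply]
      exact if_congr ⟨fun h => h.2, fun h => ⟨hr, h⟩⟩ rfl rfl
    simp only [e]
  · refine (S.integral_le_of_layers hM s (J := fun i j => movedOut s (weightLevel x Z W M (t i) j))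
      (fun i j => measurableSet_movedOut s (S.measurableSet_weightLevel M (ht i) j))
      (fun i j r hr => hr.1) (S.integrable_db_mul_integral s).neg (K := x 1 / x 0)
      fun r hr => ?_).trans (add_le_add_left (mul_le_mul_of_nonneg_left (add_le_add_left
        (hmono _ _ fun i j => le_max_right _ _) _) hAW) _)
    refine (S.neg_db_mul_integral_le hM ht hr (ecdf_mem s r) (fun i => htr i r hr)
      (hC r hr)).trans_eq ?_
    have e : ∀ i j, (movedOut s (weightLevel x Z W M (t i) j)).indicator (1 : ℝ → ℝ) r = open Classical in
        if r ∈ weightLevel x Z W M (t i) j ∧ ecdf s r ∉ weightLevel x Z W M (t i) j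
          then (1 : ℝ) else 0 := fun i j => by
      classical
      rw [indicator_apply]
      exact if_congr ⟨fun h => h.2, fun h => ⟨hr, h⟩⟩ rfl rfl
    simp only [e]

/-- No layers here: the density `b'` has total mass `b 1`, which multiplies the crude bound `W`. For
small samples with large `A` this beats the layered estimate. -/
lemma abs_integral_db_mul_le (S : BidSetup x x' Z Z' v b A W) {N : ℕ} (s : Fin N → ℝ) :
    |∫ r in (0 : ℝ)..1, (v r - b r) * x' r / x r * ∫ q in r..ecdf s r, x q * Z' q|
      ≤ W * b 1 + A * W * ∫ r in (0 : ℝ)..1, (v r - b r) * x' r / x r * |ecdf s r - r| := by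
  have h1 := (S.db_integrable zero_mem_Icc one_mem_Icc).const_mul W
  have h2 := (S.integrable_db_mul_abs s).const_mul (A * W)
  refine (intervalIntegral.abs_integral_le_integral_abs zero_le_one).trans ?_
  refine (intervalIntegral.integral_mono_on zero_le_one (S.integrable_db_mul_integral s).abs
    (h1.add h2) fun r hr => ?_).trans_eq ?_
  · rw [abs_mul, abs_of_nonneg (S.db_nonneg hr)]
    refine (mul_le_mul_of_nonneg_left (S.abs_integral_xZ'_le hr (ecdf_mem s r))
      (S.db_nonneg hr)).trans_eq ?_
    ring
  · rw [intervalIntegral.integral_add h1 h2, intervalIntegral.integral_const_mul,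
      intervalIntegral.integral_const_mul, S.integral_db one_mem_Icc]

end BidSetup

/-! ### The estimation error as an integral over quantiles -/

lemma ae_eq_Ioc_of_between {T : Set ℝ} {a c : ℝ} (h1 : Ioo a c ⊆ T) (h2 : T ⊆ Icc a c) :
    T =ᵐ[volume] Ioc a c :=
  (h2.eventuallyLE.trans Ioc_ae_eq_Icc.symm.le).antisymm
    (Ioo_ae_eq_Ioc.symm.le.trans h1.eventuallyLE)

/-- The Galois connection between the empirical quantile function and the empirical distribution
function, which identifies the region of integration in Fubini's theorem. -/
lemma lt_empBid_iff {N : ℕ} (hN : 0 < N) (s : Fin N → ℝ) {q : ℝ} (hq : q ∈ Ico (0 : ℝ) 1)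
    (r : ℝ) : r < empBid s q ↔ ecdf s r ≤ q := by
  have hN' : (0 : ℝ) < N := by exact_mod_cast hN
  have h : ⌊(N : ℝ) * q⌋₊ < N := by
    rw [Nat.floor_lt (mul_nonneg hN'.le hq.1)]
    exact mul_lt_of_lt_one_right hN' hq.2
  have h1 : empBid s q = ordStat ⟨⌊(N : ℝ) * q⌋₊, h⟩ s := by
    rw [empBid, dif_pos h, ordStat]
  rw [h1, lt_ordStat_iff, ecdf, div_le_iff₀ hN', mul_comm q]
  exact Nat.le_floor_iff (mul_nonneg hN'.le hq.1)

lemma empBid_mem {N : ℕ} (hN : 0 < N) {s : Fin N → ℝ} {S : Set ℝ} (hs : ∀ j, s j ∈ S) {q : ℝ}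
    (hq : q ∈ Ico (0 : ℝ) 1) : empBid s q ∈ S := by
  have hN' : (0 : ℝ) < N := by exact_mod_cast hN
  have h : ⌊(N : ℝ) * q⌋₊ < N := by
    rw [Nat.floor_lt (mul_nonneg hN'.le hq.1)]
    exact mul_lt_of_lt_one_right hN' hq.2
  rw [empBid, dif_pos h]
  exact hs _

lemma empBid_comp {N : ℕ} (hN : 0 < N) {s : Fin N → ℝ} {b : ℝ → ℝ} {S : Set ℝ}
    (hs : ∀ j, s j ∈ S) (hb : MonotoneOn b S) {q : ℝ} (hq : q ∈ Ico (0 : ℝ) 1) :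
    empBid (fun j => b (s j)) q = b (empBid s q) := by
  have hN' : (0 : ℝ) < N := by exact_mod_cast hN
  have h : ⌊(N : ℝ) * q⌋₊ < N := by
    rw [Nat.floor_lt (mul_nonneg hN'.le hq.1)]
    exact mul_lt_of_lt_one_right hN' hq.2
  rw [empBid, empBid, dif_pos h, dif_pos h]
  exact ordStat_comp ⟨⌊(N : ℝ) * q⌋₊, h⟩ hs hb

namespace BidSetup

variable {x x' Z Z' v b : ℝ → ℝ} {A W : ℝ}

/-- Write `b (Φ q)` as the integral of `b'` over `[0, Φ q]` and exchange the integrals over the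
region `K`. The hypotheses leave boundary points of the sections free, so step functions are
allowed. -/
lemma integral_xZ'_mul_b (S : BidSetup x x' Z Z' v b A W) {K : Set (ℝ × ℝ)}
    (hK : MeasurableSet K) {Φ Γ : ℝ → ℝ} (hΦ : ∀ q ∈ Ioo (0 : ℝ) 1, Φ q ∈ Icc (0 : ℝ) 1)
    (hΓ : ∀ r ∈ Ioo (0 : ℝ) 1, Γ r ∈ Icc (0 : ℝ) 1)
    (h1 : ∀ q ∈ Ioo (0 : ℝ) 1, ∀ r, r < Φ q → (q, r) ∈ K)
    (h2 : ∀ q ∈ Ioo (0 : ℝ) 1, ∀ r, (q, r) ∈ K → r ≤ Φ q)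
    (h3 : ∀ r ∈ Ioo (0 : ℝ) 1, ∀ q ∈ Ioo (0 : ℝ) 1, Γ r < q → (q, r) ∈ K)
    (h4 : ∀ r ∈ Ioo (0 : ℝ) 1, ∀ q ∈ Ioo (0 : ℝ) 1, (q, r) ∈ K → Γ r ≤ q) :
    ∫ q in (0 : ℝ)..1, x q * Z' q * b (Φ q)
      = ∫ r in (0 : ℝ)..1, (v r - b r) * x' r / x r * ∫ q in Γ r..1, x q * Z' q := by
  have hdb : Integrable (fun r => (v r - b r) * x' r / x r) (volume.restrict (Ioo (0 : ℝ) 1)) :=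
    (S.cont_db.integrableOn_Icc).mono_set Ioo_subset_Icc_self
  have hw : Integrable (fun q => x q * Z' q) (volume.restrict (Ioo (0 : ℝ) 1)) :=
    ((S.cont_x.continuousOn.mul S.cont_Z').integrableOn_Icc).mono_set Ioo_subset_Icc_self
  have hint : Integrable (K.indicator fun p => x p.1 * Z' p.1 * ((v p.2 - b p.2) * x' p.2 / x p.2))
      ((volume.restrict (Ioo (0 : ℝ) 1)).prod (volume.restrict (Ioo (0 : ℝ) 1))) :=
    (hw.mul_prod hdb).indicator hK
  have hswap := integral_integral_swap (f := fun q r => K.indicator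
    (fun p => x p.1 * Z' p.1 * ((v p.2 - b p.2) * x' p.2 / x p.2)) (q, r)) hint
  rw [intervalIntegral.integral_of_le zero_le_one, intervalIntegral.integral_of_le zero_le_one,
    integral_Ioc_eq_integral_Ioo, integral_Ioc_eq_integral_Ioo]
  convert hswap using 1
  · refine setIntegral_congr_fun measurableSet_Ioo fun q hq => ?_
    have hm : MeasurableSet {r | (q, r) ∈ K} := measurable_prodMk_left hK
    have e : ∀ r, K.indicator (fun p => x p.1 * Z' p.1 * ((v p.2 - b p.2) * x' p.2 / x p.2)) (q, r)
        = x q * Z' q * {r | (q, r) ∈ K}.indicator (fun r => (v r - b r) * x' r / x r) r := fun r => by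
      by_cases h : (q, r) ∈ K
      · rw [indicator_of_mem h, indicator_of_mem (by exact h)]
      · rw [indicator_of_notMem h, indicator_of_notMem (by exact h), mul_zero]
    simp only [e]
    rw [integral_const_mul, setIntegral_indicator hm, setIntegral_congr_set
      (ae_eq_Ioc_of_between (a := 0) (c := Φ q) ?_ ?_),
      ← intervalIntegral.integral_of_le (hΦ q hq).1, S.integral_db (hΦ q hq)]
    · exact fun r hr => ⟨⟨hr.1, hr.2.trans_le (hΦ q hq).2⟩, h1 q hq r hr.2⟩
    · exact fun r hr => ⟨hr.1.1.le, h2 q hq r hr.2⟩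
  · refine setIntegral_congr_fun measurableSet_Ioo fun r hr => ?_
    have hm : MeasurableSet {q | (q, r) ∈ K} := measurable_prodMk_right hK
    have e : ∀ q, K.indicator (fun p => x p.1 * Z' p.1 * ((v p.2 - b p.2) * x' p.2 / x p.2)) (q, r)
        = (v r - b r) * x' r / x r * {q | (q, r) ∈ K}.indicator (fun q => x q * Z' q) q := fun q => by
      by_cases h : (q, r) ∈ K
      · rw [indicator_of_mem h, indicator_of_mem (by exact h), mul_comm]
      · rw [indicator_of_notMem h, indicator_of_notMem (by exact h), mul_zero]
    simp only [e]
    rw [integral_const_mul, setIntegral_indicator hm, setIntegral_congr_set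
      (ae_eq_Ioc_of_between (a := Γ r) (c := 1) ?_ ?_),
      ← intervalIntegral.integral_of_le (hΓ r hr).2]
    · exact fun q hq => ⟨⟨(hΓ r hr).1.trans_lt hq.1, hq.2⟩,
        h3 r hr q ⟨(hΓ r hr).1.trans_lt hq.1, hq.2⟩ hq.1⟩
    · exact fun q hq => ⟨h4 r hr q hq.1 hq.2, hq.1.2.le⟩

lemma measurable_ecdf {N : ℕ} (s : Fin N → ℝ) : Measurable (ecdf s) := measurable_comp_ecdf s id

/-- The error of the plug-in estimate built from a sample of quantiles. -/
lemma estimate_sub_eq (S : BidSetup x x' Z Z' v b A W) {N : ℕ} (hN : 0 < N) {s : Fin N → ℝ}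
    (hs : ∀ j, s j ∈ Icc (0 : ℝ) 1) :
    (∫ q in (0 : ℝ)..1, x q * Z' q * b (empBid s q)) - ∫ q in (0 : ℝ)..1, x q * Z' q * b q
      = -∫ r in (0 : ℝ)..1, (v r - b r) * x' r / x r * ∫ q in r..ecdf s r, x q * Z' q := by
  have e1 := S.integral_xZ'_mul_b (K := {p | ecdf s p.2 ≤ p.1}) (Φ := empBid s) (Γ := ecdf s)
    (measurableSet_le ((measurable_ecdf s).comp measurable_snd) measurable_fst)
    (fun q hq => empBid_mem hN hs (Ioo_subset_Ico_self hq)) (fun r _ => ecdf_mem s r)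
    (fun q hq r h => (lt_empBid_iff hN s (Ioo_subset_Ico_self hq) r).1 h)
    (fun q hq r h => ((lt_empBid_iff hN s (Ioo_subset_Ico_self hq) r).2 h).le)
    (fun r _ q _ h => h.le) (fun r _ q _ h => h)
  have e2 := S.integral_xZ'_mul_b (K := {p | p.2 ≤ p.1}) (Φ := id) (Γ := id)
    (measurableSet_le measurable_snd measurable_fst)
    (fun q hq => Ioo_subset_Icc_self hq) (fun r hr => Ioo_subset_Icc_self hr)
    (fun q _ r h => h.le) (fun q _ r h => h) (fun r _ q _ h => h.le) (fun r _ q _ h => h)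
  simp only [id] at e2
  have hI := S.integrable_db_mul_integral s
  have hI1 : IntervalIntegrable (fun r => (v r - b r) * x' r / x r * ∫ q in r..1, x q * Z' q)
      volume 0 1 := by
    refine ContinuousOn.intervalIntegrable ?_
    rw [uIcc_of_le zero_le_one]
    refine S.cont_db.mul ?_
    have := intervalIntegral.continuousOn_primitive_interval_left (μ := volume)
      (f := fun q => x q * Z' q) (a := 0) (b := 1)
      (by rw [uIcc_of_le zero_le_one]
          exact (S.cont_x.continuousOn.mul S.cont_Z').integrableOn_Icc)
    rwa [uIcc_of_le zero_le_one] at this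
  rw [e1, e2, sub_eq_iff_eq_add, neg_add_eq_sub, ← intervalIntegral.integral_sub hI1 hI]
  refine intervalIntegral.integral_congr fun r hr => ?_
  rw [uIcc_of_le zero_le_one] at hr
  have := intervalIntegral.integral_add_adjacent_intervals
    (S.xZ'_integrable hr (ecdf_mem s r)) (S.xZ'_integrable (ecdf_mem s r) one_mem_Icc)
  rw [← this]
  ring

/-! #### Mean-square bounds -/

/-- The mean-square deviation of the empirical distribution function, weighted by the bid density. -/
noncomputable def sqDeviation (x x' v b : ℝ → ℝ) {N : ℕ} (s : Fin N → ℝ) : ℝ :=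
  ∫ r in (0 : ℝ)..1, (v r - b r) * x' r / x r * (ecdf s r - r) ^ 2

/-- Cauchy–Schwarz for the measure with density `b'`, whose total mass is `b 1`. -/
lemma integral_deviation_le (S : BidSetup x x' Z Z' v b A W) {N : ℕ} (s : Fin N → ℝ) :
    ∫ r in (0 : ℝ)..1, (v r - b r) * x' r / x r * |ecdf s r - r|
      ≤ Real.sqrt (b 1 * sqDeviation x x' v b s) := by
  set X := ∫ r in (0 : ℝ)..1, (v r - b r) * x' r / x r * |ecdf s r - r| with hX
  have hb := S.b_nonneg one_mem_Icc
  have hX1 : X ≤ b 1 := by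
    rw [← S.integral_db one_mem_Icc]
    exact intervalIntegral.integral_mono_on zero_le_one (S.integrable_db_mul_abs s)
      (S.db_integrable zero_mem_Icc one_mem_Icc)
      fun r hr => mul_le_of_le_one_right (S.db_nonneg hr) (abs_ecdf_sub_le s hr)
  rcases hb.eq_or_lt with h0 | h0
  · exact (hX1.trans_eq h0.symm).trans (Real.sqrt_nonneg _)
  refine Real.le_sqrt_of_sq_le ?_
  have i1 := S.integrable_db_mul_abs s
  have i2 := S.db_integrable zero_mem_Icc one_mem_Icc
  have i3 : IntervalIntegrable (fun r => (v r - b r) * x' r / x r * (ecdf s r - r) ^ 2)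
      volume 0 1 := by
    refine S.integrable_db_mul (c := 1)
      (((measurable_ecdf s).sub measurable_id).pow_const 2).aestronglyMeasurable fun r hr => ?_
    rw [abs_pow]
    exact pow_le_one₀ (abs_nonneg _) (abs_ecdf_sub_le s hr)
  -- Expansion of `(b 1 |F r - r| - X)²` integrated against the density.
  have h : 0 ≤ ∫ r in (0 : ℝ)..1, (b 1 ^ 2 * ((v r - b r) * x' r / x r * (ecdf s r - r) ^ 2)
      - 2 * b 1 * X * ((v r - b r) * x' r / x r * |ecdf s r - r|)
      + X ^ 2 * ((v r - b r) * x' r / x r)) := by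
    refine intervalIntegral.integral_nonneg zero_le_one fun r hr => ?_
    have := mul_nonneg (S.db_nonneg hr) (sq_nonneg (b 1 * |ecdf s r - r| - X))
    rw [← sq_abs (ecdf s r - r)]
    linarith
  rw [intervalIntegral.integral_add ((i3.const_mul _).sub (i1.const_mul _)) (i2.const_mul _),
    intervalIntegral.integral_sub (i3.const_mul _) (i1.const_mul _),
    intervalIntegral.integral_const_mul, intervalIntegral.integral_const_mul,
    intervalIntegral.integral_const_mul, ← hX, S.integral_db one_mem_Icc] at h
  have h' : 0 ≤ b 1 * (b 1 * sqDeviation x x' v b s - X ^ 2) := by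
    rw [sqDeviation]; linarith
  have := nonneg_of_mul_nonneg_right h' h0
  linarith

variable {Ω : Type*} [MeasurableSpace Ω] {μ : Measure Ω} [IsProbabilityMeasure μ]

/-- After Fubini the variance `r(1-r)/N` of the empirical distribution function appears, and `r(1-r)
≤ 1/4`. -/
lemma sqDeviation_integrable (S : BidSetup x x' Z Z' v b A W) {N : ℕ} (hN : 0 < N)
    {U : Fin N → Ω → ℝ} (hU : IsUniformSample μ U) :
    Integrable (fun ω => sqDeviation x x' v b fun j => U j ω) μ ∧
      ∫ ω, sqDeviation x x' v b (fun j => U j ω) ∂μ ≤ b 1 / (4 * N) := by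
  have hN' : (0 : ℝ) < N := by exact_mod_cast hN
  have hdb : Integrable (fun r => (v r - b r) * x' r / x r) (volume.restrict (Ioc (0 : ℝ) 1)) :=
    (S.cont_db.integrableOn_Icc).mono_set Ioc_subset_Icc_self
  have hmeas : Measurable fun p : Ω × ℝ => ecdf (fun j => U j p.1) p.2 := by
    simp only [ecdf, countLE_eq_sum]
    refine Measurable.div_const (Finset.measurable_fun_sum _ fun j _ => ?_) _
    refine Measurable.ite (measurableSet_le ((hU.meas j).comp measurable_fst) measurable_snd)
      measurable_const measurable_const
  have hint : Integrable (fun p : Ω × ℝ => (v p.2 - b p.2) * x' p.2 / x p.2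
      * (ecdf (fun j => U j p.1) p.2 - p.2) ^ 2) (μ.prod (volume.restrict (Ioc (0 : ℝ) 1))) := by
    refine Integrable.mul_bdd (c := 1) ?_
      ((hmeas.sub measurable_snd).pow_const 2).aestronglyMeasurable ?_
    · exact hdb.comp_snd μ
    · have h1 : ∀ᵐ p : Ω × ℝ ∂(μ.prod (volume.restrict (Ioc (0 : ℝ) 1))), p.2 ∈ Ioc (0 : ℝ) 1 :=
        Measure.quasiMeasurePreserving_snd.ae (ae_restrict_mem measurableSet_Ioc)
      filter_upwards [h1] with p hp
      rw [Real.norm_eq_abs, abs_pow]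
      exact pow_le_one₀ (abs_nonneg _) (abs_ecdf_sub_le _ (Ioc_subset_Icc_self hp))
  have hsq : (fun ω => sqDeviation x x' v b fun j => U j ω) = fun ω =>
      ∫ r, (v r - b r) * x' r / x r * (ecdf (fun j => U j ω) r - r) ^ 2
        ∂(volume.restrict (Ioc (0 : ℝ) 1)) := by
    funext ω
    rw [sqDeviation, intervalIntegral.integral_of_le zero_le_one]
  rw [hsq]
  refine ⟨hint.integral_prod_left, ?_⟩
  rw [integral_integral_swap hint, ← intervalIntegral.integral_of_le zero_le_one]
  have hval : ∀ r ∈ Icc (0 : ℝ) 1, ∫ ω, (v r - b r) * x' r / x r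
      * (ecdf (fun j => U j ω) r - r) ^ 2 ∂μ = (v r - b r) * x' r / x r * (r * (1 - r) / N) := by
    intro r hr
    rw [integral_const_mul]
    congr 1
    have e : ∀ ω, (ecdf (fun j => U j ω) r - r) ^ 2
        = ((countLE (fun j => U j ω) r : ℝ) - N * r) ^ 2 / (N : ℝ) ^ 2 := fun ω => by
      rw [ecdf]; field_simp
    simp only [e]
    rw [integral_div, hU.integral_countLE_sub_sq hr]
    field_simp
  rw [intervalIntegral.integral_congr (g := fun r => (v r - b r) * x' r / x r * (r * (1 - r) / N))
    fun r hr => hval r (by rwa [uIcc_of_le zero_le_one] at hr)]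
  have hb : b 1 / (4 * N) = ∫ r in (0 : ℝ)..1, (v r - b r) * x' r / x r * (1 / (4 * N)) := by
    rw [intervalIntegral.integral_mul_const, S.integral_db one_mem_Icc]; ring
  rw [hb]
  refine intervalIntegral.integral_mono_on zero_le_one ?_
    ((S.db_integrable zero_mem_Icc one_mem_Icc).mul_const _) fun r hr => ?_
  · refine ContinuousOn.intervalIntegrable ?_
    rw [uIcc_of_le zero_le_one]
    exact S.cont_db.mul (by fun_prop)
  · refine mul_le_mul_of_nonneg_left ?_ (S.db_nonneg hr)
    rw [div_le_div_iff₀ hN' (by positivity)]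
    nlinarith [sq_nonneg (2 * r - 1)]

end BidSetup

/-! ### Numerical estimates -/

/-- Equivalent to `tanh(A/2) ≤ A/2`; it follows from `2y/(y+2) ≤ log(1+y)` at `y = e^A - 1`. -/
lemma one_sub_exp_neg_le {A : ℝ} (hA : 0 < A) : (1 - Real.exp (-A)) * (2 + A) ≤ 2 * A := by
  have h1 : 0 < Real.exp A - 1 := by linarith [Real.add_one_lt_exp hA.ne']
  have h2 := Real.le_log_one_add_of_nonneg h1.le
  rw [add_sub_cancel, Real.log_exp, div_le_iff₀ (by linarith)] at h2
  have h3 : Real.exp (-A) * Real.exp A = 1 := by rw [← Real.exp_add]; simp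
  have h4 := mul_le_mul_of_nonneg_left h2 (Real.exp_pos (-A)).le
  nlinarith

lemma exp_div_le {p q : ℕ} (hq : 0 < q) {c : ℝ} (hc : 0 ≤ c)
    (h : (2.7182818286 : ℝ) ^ p ≤ c ^ q) : Real.exp (p / q) ≤ c := by
  have hq' : (q : ℝ) ≠ 0 := by exact_mod_cast hq.ne'
  refine le_of_pow_le_pow_left₀ hq.ne' hc (le_trans ?_ h)
  rw [← Real.exp_nat_mul, mul_div_cancel₀ _ hq', ← mul_one (p : ℝ), Real.exp_nat_mul]
  exact pow_le_pow_left₀ (Real.exp_pos _).le Real.exp_one_lt_d9.le _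

lemma le_one_sub_inv {A A₀ y c : ℝ} (hy : y ≤ 1 - Real.exp (-A)) (hA : A ≤ A₀)
    (hc : Real.exp A₀ ≤ c) : y ≤ 1 - 1 / c := by
  have h1 : 1 / c ≤ 1 / Real.exp A₀ := one_div_le_one_div_of_le (Real.exp_pos _) hc
  have h2 : 1 / Real.exp A₀ = Real.exp (-A₀) := by rw [Real.exp_neg, one_div]
  have h3 : Real.exp (-A₀) ≤ Real.exp (-A) := Real.exp_le_exp.2 (by linarith)
  linarith

/-- Here `y` is the highest bid. The first alternative is what the crude pathwise bound needs, the
second what the layered bound needs, both after division by `A W / √N`. -/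
lemma exists_numeric_bound {N : ℕ} (hN : 0 < N) {A y : ℝ} (hA : 0 < A) (hy0 : 0 ≤ y)
    (hy : y ≤ 1 - Real.exp (-A)) :
    Real.sqrt N * y / A + y / 2 ≤ Real.sqrt 2 ∨
      ∃ c, DeviationBound N c ∧ Real.sqrt (8 / 3 * c) + y / 2 ≤ Real.sqrt 2 := by
  have hs2 : (1.4142 : ℝ) ≤ Real.sqrt 2 := Real.le_sqrt_of_sq_le (by norm_num)
  have hy1 : y ≤ 1 := by linarith [Real.exp_pos (-A)]
  have hbase : y / A + y / 2 ≤ 1 := by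
    have h1 := one_sub_exp_neg_le hA
    have h2 := mul_le_mul_of_nonneg_right hy (by linarith : 0 ≤ 2 + A)
    have : y / A + y / 2 = y * (2 + A) / (2 * A) := by field_simp
    rw [this, div_le_one (by linarith)]
    linarith
  have hbound : ∀ {A₀ y₀ c : ℝ}, 0 < A₀ → A₀ ≤ A → y ≤ y₀ → Real.sqrt N ≤ c →
      c * y₀ / A₀ + y₀ / 2 ≤ 1.4142 → Real.sqrt N * y / A + y / 2 ≤ Real.sqrt 2 := by
    intro A₀ y₀ c h0 h1 h2 h3 h4
    have h5 : Real.sqrt N * y / A ≤ c * y₀ / A₀ := by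
      refine div_le_div₀ ?_ ?_ h0 h1
      · exact mul_nonneg ((Real.sqrt_nonneg _).trans h3) (hy0.trans h2)
      · exact mul_le_mul h3 h2 hy0 ((Real.sqrt_nonneg _).trans h3)
    linarith
  rcases (by omega : N = 1 ∨ N = 2 ∨ N = 3 ∨ N = 4 ∨ 5 ≤ N) with rfl | rfl | rfl | rfl | h5
  · left
    simp only [Nat.cast_one, Real.sqrt_one, one_mul]
    linarith
  · left
    have h1 : y / 2 ≤ Real.sqrt 2 * (y / 2) := le_mul_of_one_le_left (by linarith) (by linarith)
    have h2 := mul_le_mul_of_nonneg_left hbase (Real.sqrt_nonneg 2)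
    have : Real.sqrt 2 * y / A = Real.sqrt 2 * (y / A) := by ring
    push_cast
    linarith
  · have hs3 : Real.sqrt (3 : ℕ) ≤ 1.7321 := Real.sqrt_le_iff.2 (by norm_num)
    -- For small `A` the highest bid is well below `1` and the layered bound works; for large `A`
    -- the division by `A` saves the crude bound. The breakpoints are chosen to leave numerical
    -- room.
    rcases le_total A 1.4 with h1 | h1
    · right
      have h2 := le_one_sub_inv hy h1 (by
        have := exp_div_le (p := 7) (q := 5) (c := 4.1) (by norm_num) (by norm_num) (by norm_num)
        norm_num at this ⊢; exact this)
      have h3 : Real.sqrt (8 / 3 * (394 / 1000)) ≤ 1.0251 := Real.sqrt_le_iff.2 (by norm_num)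
      refine ⟨_, deviationBound_three, ?_⟩
      norm_num at h2 ⊢ h3
      linarith
    left
    rcases le_total A 1.6 with h2 | h2
    · exact hbound (by norm_num) h1 (le_one_sub_inv hy h2 (by
        have := exp_div_le (p := 8) (q := 5) (c := 5) (by norm_num) (by norm_num) (by norm_num)
        norm_num at this ⊢; exact this)) hs3 (by norm_num)
    rcases le_total A 1.9 with h3 | h3
    · exact hbound (by norm_num) h2 (le_one_sub_inv hy h3 (by
        have := exp_div_le (p := 19) (q := 10) (c := 6.7) (by norm_num) (by norm_num) (by norm_num)
        norm_num at this ⊢; exact this)) hs3 (by norm_num)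
    · exact hbound (by norm_num) h3 hy1 hs3 (by norm_num)
  · have hs4 : Real.sqrt (4 : ℕ) ≤ 2 := Real.sqrt_le_iff.2 (by norm_num)
    rcases le_total A 2.2 with h1 | h1
    · right
      have h2 := le_one_sub_inv hy h1 (by
        have := exp_div_le (p := 11) (q := 5) (c := 10) (by norm_num) (by norm_num) (by norm_num)
        norm_num at this ⊢; exact this)
      have h3 : Real.sqrt (8 / 3 * (347 / 1000)) ≤ 0.962 := Real.sqrt_le_iff.2 (by norm_num)
      refine ⟨_, deviationBound_four, ?_⟩
      norm_num at h2 ⊢ h3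
      linarith
    · left
      exact hbound (by norm_num) h1 hy1 hs4 (by norm_num)
  · right
    have h3 : Real.sqrt (8 / 3 * (31 / 100)) ≤ 0.91 := Real.sqrt_le_iff.2 (by norm_num)
    refine ⟨_, deviationBound_of_five_le h5, ?_⟩
    linarith

/-! ### The mean-square error -/

/-- `f` is bounded by `c` in `L²`. -/
def L2Bound {Ω : Type*} [MeasurableSpace Ω] (μ : Measure Ω) (f : Ω → ℝ) (c : ℝ) : Prop :=
  AEStronglyMeasurable f μ ∧ 0 ≤ c ∧ eLpNorm f 2 μ ≤ ENNReal.ofReal c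

namespace L2Bound

variable {Ω : Type*} [MeasurableSpace Ω] {μ : Measure Ω} {f g : Ω → ℝ} {c d : ℝ}

lemma of_sq (hf : AEStronglyMeasurable f μ) (hi : Integrable (fun ω => f ω ^ 2) μ) (hc : 0 ≤ c)
    (h : ∫ ω, f ω ^ 2 ∂μ ≤ c ^ 2) : L2Bound μ f c := by
  refine ⟨hf, hc, ?_⟩
  have h1 : ∫⁻ ω, ‖f ω‖ₑ ^ (2 : ℝ) ∂μ = ENNReal.ofReal (∫ ω, f ω ^ 2 ∂μ) := by
    rw [ofReal_integral_eq_lintegral_ofReal hi (ae_of_all _ fun ω => sq_nonneg _)]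
    refine lintegral_congr fun ω => ?_
    rw [← sq_abs, ENNReal.ofReal_pow (abs_nonneg _), ← Real.norm_eq_abs, ofReal_norm]
    norm_cast
  rw [eLpNorm_eq_lintegral_rpow_enorm_toReal (by norm_num) (by norm_num), ENNReal.toReal_ofNat, h1]
  calc ENNReal.ofReal (∫ ω, f ω ^ 2 ∂μ) ^ (1 / 2 : ℝ)
      ≤ ENNReal.ofReal (c ^ 2) ^ (1 / 2 : ℝ) :=
        ENNReal.rpow_le_rpow (ENNReal.ofReal_le_ofReal h) (by norm_num)
    _ = ENNReal.ofReal c := by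
        rw [ENNReal.ofReal_rpow_of_nonneg (by positivity) (by norm_num), ← Real.sqrt_eq_rpow,
          Real.sqrt_sq hc]

lemma add (hf : L2Bound μ f c) (hg : L2Bound μ g d) : L2Bound μ (fun ω => f ω + g ω) (c + d) :=
  ⟨hf.1.add hg.1, add_nonneg hf.2.1 hg.2.1, (eLpNorm_add_le hf.1 hg.1 (by norm_num)).trans (by
    rw [ENNReal.ofReal_add hf.2.1 hg.2.1]
    exact add_le_add hf.2.2 hg.2.2)⟩

lemma const_mul (hf : L2Bound μ f c) {a : ℝ} (ha : 0 ≤ a) :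
    L2Bound μ (fun ω => a * f ω) (a * c) := by
  refine ⟨hf.1.const_mul a, mul_nonneg ha hf.2.1, ?_⟩
  have := eLpNorm_const_smul_le (c := a) (f := f) (p := 2) (μ := μ)
  refine this.trans ?_
  rw [ENNReal.ofReal_mul ha, ← ofReal_norm, Real.norm_of_nonneg ha]
  exact mul_le_mul_right hf.2.2 _

lemma const [IsProbabilityMeasure μ] {a : ℝ} (ha : 0 ≤ a) : L2Bound μ (fun _ => a) a :=
  of_sq aestronglyMeasurable_const (integrable_const _) ha (by simp)

lemma sum {ι : Type*} (s : Finset ι) {f : ι → Ω → ℝ} {c : ι → ℝ} [IsProbabilityMeasure μ]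
    (h : ∀ i ∈ s, L2Bound μ (f i) (c i)) :
    L2Bound μ (fun ω => ∑ i ∈ s, f i ω) (∑ i ∈ s, c i) := by
  classical
  induction s using Finset.induction_on with
  | empty => simpa using const (μ := μ) le_rfl
  | insert i s hi ih =>
    simp only [Finset.sum_insert hi]
    exact (h i (Finset.mem_insert_self i s)).add
      (ih fun j hj => h j (Finset.mem_insert_of_mem hj))

lemma eLpNorm_le (hg : L2Bound μ g c) (h : ∀ ω, |f ω| ≤ g ω) :
    eLpNorm f 2 μ ≤ ENNReal.ofReal c :=
  (eLpNorm_mono_real h).trans hg.2.2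

end L2Bound

namespace BidSetup

variable {x x' Z Z' v b : ℝ → ℝ} {A W : ℝ}
variable {Ω : Type*} [MeasurableSpace Ω] {μ : Measure Ω} [IsProbabilityMeasure μ]

lemma l2Bound_deviation (S : BidSetup x x' Z Z' v b A W) {N : ℕ} (hN : 0 < N)
    {U : Fin N → Ω → ℝ} (hU : IsUniformSample μ U) :
    L2Bound μ (fun ω => Real.sqrt (b 1 * sqDeviation x x' v b fun j => U j ω))
      (b 1 / (2 * Real.sqrt N)) := by
  have hN' : (0 : ℝ) < N := by exact_mod_cast hN
  have hb := S.b_nonneg one_mem_Icc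
  obtain ⟨hi, hle⟩ := S.sqDeviation_integrable hN hU
  have hnn : ∀ ω, 0 ≤ b 1 * sqDeviation x x' v b fun j => U j ω := fun ω =>
    mul_nonneg hb (intervalIntegral.integral_nonneg zero_le_one fun r hr =>
      mul_nonneg (S.db_nonneg hr) (sq_nonneg _))
  refine L2Bound.of_sq ?_ ?_ (by positivity) ?_
  · exact Real.continuous_sqrt.comp_aestronglyMeasurable (hi.const_mul (b 1)).aestronglyMeasurable
  · simp only [Real.sq_sqrt (hnn _)]
    exact hi.const_mul _
  · simp only [Real.sq_sqrt (hnn _)]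
    rw [integral_const_mul, div_pow, mul_pow, Real.sq_sqrt hN'.le]
    calc b 1 * ∫ ω, sqDeviation x x' v b (fun j => U j ω) ∂μ ≤ b 1 * (b 1 / (4 * N)) :=
          mul_le_mul_of_nonneg_left hle hb
      _ = _ := by ring

/-- Minkowski's inequality for the average over `M²` level sets, each with the same bound, so `M`
survives only in the rounding error, which vanishes in the limit. -/
lemma eLpNorm_le_of_deviationBound (S : BidSetup x x' Z Z' v b A W) {N : ℕ} (hN : 0 < N)
    {U : Fin N → Ω → ℝ} (hU : IsUniformSample μ U) {c : ℝ} (hc : DeviationBound N c) :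
    eLpNorm (fun ω => ∫ r in (0 : ℝ)..1, (v r - b r) * x' r / x r
        * ∫ q in r..ecdf (fun j => U j ω) r, x q * Z' q) 2 μ
      ≤ ENNReal.ofReal (A * W * (Real.sqrt (8 / 3 * c / N) + b 1 / (2 * Real.sqrt N))) := by
  have hAW := (mul_pos S.A_pos S.W_pos).le
  have hK : 0 ≤ 1 + x 1 / x 0 := by
    have := div_pos (S.x_pos 1 one_mem_Icc) (S.x_pos 0 zero_mem_Icc)
    linarith
  have main : ∀ M : ℕ, 0 < M → eLpNorm (fun ω => ∫ r in (0 : ℝ)..1, (v r - b r) * x' r / x r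
        * ∫ q in r..ecdf (fun j => U j ω) r, x q * Z' q) 2 μ
      ≤ ENNReal.ofReal (A * W * (Real.sqrt (8 / 3 * c / N) + (1 + x 1 / x 0) / M)
        + A * W * (b 1 / (2 * Real.sqrt N))) := by
    intro M hM
    have hM' : (0 : ℝ) < M := by exact_mod_cast hM
    obtain ⟨t, ht, hpath⟩ := S.exists_pathwise_bound hM
    choose g hgm hg1 hg2 hgi hgs using fun i j =>
      hU.exists_level_bound hc hN (S.weightLevel_shape M (ht i) j)
    have hg : ∀ i j, L2Bound μ (g i j) (Real.sqrt (8 / 3 * c / N)) := fun i j =>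
      L2Bound.of_sq (hgm i j).aestronglyMeasurable (hgi i j) (Real.sqrt_nonneg _) (by
        rw [Real.sq_sqrt ((integral_nonneg fun ω => sq_nonneg _).trans (hgs i j))]
        exact hgs i j)
    have h1 := (((L2Bound.sum (Finset.range M) fun i _ => L2Bound.sum (Finset.range M)
      fun j _ => hg i j).const_mul (inv_nonneg.2 hM'.le)).const_mul (inv_nonneg.2 hM'.le)).add
      (L2Bound.const (μ := μ) (div_nonneg hK hM'.le))
    have h2 := (h1.const_mul hAW).add ((S.l2Bound_deviation hN hU).const_mul hAW)
    have e : (M : ℝ)⁻¹ * ((M : ℝ)⁻¹ * ∑ i ∈ Finset.range M, ∑ j ∈ Finset.range M,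
        Real.sqrt (8 / 3 * c / N)) = Real.sqrt (8 / 3 * c / N) := by
      simp only [Finset.sum_const, Finset.card_range, nsmul_eq_mul]
      field_simp
    rw [e] at h2
    refine h2.eLpNorm_le fun ω => (hpath fun j => U j ω).trans ?_
    refine add_le_add (mul_le_mul_of_nonneg_left (add_le_add_left ?_ _) hAW)
      (mul_le_mul_of_nonneg_left (S.integral_deviation_le _) hAW)
    rw [div_div, div_eq_inv_mul, mul_inv, mul_assoc]
    gcongr with i _ j _
    exact max_le (hg1 i j ω) (hg2 i j ω)
  have hlim : Tendsto (fun M : ℕ => ENNReal.ofReal (A * W * (Real.sqrt (8 / 3 * c / N)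
      + (1 + x 1 / x 0) / M) + A * W * (b 1 / (2 * Real.sqrt N)))) atTop
      (𝓝 (ENNReal.ofReal (A * W * (Real.sqrt (8 / 3 * c / N) + 0)
        + A * W * (b 1 / (2 * Real.sqrt N))))) := by
    refine (ENNReal.continuous_ofReal.tendsto _).comp ?_
    exact ((tendsto_const_nhds.add (tendsto_const_div_atTop_nhds_zero_nat _)).const_mul _).add_const _
  refine (ge_of_tendsto hlim ((eventually_gt_atTop 0).mono main)).trans_eq ?_
  congr 1
  ring

lemma eLpNorm_le_trivial (S : BidSetup x x' Z Z' v b A W) {N : ℕ} (hN : 0 < N)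
    {U : Fin N → Ω → ℝ} (hU : IsUniformSample μ U) :
    eLpNorm (fun ω => ∫ r in (0 : ℝ)..1, (v r - b r) * x' r / x r
        * ∫ q in r..ecdf (fun j => U j ω) r, x q * Z' q) 2 μ
      ≤ ENNReal.ofReal (W * b 1 + A * W * (b 1 / (2 * Real.sqrt N))) := by
  have hAW := (mul_pos S.A_pos S.W_pos).le
  have h := (L2Bound.const (μ := μ) (mul_nonneg S.W_pos.le (S.b_nonneg one_mem_Icc))).add
    ((S.l2Bound_deviation hN hU).const_mul hAW)
  exact h.eLpNorm_le fun ω => (S.abs_integral_db_mul_le _).trans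
    (add_le_add_right (mul_le_mul_of_nonneg_left (S.integral_deviation_le _) hAW) _)

lemma eLpNorm_le (S : BidSetup x x' Z Z' v b A W) {N : ℕ} (hN : 0 < N)
    {U : Fin N → Ω → ℝ} (hU : IsUniformSample μ U) :
    eLpNorm (fun ω => ∫ r in (0 : ℝ)..1, (v r - b r) * x' r / x r
        * ∫ q in r..ecdf (fun j => U j ω) r, x q * Z' q) 2 μ
      ≤ ENNReal.ofReal (Real.sqrt (2 / N)) * ENNReal.ofReal A * ENNReal.ofReal W := by
  have hN' : (0 : ℝ) < Real.sqrt N := Real.sqrt_pos.2 (by exact_mod_cast hN)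
  have hA := S.A_pos
  have hW := S.W_pos
  have hAW : 0 ≤ A * W / Real.sqrt N := by positivity
  rw [← ENNReal.ofReal_mul (Real.sqrt_nonneg _),
    ← ENNReal.ofReal_mul (mul_nonneg (Real.sqrt_nonneg _) hA.le), Real.sqrt_div (by norm_num)]
  have e : Real.sqrt 2 / Real.sqrt N * A * W = A * W / Real.sqrt N * Real.sqrt 2 := by ring
  rw [e]
  rcases exists_numeric_bound hN hA (S.b_nonneg one_mem_Icc) S.b_one_le with h | ⟨c, hc, h⟩
  · refine (S.eLpNorm_le_trivial hN hU).trans (ENNReal.ofReal_le_ofReal ?_)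
    refine le_trans (le_of_eq ?_) (mul_le_mul_of_nonneg_left h hAW)
    field_simp
  · refine (S.eLpNorm_le_of_deviationBound hN hU hc).trans (ENNReal.ofReal_le_ofReal ?_)
    refine le_trans (le_of_eq ?_) (mul_le_mul_of_nonneg_left h hAW)
    rw [Real.sqrt_div' _ (Nat.cast_nonneg N)]
    field_simp

end BidSetup

/-! ### Derivatives of the allocation rules -/

/-- The coefficient of the derivative of `knAlloc n k`. -/
noncomputable def allocCoeff (n k : ℕ) : ℝ := k * (n - 1).choose k

lemma allocCoeff_nonneg (n k : ℕ) : 0 ≤ allocCoeff n k :=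
  mul_nonneg (Nat.cast_nonneg _) (Nat.cast_nonneg _)

lemma allocCoeff_pos {n k : ℕ} (h1 : 1 ≤ k) (h2 : k < n) : 0 < allocCoeff n k :=
  mul_pos (by exact_mod_cast h1) (by exact_mod_cast Nat.choose_pos (by omega))

lemma allocCoeff_eq_zero {n k : ℕ} (h : ¬ (1 ≤ k ∧ k < n)) : allocCoeff n k = 0 := by
  rcases Nat.eq_zero_or_pos k with rfl | h1
  · simp [allocCoeff]
  · have : n ≤ k := by by_contra h2; exact h ⟨h1, by omega⟩
    rcases Nat.eq_zero_or_pos n with rfl | hn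
    · rw [allocCoeff, Nat.choose_eq_zero_of_lt (by omega)]; simp
    · rw [allocCoeff, Nat.choose_eq_zero_of_lt (by omega)]; simp

/-- The derivative of `knAlloc n k`. -/
noncomputable def dAlloc (n k : ℕ) (q : ℝ) : ℝ :=
  allocCoeff n k * q ^ (n - 1 - k) * (1 - q) ^ (k - 1)

/-- The derivative of `mixAlloc n w`. -/
noncomputable def dMix (n : ℕ) (w : ℕ → ℝ) (q : ℝ) : ℝ :=
  ∑ k ∈ Finset.range (n + 1), w k * dAlloc n k q

/-- The sum of derivatives telescopes through `(k+1) C(n-1,k+1) = (n-1-k) C(n-1,k)`, leaving a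
single monomial term. -/
lemma hasDerivAt_knAlloc (n k : ℕ) (q : ℝ) : HasDerivAt (knAlloc n k) (dAlloc n k q) q := by
  induction k with
  | zero =>
    have : knAlloc n 0 = fun _ => 0 := by funext q; simp [knAlloc]
    rw [this]
    simpa [dAlloc, allocCoeff] using hasDerivAt_const q (0 : ℝ)
  | succ k ih =>
    have h1 : knAlloc n (k + 1) = fun q => knAlloc n k q
        + ((n - 1).choose k : ℝ) * q ^ (n - 1 - k) * (1 - q) ^ k := by
      funext q; simp [knAlloc, Finset.sum_range_succ]
    rw [h1]
    have h2 : HasDerivAt (fun q : ℝ => ((n - 1).choose k : ℝ) * q ^ (n - 1 - k) * (1 - q) ^ k)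
        (((n - 1).choose k : ℝ) * (((n - 1 - k : ℕ) : ℝ) * q ^ (n - 1 - k - 1)) * (1 - q) ^ k
          + ((n - 1).choose k : ℝ) * q ^ (n - 1 - k) * ((k : ℝ) * (1 - q) ^ (k - 1) * -1)) q :=
      ((hasDerivAt_pow (n - 1 - k) q).const_mul _).fun_mul
        (((hasDerivAt_id q).const_sub 1).fun_pow k)
    refine (ih.fun_add h2).congr_deriv ?_
    have h3 : (((n - 1).choose (k + 1) : ℕ) : ℝ) * (k + 1)
        = ((n - 1).choose k : ℝ) * ((n - 1 - k : ℕ) : ℝ) := by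
      exact_mod_cast Nat.choose_succ_right_eq (n - 1) k
    have h4 : n - 1 - (k + 1) = n - 1 - k - 1 := by omega
    simp only [dAlloc, allocCoeff, h4, Nat.add_sub_cancel]
    push_cast
    rw [mul_comm ((k : ℝ) + 1), h3]
    ring

lemma deriv_knAlloc (n k : ℕ) : deriv (knAlloc n k) = dAlloc n k :=
  funext fun q => (hasDerivAt_knAlloc n k q).deriv

lemma hasDerivAt_mixAlloc (n : ℕ) (w : ℕ → ℝ) (q : ℝ) :
    HasDerivAt (mixAlloc n w) (dMix n w q) q :=
  HasDerivAt.fun_sum fun k _ => (hasDerivAt_knAlloc n k q).const_mul (w k)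

lemma deriv_mixAlloc (n : ℕ) (w : ℕ → ℝ) : deriv (mixAlloc n w) = dMix n w :=
  funext fun q => (hasDerivAt_mixAlloc n w q).deriv

lemma continuous_dAlloc (n k : ℕ) : Continuous (dAlloc n k) := by
  unfold dAlloc; fun_prop

lemma continuous_dMix (n : ℕ) (w : ℕ → ℝ) : Continuous (dMix n w) := by
  unfold dMix
  exact continuous_finsetSum _ fun k _ => continuous_const.mul (continuous_dAlloc n k)

lemma dAlloc_nonneg (n k : ℕ) {q : ℝ} (hq : q ∈ Icc (0 : ℝ) 1) : 0 ≤ dAlloc n k q :=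
  mul_nonneg (mul_nonneg (allocCoeff_nonneg n k) (pow_nonneg hq.1 _))
    (pow_nonneg (sub_nonneg.2 hq.2) _)

lemma dAlloc_pos {n k : ℕ} (h1 : 1 ≤ k) (h2 : k < n) {q : ℝ} (hq : q ∈ Ioo (0 : ℝ) 1) :
    0 < dAlloc n k q :=
  mul_pos (mul_pos (allocCoeff_pos h1 h2) (pow_pos hq.1 _)) (pow_pos (sub_pos.2 hq.2) _)

/-! ### Positivity and monotonicity of the mixture -/

section Weights

variable {n : ℕ} {w : ℕ → ℝ}

lemma dMix_nonneg (hw : ∀ j ≤ n, 0 ≤ w j) {q : ℝ} (hq : q ∈ Icc (0 : ℝ) 1) : 0 ≤ dMix n w q :=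
  Finset.sum_nonneg fun j hj => mul_nonneg (hw j (Finset.mem_range_succ_iff.1 hj))
    (dAlloc_nonneg n j hq)

lemma dMix_pos (hw : ∀ j ≤ n, 0 ≤ w j) (hw_pos : ∃ j, 1 ≤ j ∧ j < n ∧ 0 < w j) {q : ℝ}
    (hq : q ∈ Ioo (0 : ℝ) 1) : 0 < dMix n w q := by
  obtain ⟨j, h1, h2, h3⟩ := hw_pos
  refine Finset.sum_pos' (fun j hj => mul_nonneg (hw j (Finset.mem_range_succ_iff.1 hj))
    (dAlloc_nonneg n j (Ioo_subset_Icc_self hq))) ⟨j, Finset.mem_range.2 (by omega),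
      mul_pos h3 (dAlloc_pos h1 h2 hq)⟩

lemma knAlloc_nonneg (n k : ℕ) {q : ℝ} (hq : q ∈ Icc (0 : ℝ) 1) : 0 ≤ knAlloc n k q :=
  Finset.sum_nonneg fun _ _ => mul_nonneg (mul_nonneg (Nat.cast_nonneg _) (pow_nonneg hq.1 _))
    (pow_nonneg (sub_nonneg.2 hq.2) _)

lemma mixAlloc_nonneg (hw : ∀ j ≤ n, 0 ≤ w j) {q : ℝ} (hq : q ∈ Icc (0 : ℝ) 1) :
    0 ≤ mixAlloc n w q :=
  Finset.sum_nonneg fun j hj => mul_nonneg (hw j (Finset.mem_range_succ_iff.1 hj))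
    (knAlloc_nonneg n j hq)

lemma continuous_mixAlloc (n : ℕ) (w : ℕ → ℝ) : Continuous (mixAlloc n w) :=
  continuous_iff_continuousAt.2 fun q => (hasDerivAt_mixAlloc n w q).continuousAt

lemma strictMonoOn_mixAlloc (hw : ∀ j ≤ n, 0 ≤ w j) (hw_pos : ∃ j, 1 ≤ j ∧ j < n ∧ 0 < w j) :
    StrictMonoOn (mixAlloc n w) (Icc 0 1) := by
  refine strictMonoOn_of_deriv_pos (convex_Icc 0 1) (continuous_mixAlloc n w).continuousOn
    fun q hq => ?_
  rw [interior_Icc] at hq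
  rw [deriv_mixAlloc]
  exact dMix_pos hw hw_pos hq

lemma mixAlloc_pos (hw : ∀ j ≤ n, 0 ≤ w j) (hw_pos : ∃ j, 1 ≤ j ∧ j < n ∧ 0 < w j) {q : ℝ}
    (hq : q ∈ Ioc (0 : ℝ) 1) : 0 < mixAlloc n w q :=
  (mixAlloc_nonneg hw (left_mem_Icc.2 zero_le_one)).trans_lt
    (strictMonoOn_mixAlloc hw hw_pos (left_mem_Icc.2 zero_le_one) (Ioc_subset_Icc_self hq) hq.1)

lemma zFun_eq (n : ℕ) (w : ℕ → ℝ) (k : ℕ) (q : ℝ) :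
    zFun n w k q = (1 - q) * dAlloc n k q / dMix n w q := by
  rw [zFun, deriv_knAlloc, deriv_mixAlloc]

/-! ### The weight of the inference equation -/

/-- If every unit number in the mixture exceeds `k`, the weight does not vanish at `1`. -/
lemma exists_le_of_tendsto_zFun (hw : ∀ j ≤ n, 0 ≤ w j)
    (hw_pos : ∃ j, 1 ≤ j ∧ j < n ∧ 0 < w j) {k : ℕ} (hk1 : 1 ≤ k) (hkn : k < n)
    (hZ : Tendsto (zFun n w k) (𝓝[<] 1) (𝓝 0)) : ∃ j, 1 ≤ j ∧ j < n ∧ 0 < w j ∧ j ≤ k := by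
  by_contra! hcon
  set c := ∑ j ∈ Finset.range (n + 1), w j * allocCoeff n j with hc
  -- If all active indices exceed `k`, then `x'` is `O((1-q)^k)` at `1`, while `(1-q) x_k'` has
  -- exactly this order; the quotient stays away from zero.
  have hbound : ∀ q ∈ Ioo (0 : ℝ) 1, dMix n w q ≤ c * (1 - q) ^ k := by
    intro q hq
    rw [hc, Finset.sum_mul]
    refine Finset.sum_le_sum fun j hj => ?_
    have hj' := Finset.mem_range_succ_iff.1 hj
    by_cases h : (1 ≤ j ∧ j < n) ∧ 0 < w j
    · have hjk := hcon j h.1.1 h.1.2 h.2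
      rw [mul_assoc, dAlloc, mul_assoc]
      refine mul_le_mul_of_nonneg_left (mul_le_mul_of_nonneg_left ?_ (allocCoeff_nonneg n j))
        (hw j hj')
      calc q ^ (n - 1 - j) * (1 - q) ^ (j - 1) ≤ 1 * (1 - q) ^ k :=
            mul_le_mul (pow_le_one₀ hq.1.le hq.2.le)
              (pow_le_pow_of_le_one (sub_nonneg.2 hq.2.le) (by linarith [hq.1]) (by omega))
              (pow_nonneg (sub_nonneg.2 hq.2.le) _) zero_le_one
        _ = _ := one_mul _
    · have h0 : w j * allocCoeff n j = 0 := by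
        by_cases h' : 1 ≤ j ∧ j < n
        · rw [le_antisymm (not_lt.1 fun h'' => h ⟨h', h''⟩) (hw j hj'), zero_mul]
        · rw [allocCoeff_eq_zero h', mul_zero]
      rw [h0, zero_mul, dAlloc, mul_assoc, ← mul_assoc, h0, zero_mul]
  have hc0 : 0 < c := by
    have h1 : (1 / 2 : ℝ) ∈ Ioo (0 : ℝ) 1 := by norm_num
    have := (dMix_pos hw hw_pos h1).trans_le (hbound _ h1)
    exact pos_of_mul_pos_left this (by positivity)
  have hlow : ∀ q ∈ Ioo (0 : ℝ) 1, allocCoeff n k / c * q ^ (n - 1 - k) ≤ zFun n w k q := by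
    intro q hq
    rw [zFun_eq, le_div_iff₀ (dMix_pos hw hw_pos hq)]
    have h1 := mul_le_mul_of_nonneg_left (hbound q hq) (mul_nonneg
      (div_nonneg (allocCoeff_nonneg n k) hc0.le) (pow_nonneg hq.1.le (n - 1 - k)))
    refine h1.trans_eq ?_
    obtain ⟨m, rfl⟩ : ∃ m, k = m + 1 := ⟨k - 1, by omega⟩
    rw [dAlloc, Nat.add_sub_cancel]
    field_simp
    ring
  have hlim : Tendsto (fun q : ℝ => allocCoeff n k / c * q ^ (n - 1 - k)) (𝓝[<] 1)
      (𝓝 (allocCoeff n k / c * 1 ^ (n - 1 - k))) :=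
    ((continuous_const.mul (continuous_pow _)).tendsto 1).mono_left nhdsWithin_le_nhds
  have hev : ∀ᶠ q in 𝓝[<] (1 : ℝ), q ∈ Ioo (0 : ℝ) 1 := Ioo_mem_nhdsLT zero_lt_one
  have := le_of_tendsto_of_tendsto hlim hZ (hev.mono hlow)
  rw [one_pow, mul_one] at this
  exact absurd this (not_le.2 (div_pos (allocCoeff_pos hk1 hkn) hc0))

/-- If every unit number in the mixture is below `k`, the weight is unbounded near `0`. -/
lemma exists_ge_of_bounded (hw : ∀ j ≤ n, 0 ≤ w j)
    (hw_pos : ∃ j, 1 ≤ j ∧ j < n ∧ 0 < w j) {k : ℕ} (hk1 : 1 ≤ k) (hkn : k < n)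
    (h0 : 0 < mixAlloc n w 0) {W : ℝ}
    (hW : ∀ q ∈ Ioo (0 : ℝ) 1, mixAlloc n w q * zFun n w k q ≤ W) :
    ∃ j, 1 ≤ j ∧ j < n ∧ 0 < w j ∧ k ≤ j := by
  by_contra! hcon
  set c := ∑ j ∈ Finset.range (n + 1), w j * allocCoeff n j with hc
  -- If all active indices lie below `k`, then `x'` has an extra factor `q` at `0` compared with
  -- `x_k'`, so `Z` grows at least like `1/q` while `x` stays above `x(0) > 0`.
  have hbound : ∀ q ∈ Ioo (0 : ℝ) 1, dMix n w q ≤ c * q ^ (n - 1 - k) * q := by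
    intro q hq
    rw [mul_assoc, ← pow_succ, hc, Finset.sum_mul]
    refine Finset.sum_le_sum fun j hj => ?_
    have hj' := Finset.mem_range_succ_iff.1 hj
    by_cases h : (1 ≤ j ∧ j < n) ∧ 0 < w j
    · have hjk := hcon j h.1.1 h.1.2 h.2
      rw [mul_assoc, dAlloc, mul_assoc]
      refine mul_le_mul_of_nonneg_left (mul_le_mul_of_nonneg_left ?_ (allocCoeff_nonneg n j))
        (hw j hj')
      calc q ^ (n - 1 - j) * (1 - q) ^ (j - 1) ≤ q ^ (n - 1 - k + 1) * 1 :=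
            mul_le_mul (pow_le_pow_of_le_one hq.1.le hq.2.le (by omega))
              (pow_le_one₀ (sub_nonneg.2 hq.2.le) (by linarith [hq.1]))
              (pow_nonneg (sub_nonneg.2 hq.2.le) _) (pow_nonneg hq.1.le _)
        _ = _ := mul_one _
    · have h0 : w j * allocCoeff n j = 0 := by
        by_cases h' : 1 ≤ j ∧ j < n
        · rw [le_antisymm (not_lt.1 fun h'' => h ⟨h', h''⟩) (hw j hj'), zero_mul]
        · rw [allocCoeff_eq_zero h', mul_zero]
      rw [h0, zero_mul, dAlloc, mul_assoc, ← mul_assoc, h0, zero_mul]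
  have hmono := (strictMonoOn_mixAlloc hw hw_pos).monotoneOn
  have hlow : ∀ q ∈ Ioo (0 : ℝ) 1,
      mixAlloc n w 0 * (allocCoeff n k * (1 - q) ^ k) ≤ W * (c * q) := by
    intro q hq
    have hq' := Ioo_subset_Icc_self hq
    have hd := dMix_pos hw hw_pos hq
    have hqp := pow_pos hq.1 (n - 1 - k)
    have h1 := hW q hq
    have hW0 : 0 ≤ W := le_trans (mul_nonneg (mixAlloc_nonneg hw hq') (by
      rw [zFun_eq]
      exact div_nonneg (mul_nonneg (sub_nonneg.2 hq.2.le) (dAlloc_nonneg n k hq')) hd.le)) h1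
    rw [zFun_eq, mul_div_assoc', div_le_iff₀ hd] at h1
    have h2 := mul_le_mul_of_nonneg_left (hbound q hq) hW0
    have h3 : mixAlloc n w 0 * ((1 - q) * dAlloc n k q)
        ≤ mixAlloc n w q * ((1 - q) * dAlloc n k q) :=
      mul_le_mul_of_nonneg_right (hmono (left_mem_Icc.2 zero_le_one) hq' hq.1.le)
        (mul_nonneg (sub_nonneg.2 hq.2.le) (dAlloc_nonneg n k hq'))
    obtain ⟨m, rfl⟩ : ∃ m, k = m + 1 := ⟨k - 1, by omega⟩
    have h4 : (mixAlloc n w 0 * (allocCoeff n (m + 1) * (1 - q) ^ (m + 1))) * q ^ (n - 1 - (m + 1))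
        ≤ (W * (c * q)) * q ^ (n - 1 - (m + 1)) := by
      refine le_trans (le_of_eq ?_) ((h3.trans (h1.trans h2)).trans_eq (by ring))
      rw [dAlloc, Nat.add_sub_cancel]
      ring
    exact le_of_mul_le_mul_right h4 hqp
  have hlim1 : Tendsto (fun q : ℝ => mixAlloc n w 0 * (allocCoeff n k * (1 - q) ^ k)) (𝓝[>] 0)
      (𝓝 (mixAlloc n w 0 * (allocCoeff n k * (1 - 0) ^ k))) :=
    (Continuous.tendsto (by fun_prop) 0).mono_left nhdsWithin_le_nhds
  have hlim2 : Tendsto (fun q : ℝ => W * (c * q)) (𝓝[>] 0) (𝓝 (W * (c * 0))) :=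
    (Continuous.tendsto (by fun_prop) 0).mono_left nhdsWithin_le_nhds
  have hev : ∀ᶠ q in 𝓝[>] (0 : ℝ), q ∈ Ioo (0 : ℝ) 1 := Ioo_mem_nhdsGT zero_lt_one
  have := le_of_tendsto_of_tendsto hlim1 hlim2 (hev.mono hlow)
  rw [sub_zero, one_pow, mul_one, mul_zero, mul_zero] at this
  exact absurd this (not_le.2 (mul_pos h0 (allocCoeff_pos hk1 hkn)))

/-- `zFun` is quasi-concave on the open interval: its reciprocal is convex in `log ((1 - q) / q)`. -/
lemma min_le_zFun (hw : ∀ j ≤ n, 0 ≤ w j)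
    (hw_pos : ∃ j, 1 ≤ j ∧ j < n ∧ 0 < w j) {k : ℕ} (hk1 : 1 ≤ k) (hkn : k < n) {p s r : ℝ}
    (hp : 0 < p) (hps : p ≤ s) (hsr : s ≤ r) (hr : r < 1) :
    min (zFun n w k p) (zFun n w k r) ≤ zFun n w k s := by
  -- With `ρ = (1-q)/q = e^L`, the ratio `x_j'/x_k'` is a constant times `ρ^(j-k)`, and `1/(1-q) = 1
  -- + 1/ρ`. So `1/Z` is a nonnegative combination of exponentials in `L`.
  set h : ℝ → ℝ := fun L => ∑ j ∈ Finset.range (n + 1), w j * allocCoeff n j / allocCoeff n k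
    * (Real.exp (((j : ℝ) - k) * L) + Real.exp (((j : ℝ) - k - 1) * L)) with hh
  have hexp : ∀ a : ℝ, ConvexOn ℝ univ fun L : ℝ => Real.exp (a * L) := fun a => by
    have := convexOn_exp.comp_linearMap (LinearMap.mul ℝ ℝ a)
    rwa [preimage_univ] at this
  have hconv : ConvexOn ℝ univ h := by
    have : ∀ s : Finset ℕ, (∀ j ∈ s, j ≤ n) → ConvexOn ℝ univ fun L : ℝ =>
        ∑ j ∈ s, w j * allocCoeff n j / allocCoeff n k
          * (Real.exp (((j : ℝ) - k) * L) + Real.exp (((j : ℝ) - k - 1) * L)) := by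
      intro s
      induction s using Finset.induction_on with
      | empty => intro _; simpa using convexOn_const (0 : ℝ) convex_univ
      | insert i s hi ih =>
        intro hs
        simp only [Finset.sum_insert hi]
        refine ConvexOn.add ?_ (ih fun j hj => hs j (Finset.mem_insert_of_mem hj))
        exact ((hexp _).add (hexp _)).smul (div_nonneg (mul_nonneg
          (hw i (hs i (Finset.mem_insert_self i s))) (allocCoeff_nonneg n i))
          (allocCoeff_nonneg n k))
    exact this _ fun j hj => Finset.mem_range_succ_iff.1 hj
  have hck := allocCoeff_pos hk1 hkn
  have hinv : ∀ q ∈ Ioo (0 : ℝ) 1, (zFun n w k q)⁻¹ = h (Real.log ((1 - q) / q)) := by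
    intro q hq
    have hq1 : 0 < 1 - q := sub_pos.2 hq.2
    have hρ : 0 < (1 - q) / q := div_pos hq1 hq.1
    have hq0 := hq.1.ne'
    rw [zFun_eq, inv_div, dMix, Finset.sum_div, hh]
    refine Finset.sum_congr rfl fun j hj => ?_
    by_cases hjn : 1 ≤ j ∧ j < n
    · have e1 : ∀ i : ℕ, Real.exp (i * Real.log ((1 - q) / q)) = ((1 - q) / q) ^ i := fun i => by
        rw [Real.exp_nat_mul, Real.exp_log hρ]
      have e6 : Real.exp (((j : ℝ) - k) * Real.log ((1 - q) / q))
          = ((1 - q) / q) ^ j / ((1 - q) / q) ^ k := by rw [sub_mul, Real.exp_sub, e1, e1]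
      have e7 : Real.exp (((j : ℝ) - k - 1) * Real.log ((1 - q) / q))
          = ((1 - q) / q) ^ j / ((1 - q) / q) ^ k / ((1 - q) / q) := by
        rw [sub_mul _ (1 : ℝ), Real.exp_sub, e6, one_mul, Real.exp_log hρ]
      rw [e6, e7, dAlloc, dAlloc]
      obtain ⟨m, rfl⟩ : ∃ m, k = m + 1 := ⟨k - 1, by omega⟩
      obtain ⟨i, rfl⟩ : ∃ i, j = i + 1 := ⟨j - 1, by omega⟩
      obtain ⟨a, ha⟩ : ∃ a, n - 1 = m + 1 + a := ⟨n - 1 - (m + 1), by omega⟩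
      obtain ⟨d, hd⟩ : ∃ d, n - 1 = i + 1 + d := ⟨n - 1 - (i + 1), by omega⟩
      have e2 : n - 1 - (m + 1) = a := by omega
      have e3 : n - 1 - (i + 1) = d := by omega
      rw [e2, e3, Nat.add_sub_cancel, Nat.add_sub_cancel, div_pow, div_pow]
      have e4 : q ^ (m + 1) * q ^ a = q ^ (i + 1) * q ^ d := by
        rw [← pow_add, ← pow_add, ← ha, ← hd]
      have h1 := hq1.ne'
      have h2 := hck.ne'
      have e5 : q ^ d = q ^ (m + 1) * q ^ a / q ^ (i + 1) := by
        rw [e4]; field_simp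
      rw [e5]
      field_simp
      ring
    · rw [dAlloc, allocCoeff_eq_zero hjn]
      simp
  have hpos : ∀ q ∈ Ioo (0 : ℝ) 1, 0 < zFun n w k q := fun q hq => by
    rw [zFun_eq]
    exact div_pos (mul_pos (sub_pos.2 hq.2) (dAlloc_pos hk1 hkn hq)) (dMix_pos hw hw_pos hq)
  have hlog : ∀ q q' : ℝ, 0 < q → q ≤ q' → q' < 1 →
      Real.log ((1 - q') / q') ≤ Real.log ((1 - q) / q) := fun q q' h1 h2 h3 => by
    refine Real.log_le_log (div_pos (by linarith) (by linarith)) ?_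
    rw [div_le_div_iff₀ (by linarith) h1]
    nlinarith
  have hpI : p ∈ Ioo (0 : ℝ) 1 := ⟨hp, by linarith⟩
  have hsI : s ∈ Ioo (0 : ℝ) 1 := ⟨by linarith, by linarith⟩
  have hrI : r ∈ Ioo (0 : ℝ) 1 := ⟨by linarith, hr⟩
  have key := hconv.le_max_of_mem_Icc (mem_univ (Real.log ((1 - r) / r)))
    (mem_univ (Real.log ((1 - p) / p)))
    ⟨hlog s r hsI.1 hsr hr, hlog p s hp hps hsI.2⟩
  rw [← hinv r hrI, ← hinv p hpI, ← hinv s hsI, le_max_iff, inv_le_inv₀ (hpos s hsI) (hpos r hrI),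
    inv_le_inv₀ (hpos s hsI) (hpos p hpI)] at key
  rcases key with h | h
  · exact (min_le_right _ _).trans h
  · exact (min_le_left _ _).trans h

end Weights

/-- The weight extends to a continuously differentiable function on `[0, 1]` that vanishes at `1`. -/
lemma exists_zFun_extension {n : ℕ} {w : ℕ → ℝ} (hw : ∀ j ≤ n, 0 ≤ w j) {k : ℕ}
    (hlo : ∃ j, 1 ≤ j ∧ j < n ∧ 0 < w j ∧ j ≤ k) (hhi : ∃ j, 1 ≤ j ∧ j < n ∧ 0 < w j ∧ k ≤ j) :
    ∃ Z Z' : ℝ → ℝ, (∀ q ∈ Icc (0 : ℝ) 1, HasDerivAt Z (Z' q) q) ∧ ContinuousOn Z' (Icc 0 1) ∧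
      (∀ q ∈ Ioo (0 : ℝ) 1, Z q = zFun n w k q) ∧ Z 1 = 0 := by
  classical
  set J := (Finset.range n).filter fun j => 1 ≤ j ∧ 0 < w j with hJ
  have hmem : ∀ {j}, j ∈ J ↔ j < n ∧ 1 ≤ j ∧ 0 < w j := fun {j} => by simp [hJ]
  obtain ⟨a, ha1, ha2, ha3, hak⟩ := hlo
  obtain ⟨c, hc1, hc2, hc3, hck⟩ := hhi
  have hne : J.Nonempty := ⟨a, hmem.2 ⟨ha2, ha1, ha3⟩⟩
  obtain ⟨j₀, hj₀, hmin⟩ := J.exists_min_image id hne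
  obtain ⟨j₁, hj₁, hmax⟩ := J.exists_max_image id hne
  simp only [id] at hmin hmax
  have h0k : j₀ ≤ k := (hmin a (hmem.2 ⟨ha2, ha1, ha3⟩)).trans hak
  have hk1 : k ≤ j₁ := hck.trans (hmax c (hmem.2 ⟨hc2, hc1, hc3⟩))
  rw [hmem] at hj₀ hj₁
  -- Numerator and denominator of `Z` after cancelling their common factor `q^(n-1-j₁)
  -- (1-q)^(j₀-1)`. Then `P` still vanishes at `1`, while `D` is positive on `[0,1]`: its `j₁` term
  -- for `q < 1`, its `j₀` term at `1`.
  set P : Polynomial ℝ := Polynomial.C (allocCoeff n k) * Polynomial.X ^ (j₁ - k)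
    * (1 - Polynomial.X) ^ (k - j₀ + 1) with hP
  set D : Polynomial ℝ := ∑ j ∈ Finset.range (n + 1), Polynomial.C (w j * allocCoeff n j)
    * Polynomial.X ^ (j₁ - j) * (1 - Polynomial.X) ^ (j - j₀) with hD
  have hPe : ∀ q, P.eval q = allocCoeff n k * q ^ (j₁ - k) * (1 - q) ^ (k - j₀ + 1) := fun q => by
    simp [hP]
  have hDe : ∀ q, D.eval q = ∑ j ∈ Finset.range (n + 1),
      w j * allocCoeff n j * q ^ (j₁ - j) * (1 - q) ^ (j - j₀) := fun q => by
    simp [hD, Polynomial.eval_finsetSum]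
  have hDpos : ∀ q ∈ Icc (0 : ℝ) 1, 0 < D.eval q := by
    intro q hq
    rw [hDe]
    have hnn : ∀ j ∈ Finset.range (n + 1),
        0 ≤ w j * allocCoeff n j * q ^ (j₁ - j) * (1 - q) ^ (j - j₀) := fun j hj =>
      mul_nonneg (mul_nonneg (mul_nonneg (hw j (Finset.mem_range_succ_iff.1 hj))
        (allocCoeff_nonneg n j)) (pow_nonneg hq.1 _)) (pow_nonneg (sub_nonneg.2 hq.2) _)
    rcases lt_or_ge q 1 with h | h
    · refine Finset.sum_pos' hnn ⟨j₁, Finset.mem_range.2 (by omega), ?_⟩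
      rw [Nat.sub_self, pow_zero, mul_one]
      exact mul_pos (mul_pos hj₁.2.2 (allocCoeff_pos hj₁.2.1 hj₁.1)) (pow_pos (sub_pos.2 h) _)
    · refine Finset.sum_pos' hnn ⟨j₀, Finset.mem_range.2 (by omega), ?_⟩
      rw [Nat.sub_self, pow_zero, mul_one]
      exact mul_pos (mul_pos hj₀.2.2 (allocCoeff_pos hj₀.2.1 hj₀.1))
        (pow_pos (zero_lt_one.trans_le h) _)
  have hdMix : ∀ q, dMix n w q = q ^ (n - 1 - j₁) * (1 - q) ^ (j₀ - 1) * D.eval q := by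
    intro q
    rw [hDe, dMix, Finset.mul_sum]
    refine Finset.sum_congr rfl fun j hj => ?_
    by_cases h : (1 ≤ j ∧ j < n) ∧ 0 < w j
    · have hj' : j ∈ J := hmem.2 ⟨h.1.2, h.1.1, h.2⟩
      have h1 := hmin j hj'
      have h2 := hmax j hj'
      rw [dAlloc, show n - 1 - j = (n - 1 - j₁) + (j₁ - j) by omega,
        show j - 1 = (j₀ - 1) + (j - j₀) by omega, pow_add, pow_add]
      ring
    -- Outside the active indices the exponents of `D` may be truncated subtractions, but the
    -- coefficient is zero.
    · have h0 : w j * allocCoeff n j = 0 := by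
        by_cases h' : 1 ≤ j ∧ j < n
        · rw [le_antisymm (not_lt.1 fun h'' => h ⟨h', h''⟩)
            (hw j (Finset.mem_range_succ_iff.1 hj)), zero_mul]
        · rw [allocCoeff_eq_zero h', mul_zero]
      rw [h0, dAlloc, mul_assoc, ← mul_assoc, h0]
      ring
  have hdk : ∀ q : ℝ, (1 - q) * dAlloc n k q
      = q ^ (n - 1 - j₁) * (1 - q) ^ (j₀ - 1) * P.eval q := by
    intro q
    have h1 : (1 - q) ^ (k - j₀ + 1) * (1 - q) ^ (j₀ - 1) = (1 - q) * (1 - q) ^ (k - 1) := by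
      rw [← pow_add, ← pow_succ']; congr 1; omega
    rw [hPe, dAlloc, show n - 1 - k = (n - 1 - j₁) + (j₁ - k) by omega, pow_add]
    linear_combination (-(allocCoeff n k * q ^ (n - 1 - j₁) * q ^ (j₁ - k))) * h1
  refine ⟨fun q => P.eval q / D.eval q, fun q => (P.derivative.eval q * D.eval q
    - P.eval q * D.derivative.eval q) / D.eval q ^ 2, fun q hq => ?_, ?_, fun q hq => ?_, ?_⟩
  · exact (P.hasDerivAt q).fun_div (D.hasDerivAt q) (hDpos q hq).ne'
  · refine ContinuousOn.div ?_ ?_ fun q hq => pow_ne_zero 2 (hDpos q hq).ne'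
    · exact ((P.derivative.continuous.mul D.continuous).sub
        (P.continuous.mul D.derivative.continuous)).continuousOn
    · exact (D.continuous.pow 2).continuousOn
  · have h1 : q ^ (n - 1 - j₁) * (1 - q) ^ (j₀ - 1) ≠ 0 :=
      mul_ne_zero (pow_ne_zero _ hq.1.ne') (pow_ne_zero _ (sub_pos.2 hq.2).ne')
    simp only
    rw [zFun_eq, hdk, hdMix, mul_div_mul_left _ _ h1]
  · simp [hPe]

/-! ### Equilibrium payments -/

/-- Payments that satisfy the incentive constraints are given by the payment identity. -/
lemma payment_identity {x x' v pay : ℝ → ℝ} (hx : ∀ q, HasDerivAt x (x' q) q)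
    (hx' : Continuous x') (hx'_nonneg : ∀ q ∈ Icc (0 : ℝ) 1, 0 ≤ x' q)
    (hv : MonotoneOn v (Icc 0 1)) (hvc : ContinuousOn v (Icc 0 1)) (hpc : ContinuousOn pay (Icc 0 1))
    (hp0 : pay 0 = 0)
    (h : ∀ p ∈ Icc (0 : ℝ) 1, ∀ q ∈ Icc (0 : ℝ) 1, pay q - pay p ≤ v q * (x q - x p))
    {q : ℝ} (hq : q ∈ Icc (0 : ℝ) 1) : pay q = ∫ s in (0 : ℝ)..q, v s * x' s := by
  have hsub : ∀ {r p : ℝ}, r ∈ Icc (0 : ℝ) 1 → p ∈ Icc (0 : ℝ) 1 → uIcc r p ⊆ Icc (0 : ℝ) 1 :=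
    fun hr hp => (convex_Icc (0 : ℝ) 1).ordConnected.uIcc_subset hr hp
  have h01 : (0 : ℝ) ∈ Icc (0 : ℝ) 1 := left_mem_Icc.2 zero_le_one
  have hI : ∀ {r p : ℝ}, r ∈ Icc (0 : ℝ) 1 → p ∈ Icc (0 : ℝ) 1 →
      IntervalIntegrable (fun s => v s * x' s) volume r p := fun hr hp =>
    ((hvc.mono (hsub hr hp)).mul hx'.continuousOn).intervalIntegrable
  set F : ℝ → ℝ := fun q => pay q - ∫ s in (0 : ℝ)..q, v s * x' s with hF
  -- The incentive constraint in both directions and the monotonicity of `v` confine the payment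
  -- increment and the integral to the same interval, of length `(v q - v p)(x q - x p)`.
  have hFle : ∀ p ∈ Icc (0 : ℝ) 1, ∀ q ∈ Icc (0 : ℝ) 1, p ≤ q →
      |F q - F p| ≤ (v q - v p) * (x q - x p) := by
    intro p hp q hq hpq
    have e1 : F q - F p = (pay q - pay p) - ∫ s in p..q, v s * x' s := by
      have := intervalIntegral.integral_interval_sub_left (hI h01 hq) (hI h01 hp)
      simp only [hF]
      linarith
    have e2 : ∀ c : ℝ, ∫ s in p..q, c * x' s = c * (x q - x p) := fun c => by
      rw [intervalIntegral.integral_const_mul, intervalIntegral.integral_eq_sub_of_hasDerivAt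
        (fun s _ => hx s) (hx'.intervalIntegrable _ _)]
    have hs : ∀ s ∈ Icc p q, s ∈ Icc (0 : ℝ) 1 := fun s hs => ⟨hp.1.trans hs.1, hs.2.trans hq.2⟩
    have h1 := intervalIntegral.integral_mono_on hpq
      ((hx'.intervalIntegrable (μ := volume) p q).const_mul (v p)) (hI hp hq) fun s hs' =>
        mul_le_mul_of_nonneg_right (hv hp (hs s hs') hs'.1) (hx'_nonneg s (hs s hs'))
    have h2 := intervalIntegral.integral_mono_on hpq (hI hp hq)
      ((hx'.intervalIntegrable (μ := volume) p q).const_mul (v q)) fun s hs' =>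
        mul_le_mul_of_nonneg_right (hv (hs s hs') hq hs'.2) (hx'_nonneg s (hs s hs'))
    rw [e2] at h1 h2
    have h3 := h p hp q hq
    have h4 := h q hq p hp
    rw [e1, abs_le]
    constructor <;> nlinarith
  have hFc : ContinuousOn F (Icc 0 1) := by
    refine hpc.sub ?_
    have := intervalIntegral.continuousOn_primitive_interval (μ := volume)
      (f := fun s => v s * x' s) (a := 0) (b := 1)
      (by rw [uIcc_of_le zero_le_one]
          exact (hvc.mul hx'.continuousOn).integrableOn_Icc)
    rwa [uIcc_of_le zero_le_one] at this
  -- The bound is `o(1) · O(q - p)`, since `v` is continuous and `x` differentiable; `F` therefore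
  -- has zero right derivative without differentiability of `v` or `pay` being known.
  have hFd : ∀ p ∈ Ico (0 : ℝ) 1, HasDerivWithinAt F 0 (Ici p) p := by
    intro p hp
    have hp' := Ico_subset_Icc_self hp
    have hmem : ∀ᶠ q in 𝓝[Ici p] p, q ∈ Icc p 1 := Icc_mem_nhdsGE hp.2
    rw [hasDerivWithinAt_iff_isLittleO]
    have h1 : (fun q => v q - v p) =o[𝓝[Ici p] p] fun _ => (1 : ℝ) := by
      rw [Asymptotics.isLittleO_one_iff]
      have h2 : Tendsto v (𝓝[Ici p] p) (𝓝 (v p)) := by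
        rw [← nhdsWithin_Icc_eq_nhdsGE hp.2]
        exact (hvc p hp').mono_left (nhdsWithin_mono p (Icc_subset_Icc_left hp.1))
      simpa using h2.sub_const (v p)
    have h2 : (fun q => x q - x p) =O[𝓝[Ici p] p] fun q => q - p :=
      ((hx p).isBigO_sub).mono nhdsWithin_le_nhds
    have h3 := h1.mul_isBigO h2
    simp only [one_mul] at h3
    refine (Asymptotics.IsBigO.of_bound 1 ?_).trans_isLittleO h3
    filter_upwards [hmem] with q hq
    have := hFle p hp' q ⟨hp.1.trans hq.1, hq.2⟩ hq.1
    rw [smul_zero, sub_zero, one_mul, Real.norm_eq_abs, Real.norm_eq_abs]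
    exact this.trans (le_abs_self _)
  have := constant_of_has_deriv_right_zero hFc hFd q hq
  simp only [hF, hp0, intervalIntegral.integral_same] at this
  linarith

section Equilibrium

variable {b : ℝ → ℝ}

lemma bidDist_Iic (hb_cont : ContinuousOn b (Icc (0 : ℝ) 1)) (z : ℝ) :
    (bidDist b).real (Iic z) = volume.real ({q | b q ≤ z} ∩ Icc (0 : ℝ) 1) := by
  rw [bidDist, measureReal_def, Measure.map_apply_of_aemeasurable
    (hb_cont.aemeasurable measurableSet_Icc) measurableSet_Iic,
    Measure.restrict_apply' measurableSet_Icc]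
  rfl

/-- The bid distribution function inverts the bid function. -/
lemma bidCDF_apply (hb_mono : StrictMonoOn b (Icc (0 : ℝ) 1))
    (hb_cont : ContinuousOn b (Icc (0 : ℝ) 1)) {p : ℝ} (hp : p ∈ Icc (0 : ℝ) 1) :
    bidCDF b (b p) = p := by
  rw [bidCDF, bidDist_Iic hb_cont]
  have : {q | b q ≤ b p} ∩ Icc (0 : ℝ) 1 = Icc 0 p := by
    ext q
    constructor
    · rintro ⟨h1, h2⟩
      exact ⟨h2.1, (hb_mono.le_iff_le h2 hp).1 h1⟩
    · intro h
      have hq : q ∈ Icc (0 : ℝ) 1 := ⟨h.1, h.2.trans hp.2⟩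
      exact ⟨(hb_mono.le_iff_le hq hp).2 h.2, hq⟩
  rw [this, Real.volume_real_Icc_of_le hp.1, sub_zero]

lemma bidCDF_zero (hb_mono : StrictMonoOn b (Icc (0 : ℝ) 1))
    (hb_cont : ContinuousOn b (Icc (0 : ℝ) 1)) (hb : ∀ q ∈ Icc (0 : ℝ) 1, 0 ≤ b q) :
    bidCDF b 0 = 0 := by
  have h0 : (0 : ℝ) ∈ Icc (0 : ℝ) 1 := left_mem_Icc.2 zero_le_one
  rw [bidCDF, bidDist_Iic hb_cont]
  have : {q | b q ≤ 0} ∩ Icc (0 : ℝ) 1 ⊆ {0} := by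
    rintro q ⟨h1, h2⟩
    by_contra hne
    have := hb_mono h0 h2 (lt_of_le_of_ne h2.1 (Ne.symm hne))
    exact absurd h1 (not_le.2 ((hb 0 h0).trans_lt this))
  exact le_antisymm ((measureReal_mono this (by simp)).trans_eq (by simp [measureReal_def]))
    measureReal_nonneg

instance isProbabilityMeasure_unitInterval :
    IsProbabilityMeasure (volume.restrict (Icc (0 : ℝ) 1)) := ⟨by simp⟩

lemma isProbabilityMeasure_bidDist (hb_cont : ContinuousOn b (Icc (0 : ℝ) 1)) :
    IsProbabilityMeasure (bidDist b) :=
  Measure.isProbabilityMeasure_map (hb_cont.aemeasurable measurableSet_Icc)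

lemma bidCDF_mem (hb_cont : ContinuousOn b (Icc (0 : ℝ) 1)) (z : ℝ) :
    bidCDF b z ∈ Icc (0 : ℝ) 1 :=
  haveI := isProbabilityMeasure_bidDist hb_cont
  ⟨measureReal_nonneg, measureReal_le_one⟩

lemma measurable_bidCDF (hb_cont : ContinuousOn b (Icc (0 : ℝ) 1)) : Measurable (bidCDF b) :=
  haveI := isProbabilityMeasure_bidDist hb_cont
  Monotone.measurable fun _ _ h => measureReal_mono (Iic_subset_Iic.2 h)

/-- The probability integral transform; it holds because the distribution function inverts `b`
almost everywhere. -/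
lemma map_bidCDF (hb_mono : StrictMonoOn b (Icc (0 : ℝ) 1))
    (hb_cont : ContinuousOn b (Icc (0 : ℝ) 1)) :
    (bidDist b).map (bidCDF b) = volume.restrict (Icc (0 : ℝ) 1) := by
  rw [bidDist, AEMeasurable.map_map_of_aemeasurable
    (measurable_bidCDF hb_cont).aemeasurable (hb_cont.aemeasurable measurableSet_Icc)]
  have : bidCDF b ∘ b =ᵐ[volume.restrict (Icc (0 : ℝ) 1)] id :=
    (ae_restrict_iff' measurableSet_Icc).2 (ae_of_all _ fun q hq => bidCDF_apply hb_mono hb_cont hq)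
  rw [Measure.map_congr this, Measure.map_id]

lemma ae_mem_image_bidDist (hb_cont : ContinuousOn b (Icc (0 : ℝ) 1)) :
    ∀ᵐ z ∂(bidDist b), z ∈ b '' Icc (0 : ℝ) 1 := by
  have hcl : MeasurableSet (b '' Icc (0 : ℝ) 1) :=
    (isCompact_Icc.image_of_continuousOn hb_cont).isClosed.measurableSet
  refine (ae_map_iff (p := (· ∈ b '' Icc 0 1)) (hb_cont.aemeasurable measurableSet_Icc) hcl).2 ?_
  exact (ae_restrict_iff' measurableSet_Icc).2 (ae_of_all _ fun q hq => mem_image_of_mem b hq)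

/-- The quantiles of an independent sample of bids form a uniform sample. -/
lemma isUniformSample_bidCDF (hb_mono : StrictMonoOn b (Icc (0 : ℝ) 1))
    (hb_cont : ContinuousOn b (Icc (0 : ℝ) 1)) {Ω : Type*} [MeasurableSpace Ω] {μ : Measure Ω}
    {N : ℕ} {B : Fin N → Ω → ℝ} (hB_meas : ∀ i, Measurable (B i)) (hB_indep : iIndepFun B μ)
    (hB_law : ∀ i, μ.map (B i) = bidDist b) :
    IsUniformSample μ fun i ω => bidCDF b (B i ω) where
  meas i := (measurable_bidCDF hb_cont).comp (hB_meas i)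
  indep := hB_indep.comp (fun _ => bidCDF b) fun _ => measurable_bidCDF hb_cont
  law i := by
    rw [← map_bidCDF hb_mono hb_cont, ← hB_law i,
      Measure.map_map (measurable_bidCDF hb_cont) (hB_meas i)]
    rfl
  mem i ω := bidCDF_mem hb_cont _

lemma ae_bid_eq (hb_mono : StrictMonoOn b (Icc (0 : ℝ) 1))
    (hb_cont : ContinuousOn b (Icc (0 : ℝ) 1)) {Ω : Type*} [MeasurableSpace Ω] {μ : Measure Ω}
    {N : ℕ} {B : Fin N → Ω → ℝ} (hB_meas : ∀ i, Measurable (B i))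
    (hB_law : ∀ i, μ.map (B i) = bidDist b) :
    ∀ᵐ ω ∂μ, (fun i => B i ω) = fun i => b (bidCDF b (B i ω)) := by
  have : ∀ i, ∀ᵐ ω ∂μ, B i ω = b (bidCDF b (B i ω)) := fun i => by
    have h1 := ae_mem_image_bidDist hb_cont
    rw [← hB_law i] at h1
    filter_upwards [ae_of_ae_map (hB_meas i).aemeasurable h1] with ω hω
    obtain ⟨p, hp, hpe⟩ := hω
    rw [← hpe, bidCDF_apply hb_mono hb_cont hp]
  filter_upwards [ae_all_iff.2 this] with ω hω
  exact funext hω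

end Equilibrium

/-! ### From the equilibrium to the analytic setup and the error formula -/

namespace BidSetup

/-- The revenue equals the average of the bids with the weights of the plug-in estimate. -/
lemma integral_Z_mul {x x' Z Z' v b : ℝ → ℝ} {A W : ℝ} (S : BidSetup x x' Z Z' v b A W) :
    ∫ q in (0 : ℝ)..1, Z q * (v q * x' q) = -∫ q in (0 : ℝ)..1, x q * Z' q * b q := by
  have h : ∫ q in (0 : ℝ)..1, Z q * (v q * x' q)
      = Z 1 * (x 1 * b 1) - Z 0 * (x 0 * b 0) - ∫ q in (0 : ℝ)..1, Z' q * (x q * b q) := by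
    refine intervalIntegral.integral_mul_deriv_eq_deriv_mul_of_hasDerivAt (u := Z) (u' := Z')
      (v := fun q => x q * b q) ?_ ?_ ?_ ?_ ?_ (S.vx'_integrable zero_mem_Icc one_mem_Icc)
    · rw [uIcc_of_le zero_le_one]; exact S.cont_Z
    · rw [uIcc_of_le zero_le_one]; exact S.cont_x.continuousOn.mul S.cont_b
    · rw [min_eq_left zero_le_one, max_eq_right zero_le_one]
      exact fun q hq => S.deriv_Z q (Ioo_subset_Icc_self hq)
    · rw [min_eq_left zero_le_one, max_eq_right zero_le_one]
      intro q hq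
      refine ((S.deriv_x q).fun_mul (S.hasDerivAt_b hq)).congr_deriv ?_
      have := (S.x_pos q (Ioo_subset_Icc_self hq)).ne'
      field_simp
      ring
    · refine ContinuousOn.intervalIntegrable ?_
      rw [uIcc_of_le zero_le_one]; exact S.cont_Z'
  rw [h, S.Z_one, S.b_zero, zero_mul, mul_zero, mul_zero, sub_zero, zero_sub]
  congr 1
  exact intervalIntegral.integral_congr fun q _ => by ring

end BidSetup

lemma integral_congr_Ioo {f g : ℝ → ℝ} (h : ∀ q ∈ Ioo (0 : ℝ) 1, f q = g q) :
    ∫ q in (0 : ℝ)..1, f q = ∫ q in (0 : ℝ)..1, g q := by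
  rw [intervalIntegral.integral_of_le zero_le_one, intervalIntegral.integral_of_le zero_le_one,
    integral_Ioc_eq_integral_Ioo, integral_Ioc_eq_integral_Ioo]
  exact setIntegral_congr_fun measurableSet_Ioo h

lemma le_of_le_on_Ioo {f g : ℝ → ℝ} (hf : ContinuousOn f (Icc 0 1)) (hg : ContinuousOn g (Icc 0 1))
    (h : ∀ q ∈ Ioo (0 : ℝ) 1, f q ≤ g q) {q : ℝ} (hq : q ∈ Icc (0 : ℝ) 1) : f q ≤ g q := by
  have hc : closure (Ioo (0 : ℝ) 1) = Icc 0 1 := closure_Ioo zero_ne_one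
  have hq' : q ∈ closure (Ioo (0 : ℝ) 1) := hc ▸ hq
  exact ContinuousWithinAt.closure_le hq' ((hf q hq).mono Ioo_subset_Icc_self)
    ((hg q hq).mono Ioo_subset_Icc_self) h

/-- The allocation rule is positive at the lowest quantile if its logarithmic derivative is bounded. -/
lemma mixAlloc_zero_pos {n : ℕ} {w : ℕ → ℝ} (hw : ∀ j ≤ n, 0 ≤ w j)
    (hw_pos : ∃ j, 1 ≤ j ∧ j < n ∧ 0 < w j) {A : ℝ}
    (hA : ∀ q ∈ Ioo (0 : ℝ) 1, dMix n w q ≤ A * mixAlloc n w q) : 0 < mixAlloc n w 0 := by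
  have hd : ∀ q, HasDerivAt (fun q => mixAlloc n w q * Real.exp (-(A * q)))
      (dMix n w q * Real.exp (-(A * q)) + mixAlloc n w q * (Real.exp (-(A * q)) * -(A * 1))) q :=
    fun q => (hasDerivAt_mixAlloc n w q).fun_mul (((hasDerivAt_id q).const_mul A).fun_neg.exp)
  -- Grönwall: `x(0) ≥ x(1) e^{-A} > 0`.
  have hanti : AntitoneOn (fun q => mixAlloc n w q * Real.exp (-(A * q))) (Icc 0 1) := by
    refine antitoneOn_of_deriv_nonpos (convex_Icc 0 1)
      (fun q _ => (hd q).continuousAt.continuousWithinAt)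
      (fun q _ => (hd q).differentiableAt.differentiableWithinAt) fun q hq => ?_
    rw [interior_Icc] at hq
    rw [(hd q).deriv]
    have := hA q hq
    nlinarith [Real.exp_pos (-(A * q))]
  have := hanti (left_mem_Icc.2 zero_le_one) (right_mem_Icc.2 zero_le_one) zero_le_one
  simp only [mul_one, mul_zero, neg_zero, Real.exp_zero] at this
  exact (mul_pos (mixAlloc_pos hw hw_pos (right_mem_Ioc.2 zero_lt_one)) (Real.exp_pos _)).trans_le
    this

/-- An equilibrium with finite bounds gives rise to a `BidSetup`. -/
lemma bidSetup_of_equilibrium {n : ℕ} {w : ℕ → ℝ} (hw : ∀ j ≤ n, 0 ≤ w j)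
    (hw_pos : ∃ j, 1 ≤ j ∧ j < n ∧ 0 < w j) {v b : ℝ → ℝ}
    (hv_mono : StrictMonoOn v (Icc (0 : ℝ) 1)) (hv_cont : ContinuousOn v (Icc (0 : ℝ) 1))
    (hv_mem : ∀ q ∈ Icc (0 : ℝ) 1, v q ∈ Icc (0 : ℝ) 1)
    (hb_mono : StrictMonoOn b (Icc (0 : ℝ) 1)) (hb_cont : ContinuousOn b (Icc (0 : ℝ) 1))
    (hb : IsFirstPriceBNE n w v b) {k : ℕ} (hk1 : 1 ≤ k) (hkn : k < n)
    (hZ : Tendsto (zFun n w k) (𝓝[<] 1) (𝓝 0)) {A W : ℝ} (hA0 : 0 < A) (hW0 : 0 < W)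
    (hA : ∀ q ∈ Ioo (0 : ℝ) 1, dMix n w q ≤ A * mixAlloc n w q)
    (hW : ∀ q ∈ Ioo (0 : ℝ) 1, mixAlloc n w q * zFun n w k q ≤ W) :
    ∃ Z Z' : ℝ → ℝ, BidSetup (mixAlloc n w) (dMix n w) Z Z' v b A W ∧
      ∀ q ∈ Ioo (0 : ℝ) 1, Z q = zFun n w k q := by
  have h0 : (0 : ℝ) ∈ Icc (0 : ℝ) 1 := left_mem_Icc.2 zero_le_one
  have hx0 := mixAlloc_zero_pos hw hw_pos hA
  have hxpos : ∀ q ∈ Icc (0 : ℝ) 1, 0 < mixAlloc n w q := fun q hq =>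
    hx0.trans_le ((strictMonoOn_mixAlloc hw hw_pos).monotoneOn h0 hq hq.1)
  obtain ⟨Z, Z', hZd, hZ'c, hZe, hZ1⟩ := exists_zFun_extension hw
    (exists_le_of_tendsto_zFun hw hw_pos hk1 hkn hZ)
    (exists_ge_of_bounded hw hw_pos hk1 hkn hx0 hW)
  have hZc : ContinuousOn Z (Icc 0 1) := fun q hq => (hZd q hq).continuousAt.continuousWithinAt
  have hxc := (continuous_mixAlloc n w).continuousOn (s := Icc (0 : ℝ) 1)
  have hZ0 : ∀ q ∈ Icc (0 : ℝ) 1, 0 ≤ Z q := fun q hq =>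
    le_of_le_on_Ioo continuousOn_const hZc (fun q hq => by
      rw [hZe q hq, zFun_eq]
      exact div_nonneg (mul_nonneg (sub_nonneg.2 hq.2.le)
        (dAlloc_nonneg n k (Ioo_subset_Icc_self hq))) (dMix_pos hw hw_pos hq).le) hq
  have hIC : ∀ p ∈ Icc (0 : ℝ) 1, ∀ q ∈ Icc (0 : ℝ) 1,
      (v q - b p) * mixAlloc n w p ≤ (v q - b q) * mixAlloc n w q := by
    intro p hp q hq
    have := hb.best_response q hq (b p) (hb.nonneg p hp)
    rwa [firstPriceUtility, firstPriceUtility, bidCDF_apply hb_mono hb_cont hp,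
      bidCDF_apply hb_mono hb_cont hq] at this
  -- The lowest type wins with the same positive probability `x(0)` when bidding zero, so any
  -- positive bid would be a waste.
  have hb0 : b 0 = 0 := by
    have := hb.best_response 0 h0 0 le_rfl
    rw [firstPriceUtility, firstPriceUtility, bidCDF_apply hb_mono hb_cont h0,
      bidCDF_zero hb_mono hb_cont hb.nonneg] at this
    have := le_of_mul_le_mul_right this hx0
    exact le_antisymm (by linarith) (hb.nonneg 0 h0)
  refine ⟨Z, Z', ?_, hZe⟩
  exact
    { deriv_x := hasDerivAt_mixAlloc n w
      cont_x' := continuous_dMix n w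
      deriv_Z := hZd
      cont_Z' := hZ'c
      x_pos := hxpos
      x'_nonneg := fun q hq => dMix_nonneg hw hq
      x'_le := fun q hq => le_of_le_on_Ioo (continuous_dMix n w).continuousOn
        (continuousOn_const.mul hxc) hA hq
      Z_nonneg := hZ0
      xZ_le := fun q hq => le_of_le_on_Ioo
        (f := fun q => mixAlloc n w q * Z q) (hxc.mul hZc) continuousOn_const
        (fun q hq => by rw [hZe q hq]; exact hW q hq) hq
      -- Quasi-concavity is known on the open interval. The endpoint `r = 1` is trivial because `Z 1
      -- = 0`, and a left endpoint `p = 0` is reached by continuity.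
      Z_quasi := by
        intro p hp s hps r hr hsr
        rcases hps.eq_or_lt with rfl | hps'
        · exact min_le_left _ _
        rcases hsr.eq_or_lt with rfl | hsr'
        · exact min_le_right _ _
        have hs : s ∈ Ioo (0 : ℝ) 1 := ⟨hp.1.trans_lt hps', hsr'.trans_le hr.2⟩
        rcases hr.2.eq_or_lt with rfl | hr1
        · exact (min_le_right _ _).trans (hZ1.trans_le (hZ0 s (Ioo_subset_Icc_self hs)))
        have hrI : r ∈ Ioo (0 : ℝ) 1 := ⟨hs.1.trans hsr', hr1⟩
        have key : ∀ p' ∈ Ioo p s, min (Z p') (Z r) ≤ Z s := fun p' hp' => by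
          have hp'I : p' ∈ Ioo (0 : ℝ) 1 := ⟨hp.1.trans_lt hp'.1, hp'.2.trans hs.2⟩
          rw [hZe p' hp'I, hZe r hrI, hZe s hs]
          exact min_le_zFun hw hw_pos hk1 hkn hp'I.1 hp'.2.le hsr hr1
        have hpc : p ∈ closure (Ioo p s) := by
          rw [closure_Ioo hps'.ne]; exact left_mem_Icc.2 hps
        have hcw : ContinuousWithinAt (fun p' => min (Z p') (Z r)) (Ioo p s) p :=
          ((hZc p hp).mono fun p' hp' => ⟨hp.1.trans hp'.1.le, (hp'.2.trans hs.2).le⟩).inf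
            continuousWithinAt_const
        exact hcw.closure_le hpc continuousWithinAt_const key
      Z_one := hZ1
      A_pos := hA0
      W_pos := hW0
      v_mono := hv_mono.monotoneOn
      v_cont := hv_cont
      v_mem := hv_mem
      payment := fun q hq => payment_identity (pay := fun q => mixAlloc n w q * b q)
        (hasDerivAt_mixAlloc n w) (continuous_dMix n w) (fun q hq => dMix_nonneg hw hq)
        hv_mono.monotoneOn hv_cont (hxc.mul hb_cont) (by simp [hb0])
        (fun p hp q hq => by have := hIC p hp q hq; linarith) hq
      -- Imitating the lowest type, who bids zero, yields nonnegative utility.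
      b_le := fun q hq => by
        have h1 := hIC 0 h0 q hq
        rw [hb0, sub_zero] at h1
        have h2 := (mul_nonneg (hv_mem q hq).1 hx0.le).trans h1
        exact sub_nonneg.1 (nonneg_of_mul_nonneg_left h2 (hxpos q hq)) }

/-- The error of the plug-in estimate in terms of the quantiles of the sampled bids. -/
lemma plugInEstimate_sub_eq {n : ℕ} {w : ℕ → ℝ} (hw : ∀ j ≤ n, 0 ≤ w j)
    (hw_pos : ∃ j, 1 ≤ j ∧ j < n ∧ 0 < w j) {v b Z Z' : ℝ → ℝ} {A W : ℝ} {k : ℕ}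
    (S : BidSetup (mixAlloc n w) (dMix n w) Z Z' v b A W)
    (hZ : ∀ q ∈ Ioo (0 : ℝ) 1, Z q = zFun n w k q) (hb : MonotoneOn b (Icc 0 1)) {N : ℕ}
    (hN : 0 < N) {s : Fin N → ℝ} (hs : ∀ j, s j ∈ Icc (0 : ℝ) 1) :
    plugInEstimate n w k (fun i => b (s i)) - multiUnitRevenue n v k
      = ∫ r in (0 : ℝ)..1, (v r - b r) * dMix n w r / mixAlloc n w r
        * ∫ q in r..ecdf s r, mixAlloc n w q * Z' q := by
  have h1 : multiUnitRevenue n v k = -∫ q in (0 : ℝ)..1, mixAlloc n w q * Z' q * b q := by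
    rw [← S.integral_Z_mul, multiUnitRevenue]
    refine integral_congr_Ioo fun q hq => ?_
    have := (dMix_pos hw hw_pos hq).ne'
    rw [hZ q hq, zFun_eq, deriv_knAlloc, revenueCurve]
    field_simp
  have h2 : plugInEstimate n w k (fun i => b (s i))
      = -∫ q in (0 : ℝ)..1, mixAlloc n w q * Z' q * b (empBid s q) := by
    rw [plugInEstimate, ← intervalIntegral.integral_neg]
    refine integral_congr_Ioo fun q hq => ?_
    have h3 : deriv (zFun n w k) q = Z' q := by
      have h4 : zFun n w k =ᶠ[𝓝 q] Z := by
        filter_upwards [Ioo_mem_nhds hq.1 hq.2] with p hp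
        exact (hZ p hp).symm
      rw [h4.deriv_eq, (S.deriv_Z q (Ioo_subset_Icc_self hq)).deriv]
    rw [h3, empBid_comp hN hs hb (Ioo_subset_Ico_self hq)]
  have h3 := S.estimate_sub_eq hN hs
  rw [h1, h2]
  linarith

/-! ### Degenerate unit numbers and positivity of the suprema -/

lemma zFun_eq_zero {n : ℕ} (w : ℕ → ℝ) {k : ℕ} (hk : ¬ (1 ≤ k ∧ k < n)) :
    zFun n w k = fun _ => 0 := by
  funext q
  rw [zFun_eq, dAlloc, allocCoeff_eq_zero hk]
  simp

/-- A constant `x_k` has zero revenue and zero weight, so both terms vanish; this makes the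
convention `0 · ∞ = 0` consistent with the bound. -/
lemma error_eq_zero {n : ℕ} (w : ℕ → ℝ) (v : ℝ → ℝ) {k : ℕ} (hk : ¬ (1 ≤ k ∧ k < n)) {N : ℕ}
    (s : Fin N → ℝ) : plugInEstimate n w k s - multiUnitRevenue n v k = 0 := by
  have h : deriv (knAlloc n k) = fun _ => 0 := by
    rw [deriv_knAlloc]; funext q; rw [dAlloc, allocCoeff_eq_zero hk]; simp
  simp [plugInEstimate, multiUnitRevenue, zFun_eq_zero w hk, h]

lemma supLogDeriv_pos {n : ℕ} {w : ℕ → ℝ} (hw : ∀ j ≤ n, 0 ≤ w j)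
    (hw_pos : ∃ j, 1 ≤ j ∧ j < n ∧ 0 < w j) : 0 < supLogDeriv n w := by
  have h : (1 / 2 : ℝ) ∈ Ioo (0 : ℝ) 1 := by norm_num
  refine lt_of_lt_of_le ?_ (le_iSup₂ (1 / 2 : ℝ) h)
  rw [ENNReal.ofReal_pos, deriv_mixAlloc]
  exact div_pos (dMix_pos hw hw_pos h) (mixAlloc_pos hw hw_pos (Ioo_subset_Ioc_self h))

lemma weighted_eq {n : ℕ} {w : ℕ → ℝ} (k : ℕ) (q : ℝ) :
    (1 - q) * mixAlloc n w q * deriv (knAlloc n k) q / deriv (mixAlloc n w) q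
      = mixAlloc n w q * zFun n w k q := by
  rw [zFun]; ring

lemma supWeighted_pos {n : ℕ} {w : ℕ → ℝ} (hw : ∀ j ≤ n, 0 ≤ w j)
    (hw_pos : ∃ j, 1 ≤ j ∧ j < n ∧ 0 < w j) {k : ℕ} (hk1 : 1 ≤ k) (hkn : k < n) :
    0 < supWeighted n w k := by
  have h : (1 / 2 : ℝ) ∈ Ioo (0 : ℝ) 1 := by norm_num
  refine lt_of_lt_of_le ?_ (le_iSup₂ (1 / 2 : ℝ) h)
  rw [ENNReal.ofReal_pos, weighted_eq, zFun_eq]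
  exact mul_pos (mixAlloc_pos hw hw_pos (Ioo_subset_Ioc_self h))
    (div_pos (mul_pos (sub_pos.2 h.2) (dAlloc_pos hk1 hkn h)) (dMix_pos hw hw_pos h))

end RankAuction

/-! ### The theorem -/

open RankAuction

theorem mainTheorem5
    (n : ℕ) (hn : 2 ≤ n)
    -- the auction: a nonconstant convex combination of the multi-unit auctions
    (w : ℕ → ℝ) (hw : ∀ j ≤ n, 0 ≤ w j) (hw_sum : ∑ j ∈ Finset.range (n + 1), w j = 1)
    (hw_pos : ∃ j, 1 ≤ j ∧ j < n ∧ 0 < w j)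
    -- the value function and the equilibrium bid function, in quantile space
    (v b : ℝ → ℝ)
    (hv_mono : StrictMonoOn v (Icc (0 : ℝ) 1)) (hv_cont : ContinuousOn v (Icc (0 : ℝ) 1))
    (hv_mem : ∀ q ∈ Icc (0 : ℝ) 1, v q ∈ Icc (0 : ℝ) 1)
    (hb_mono : StrictMonoOn b (Icc (0 : ℝ) 1)) (hb_cont : ContinuousOn b (Icc (0 : ℝ) 1))
    (hb : RankAuction.IsFirstPriceBNE n w v b)
    -- the quantity to be estimated
    (k : ℕ) (hk : k ≤ n)
    (hZ : Tendsto (RankAuction.zFun n w k) (𝓝[<] 1) (𝓝 0))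
    -- the sample of `N` independent bids
    (N : ℕ) (hN : 1 ≤ N)
    {Ω : Type*} [MeasurableSpace Ω] (μ : Measure Ω) [IsProbabilityMeasure μ]
    (B : Fin N → Ω → ℝ) (hB_meas : ∀ i, Measurable (B i)) (hB_indep : iIndepFun B μ)
    (hB_law : ∀ i, μ.map (B i) = RankAuction.bidDist b) :
    eLpNorm (fun ω => RankAuction.plugInEstimate n w k (fun i => B i ω)
        - RankAuction.multiUnitRevenue n v k) 2 μ
      ≤ ENNReal.ofReal (Real.sqrt (2 / N))
        * RankAuction.supLogDeriv n w * RankAuction.supWeighted n w k := by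
  by_cases hk' : 1 ≤ k ∧ k < n
  swap
  · simp [error_eq_zero w v hk']
  obtain ⟨hk1, hkn⟩ := hk'
  have hApos := supLogDeriv_pos hw hw_pos
  have hWpos := supWeighted_pos hw hw_pos hk1 hkn
  have hsqrt : ENNReal.ofReal (Real.sqrt (2 / N)) ≠ 0 := by
    have : (0 : ℝ) < N := by exact_mod_cast hN
    exact (ENNReal.ofReal_pos.2 (Real.sqrt_pos.2 (by positivity))).ne'
  -- An infinite supremum makes the right side infinite, because every other factor is nonzero.
  by_cases hAtop : supLogDeriv n w = ⊤
  · rw [hAtop, ENNReal.mul_top hsqrt, ENNReal.top_mul hWpos.ne']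
    exact le_top
  by_cases hWtop : supWeighted n w k = ⊤
  · rw [hWtop, ENNReal.mul_top (mul_ne_zero hsqrt hApos.ne')]
    exact le_top
  have hA : ∀ q ∈ Ioo (0 : ℝ) 1, dMix n w q ≤ (supLogDeriv n w).toReal * mixAlloc n w q := by
    intro q hq
    rw [← div_le_iff₀ (mixAlloc_pos hw hw_pos (Ioo_subset_Ioc_self hq)),
      ← ENNReal.ofReal_le_iff_le_toReal hAtop, ← deriv_mixAlloc]
    exact le_iSup₂ (f := fun q (_ : q ∈ Ioo (0 : ℝ) 1) =>
      ENNReal.ofReal (deriv (mixAlloc n w) q / mixAlloc n w q)) q hq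
  have hW : ∀ q ∈ Ioo (0 : ℝ) 1,
      mixAlloc n w q * zFun n w k q ≤ (supWeighted n w k).toReal := by
    intro q hq
    rw [← ENNReal.ofReal_le_iff_le_toReal hWtop, ← weighted_eq]
    exact le_iSup₂ (f := fun q (_ : q ∈ Ioo (0 : ℝ) 1) => ENNReal.ofReal
      ((1 - q) * mixAlloc n w q * deriv (knAlloc n k) q / deriv (mixAlloc n w) q)) q hq
  obtain ⟨Z, Z', S, hZe⟩ := bidSetup_of_equilibrium hw hw_pos hv_mono hv_cont hv_mem hb_mono
    hb_cont hb hk1 hkn hZ (ENNReal.toReal_pos hApos.ne' hAtop)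
    (ENNReal.toReal_pos hWpos.ne' hWtop) hA hW
  have hU := isUniformSample_bidCDF hb_mono hb_cont hB_meas hB_indep hB_law
  have key := S.eLpNorm_le hN hU
  rw [ENNReal.ofReal_toReal hAtop, ENNReal.ofReal_toReal hWtop] at key
  -- Almost surely every bid lies in the range of `b`, so the sample may be replaced by `b` of its
  -- quantiles.
  refine le_of_eq_of_le (eLpNorm_congr_ae ?_) key
  filter_upwards [ae_bid_eq hb_mono hb_cont hB_meas hB_law] with ω hω
  rw [hω]
  exact plugInEstimate_sub_eq hw hw_pos S hZe hb_mono.monotoneOn hN fun j => hU.mem j ω
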